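/- **Setting.** Let $N\ge 1$ and let $\Omega\subset\mathbb R^N$ be an open set of finite Lebesgue measure. Functions on $\Omega$ are extended by zero to $\mathbb R^N$. For $0<s<1\le p<\infty$ let $$[u]_{s,p}=\Big(\iint_{\mathbb R^N\times\mathbb R^N}\frac{|u(x)-u(y)|^p}{|x-y|^{N+sp}}\,dx\,dy\Big)^{1/p},$$ and at the end points ($0<s\le 1\le p\le\infty$ with $s=1$ or $p=\infty$) let $[u]_{s,p}=\sup_{h\ne0}|h|^{-s}\|u(\cdot+h)-u\|_{L^p(\mathbb R^N)}$ (the Hölder or Lipschitz seminorm if $p=\infty$; comparable to $\|\nabla u\|_p$ if $s=1<p<\infty$, and to the total variation of $u$ if $s=p=1$). Let $W^{s,p}_0(\Omega)=\{u\in L^p(\mathbb R^N): [u]_{s,p}<\infty,\ u=0 \text{ a.e. in }\mathbb R^N\setminus\Omega\}$, normed by $\|u\|_p+[u]_{s,p}$. Let $F_n\colon L^1(\Omega)\to[0,\infty]$ ($n\in\mathbb N$) be functionals such that: * (A1) each $F_n$ is convex and $1$-homogeneous, i.e. $F_n(cv)=|c|F_n(v)$ for all $c\in\mathbb R$ (with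 $0\cdot\infty=0$); * (A2) there are constants $0<\alpha<\beta$ and numbers $p_n\in[1,\infty)$, $s_n\in(0,1)$ with $$\alpha(1-s_n)^{1/p_n}[v]_{s_n,p_n}\le F_n(v)\le\beta(1-s_n)^{1/p_n}[v]_{s_n,p_n}\quad\text{if } v\in W^{s_n,p_n}_0(\Omega),$$ and $F_n(v)=+\infty$ otherwise; * (A3) $p_n\to p_0\in[1,\infty]$ and $s_n\to s_0\in(0,1]$, and there is $F_0\colon L^1(\Omega)\to[0,\infty]$ such that $F_n$ $\Gamma$-converges to $F_0$ in $X$, where $X=L^{p_0}(\Omega)$ if $p_0<\infty$, and $X=C_0(\Omega)$ (the closure of $C_c(\Omega)$ in the supremum norm) if $p_0=\infty$. Let $\mathcal K_{\rm sym}(\Omega)$ be the set of nonempty compact sets $G\subset X$ with $G=-G$, with the Hausdorff distance. For such $G$ let $\gamma(G)\in\mathbb N\cup\{\infty\}$ be the Krasnoselskii genus of $G$ as a subset of $X$: the least $m$ for which there is a continuous odd map $G\to\mathbb R^m\setminus\{0\}$ ($\infty$ if there is none). Let $\mathcal G^k_{s,p}$ be the class of those $G\in\mathcal K_{\rm sym}(\Omega)$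 with $G\subset W^{s,p}_0(\Omega)$, $G$ closed and bounded in $W^{s,p}_0(\Omega)$, $\|u\|_{p}=1$ for all $u\in G$, and $\gamma(G)\ge k$. For $n\ge 0$ (so including the limit index $0$, with $F_0,s_0,p_0$) define $J_n^k\colon\mathcal K_{\rm sym}(\Omega)\to[0,\infty]$ by $$J_n^k(G)=\sup_{v\in G}F_n(v)\ \text{ if } G\in\mathcal G^k_{s_n,p_n},\qquad J_n^k(G)=+\infty\ \text{ otherwise.}$$ **Theorem.** Let $k\ge 1$ be an integer and assume (A1)–(A3). Then: 1. (Equicoercivity) there is $n_0\in\mathbb N$ such that for every $t\in[0,\infty)$ there is a compact set $\mathfrak K\subset\mathcal K_{\rm sym}(\Omega)$ with $\{J_n^k\le t\}\subset\mathfrak K$ for all $n\ge n_0$; 2. ($\liminf$ inequality) if $G_n\to G_0$ in $\mathcal K_{\rm sym}(\Omega)$, then $J_0^k(G_0)\le\liminf_{n\to\infty}J_n^k(G_n)$; 3. $\displaystyle\lim_{n\to\infty}\Big(\inf_{G\in\mathcal K_{\rm sym}(\Omega)}J_n^k(G)\Big)=\inf_{G\in\mathcal K_{\rm sym}(\Omega)}J_0^k(G).$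 -/

import Mathlib

open MeasureTheory Filter Topology Set
open scoped ENNReal NNReal

noncomputable section

namespace FracEig

/-- `N`-dimensional Euclidean space. -/
abbrev Euc (N : ℕ) : Type := EuclideanSpace ℝ (Fin N)

/-- `L^p(Ω)`, for Lebesgue measure on `Ω`. -/
abbrev LpOn {N : ℕ} (Ω : Set (Euc N)) (p : ℝ≥0∞) : Type :=
  Lp ℝ p ((volume : Measure (Euc N)).restrict Ω)

/-- The extension by zero to the whole space of (the class of) a function on `Ω`. -/
def extZero {N : ℕ} {Ω : Set (Euc N)} {p : ℝ≥0∞} (v : LpOn Ω p) : Euc N → ℝ :=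
  Ω.indicator v

/-- The Gagliardo seminorm
`(∬ |u x - u y| ^ p / |x - y| ^ (N + s p) dx dy) ^ (1 / p)` over the whole space. -/
def gagliardo {N : ℕ} (s p : ℝ) (u : Euc N → ℝ) : ℝ≥0∞ :=
  (∫⁻ x, ∫⁻ y, ‖u x - u y‖ₑ ^ p / ‖x - y‖ₑ ^ ((N : ℝ) + s * p)) ^ (1 / p)

/-- The seminorm `sup_{h ≠ 0} ‖u(· + h) - u‖_p / |h| ^ s`, used only at the end points `s = 1`
or `p = ∞`. For `p = ∞` it is the Hölder (for `s = 1` the Lipschitz) seminorm of order `s`. For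
`s = 1` and `1 < p < ∞` it is finite on `L^p` exactly on `W^{1,p}`, where it is comparable to
`‖∇u‖_p`, and for `s = p = 1` it is comparable to the total variation and is finite on `L^1`
exactly on `BV`. -/
def translationSeminorm {N : ℕ} (s : ℝ) (p : ℝ≥0∞) (u : Euc N → ℝ) : ℝ≥0∞ :=
  ⨆ (h : Euc N) (_ : h ≠ 0), eLpNorm (fun x => u (x + h) - u x) p volume / ‖h‖ₑ ^ s

open Classical in
/-- The seminorm `[u]_{s,p}`, for `0 < s ≤ 1 ≤ p ≤ ∞`: Gagliardo's when `s < 1` and `p < ∞`. -/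
def seminormSP {N : ℕ} (s : ℝ) (p : ℝ≥0∞) (u : Euc N → ℝ) : ℝ≥0∞ :=
  if s < 1 ∧ p ≠ ∞ then gagliardo s p.toReal u else translationSeminorm s p u

/-- `‖u‖_p + [u]_{s,p}`, which is equivalent to the norm `(‖u‖_p ^ p + [u]_{s,p} ^ p) ^ (1 / p)`
of `W^{s,p}`. It only serves to say "closed" and "bounded" in `W^{s,p}`. -/
def normSP {N : ℕ} (s : ℝ) (p : ℝ≥0∞) (u : Euc N → ℝ) : ℝ≥0∞ :=
  eLpNorm u p volume + seminormSP s p u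

/-- `v ∈ W_0^{s,p}(Ω)`: the extension of `v` by zero lies in `W^{s,p}` of the whole space. (On an
`Ω` of finite measure every function of `W_0^{s,p}(Ω)` is integrable, so nothing is lost by taking
`v` in `L^1(Ω)`.) -/
def MemW0 {N : ℕ} {Ω : Set (Euc N)} (s : ℝ) (p : ℝ≥0∞) (v : LpOn Ω 1) : Prop :=
  MemLp (extZero v) p volume ∧ seminormSP s p (extZero v) < ∞

/-- Krasnoselskii's genus of a subset of a normed space. -/
def genus {E : Type*} [NormedAddCommGroup E] (A : Set E) : ℕ∞ :=
  ⨅ (m : ℕ) (_ : ∃ φ : E → EuclideanSpace ℝ (Fin m),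
    ContinuousOn φ A ∧ (∀ x ∈ A, φ (-x) = -φ x) ∧ ∀ x ∈ A, φ x ≠ 0), (m : ℕ∞)

/-- The `liminf` inequality of `Γ`-convergence, for `[0, ∞]`-valued functions on a metric space. -/
def GammaLiminf {X : Type*} [MetricSpace X] (F : ℕ → X → ℝ≥0∞) (F₀ : X → ℝ≥0∞) : Prop :=
  ∀ (x : X) (u : ℕ → X), Tendsto u atTop (𝓝 x) →
    F₀ x ≤ liminf (fun n => F n (u n)) atTop

/-- `Γ`-convergence: the `liminf` inequality and the existence of recovery sequences. -/
def GammaConverges {X : Type*} [MetricSpace X] (F : ℕ → X → ℝ≥0∞) (F₀ : X → ℝ≥0∞) : Prop :=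
  GammaLiminf F F₀ ∧
  ∀ x : X, ∃ u : ℕ → X, Tendsto u atTop (𝓝 x) ∧
    limsup (fun n => F n (u n)) atTop ≤ F₀ x

section Spaces

variable {N : ℕ} (Ω : Set (Euc N)) (p₀ : ℝ≥0∞) [Fact (1 ≤ p₀)]

/-- The subspace of (classes of) functions in `C_c(Ω)`. -/
def compactlySupported : Submodule ℝ (LpOn Ω p₀) where
  carrier := {f | ∃ g : Euc N → ℝ, Continuous g ∧ HasCompactSupport g ∧ tsupport g ⊆ Ω ∧
    f =ᵐ[(volume : Measure (Euc N)).restrict Ω] g}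
  zero_mem' := ⟨0, continuous_zero, HasCompactSupport.zero, by simp, Lp.coeFn_zero _ _ _⟩
  add_mem' := by
    rintro f₁ f₂ ⟨g₁, c₁, k₁, t₁, h₁⟩ ⟨g₂, c₂, k₂, t₂, h₂⟩
    exact ⟨g₁ + g₂, c₁.add c₂, k₁.add k₂,
      (tsupport_add g₁ g₂).trans (union_subset t₁ t₂), (Lp.coeFn_add f₁ f₂).trans (h₁.add h₂)⟩
  smul_mem' := by
    rintro c f ⟨g, cg, k, t, h⟩
    exact ⟨c • g, cg.const_smul c, k.smul_left (f := fun _ => c),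
      (closure_mono (Function.support_const_smul_subset c g)).trans t,
      (Lp.coeFn_smul c f).trans (h.const_smul c)⟩

open Classical in
/-- The space in which all convergence takes place: `L^{p₀}(Ω)` if `p₀ < ∞`, and `C_0(Ω)`, the
closure of `C_c(Ω)` in the supremum norm, if `p₀ = ∞`. -/
def baseSpace : Submodule ℝ (LpOn Ω p₀) :=
  if p₀ = ∞ then (compactlySupported Ω p₀).topologicalClosure else ⊤

/-- `K_sym(Ω)`: the nonempty compact symmetric subsets of the base space. Its metric is the
Hausdorff distance. -/
abbrev Ksym : Type :=
  {K : TopologicalSpace.NonemptyCompacts (baseSpace Ω p₀) // ∀ v ∈ K, -v ∈ K}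

variable {Ω p₀}

/-- The inclusion of the base space in `L^1(Ω)`, for `Ω` of finite measure. -/
def toL1 [Fact (volume Ω < ∞)] (v : baseSpace Ω p₀) : LpOn Ω 1 :=
  AddSubgroup.inclusion (Lp.antitone (Fact.out : 1 ≤ p₀)) (v : LpOn Ω p₀)

/-- The class of the `G ⊆ W_0^{s,p}(Ω)` that are closed and bounded in `W_0^{s,p}(Ω)`, lie on the
unit sphere of `L^p(Ω)` and have genus at least `k`. The sets `G` are taken in `K_sym(Ω)`, so they
are symmetric; the genus is that of `G` as a compact subset of the base space. -/
structure Admissible [Fact (volume Ω < ∞)] (k : ℕ) (s : ℝ) (p : ℝ≥0∞) (G : Ksym Ω p₀) :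
    Prop where
  memW0 : ∀ v ∈ G.1, MemW0 s p (toL1 v)
  closed : ∀ w : LpOn Ω 1, MemW0 s p w →
    (∀ ε : ℝ≥0∞, 0 < ε → ∃ v ∈ G.1, normSP s p (extZero (toL1 v - w)) < ε) →
    ∃ v ∈ G.1, toL1 v = w
  bounded : ∃ C : ℝ≥0, ∀ v ∈ G.1, normSP s p (extZero (toL1 v)) ≤ C
  sphere : ∀ v ∈ G.1, eLpNorm (toL1 v) p (volume.restrict Ω) = 1
  genus_ge : (k : ℕ∞) ≤ genus (G.1 : Set (baseSpace Ω p₀))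

open Classical in
/-- The minimax functional `J^k` associated with `F`, `s` and `p`. -/
def J [Fact (volume Ω < ∞)] (k : ℕ) (s : ℝ) (p : ℝ≥0∞) (F : LpOn Ω 1 → ℝ≥0∞)
    (G : Ksym Ω p₀) : ℝ≥0∞ :=
  if Admissible k s p G then ⨆ v ∈ G.1, F (toL1 v) else ∞

end Spaces

/-- Convex and (absolutely) homogeneous of degree one. -/
structure ConvexHomogeneous {E : Type*} [NormedAddCommGroup E] [NormedSpace ℝ E]
    (F : E → ℝ≥0∞) : Prop where
  convex : ∀ (u v : E) (a b : ℝ≥0), a + b = 1 → F (a • u + b • v) ≤ a * F u + b * F v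
  homogeneous : ∀ (c : ℝ) (v : E), F (c • v) = ‖c‖ₑ * F v

/-- `F` is comparable to `(1 - s) ^ (1 / p) [·]_{s,p}` on `W_0^{s,p}(Ω)`, with constants `α` and
`β`, and is infinite off `W_0^{s,p}(Ω)`. -/
structure Comparable {N : ℕ} {Ω : Set (Euc N)} (α β s : ℝ) (p : ℝ≥0∞)
    (F : LpOn Ω 1 → ℝ≥0∞) : Prop where
  lower : ∀ v, MemW0 s p v →
    ENNReal.ofReal (α * (1 - s) ^ (1 / p.toReal)) * seminormSP s p (extZero v) ≤ F v
  upper : ∀ v, MemW0 s p v →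
    F v ≤ ENNReal.ofReal (β * (1 - s) ^ (1 / p.toReal)) * seminormSP s p (extZero v)
  infinite : ∀ v, ¬ MemW0 s p v → F v = ∞

/-- Equicoercivity of the tail of a sequence of functions: from some index `n₀` on, for each
finite level the sublevel sets lie in one and the same compact set. -/
def EventuallyEquicoercive {X : Type*} [TopologicalSpace X] (F : ℕ → X → ℝ≥0∞) : Prop :=
  ∃ n₀ : ℕ, ∀ t : ℝ≥0, ∃ K : Set X, IsCompact K ∧ ∀ n, n₀ ≤ n → {x | F n x ≤ t} ⊆ K

end FracEig

end

/-! The exponents move with `n`, so everything rests on estimates uniform in `p` and `s`. Put g(h) =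
‖u(· + h) - u‖_p. Since g is subadditive, the part of ∫ g^p / |h|^(N+sp) over a dyadic annulus keeps
at least the fraction 2^(-p(1-s)) when the radius is halved. Summing the geometric series bounds
each annulus by p(1-s) times the whole integral, and averaging g(h) ≤ g(k) + g(h-k) over k turns
this into g(h) ≤ C_N |h|^s (1-s)^(1/p) [u]_{s,p} (`eLpNorm_translation_sub_le`). The factor
(1-s)^(1/p) is the one in `Comparable`, so functions of bounded level have uniformly Hölder
continuous translations.

Such functions are approximated by their ball averages in L^q at the rate ε^γ if 0 < γ ≤ s - N(1/p -
1/q) and ε ≤ 1 (`eLpNorm_sub_ballAvg_le`), and one pair q ≥ p₀, γ serves all large n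
(`exists_exponent`). The averages are equicontinuous and uniformly small at infinity, so the
functions of bounded level form a totally bounded set (`totallyBounded_family`). Compactness of the
hyperspace of a compact set then gives equicoercivity.

The same approximation improves L^1 convergence to L^q convergence
(`tendsto_eLpNorm_sub_of_family`), so the norms ‖u_n‖_{p_n} converge to ‖v‖_{p₀} and the sphere
constraint survives. The seminorm bound survives by Fatou's lemma, or at the end points by passing
to the limit in the translation bound (`limit_member`). The genus does not drop
(`le_genus_of_tendsto`). Together with the liminf inequality for the functionals this is the liminf
inequality for `J`, and with equicoercivity it bounds the infima from below.

For the upper bound, a nearly optimal G is replaced by an odd image of itself in a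
finite-dimensional space: finitely many points of G, their recovery sequences, odd coordinates with
Σ|c_i| ≤ 1 (`exists_odd_coordinates`), and division by the L^{p_n} norm (`exists_J_le`). Convexity
and homogeneity control the level, oddness preserves the genus, and the norms divided by are almost
at least 1 (`eventually_le_eLpNorm_add`). -/

noncomputable section

namespace FracEig

/-! ### Subadditive functions and dyadic annuli -/

section DyadicEstimate

variable {N : ℕ}

theorem two_rpow_ne_zero (x : ℝ) : (2 : ℝ≥0∞) ^ x ≠ 0 := by
  simp [ENNReal.rpow_eq_zero_iff]

theorem two_rpow_ne_top (x : ℝ) : (2 : ℝ≥0∞) ^ x ≠ ∞ := by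
  simp [ENNReal.rpow_eq_top_iff]

/-- The half-open annulus of radii `R / 2` and `R`. -/
def annulus (N : ℕ) (R : ℝ) : Set (Euc N) := {h | R / 2 ≤ ‖h‖ ∧ ‖h‖ < R}

theorem measurableSet_annulus (R : ℝ) : MeasurableSet (annulus N R) :=
  (measurableSet_le measurable_const measurable_norm).inter
    (measurableSet_lt measurable_norm measurable_const)

theorem disjoint_annulus {R : ℝ} (hR : 0 < R) :
    Pairwise (Function.onFun Disjoint fun j : ℕ => annulus N (R / 2 ^ j)) := by
  have key : ∀ i j : ℕ, i < j → Disjoint (annulus N (R / 2 ^ i)) (annulus N (R / 2 ^ j)) := by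
    intro i j hij
    refine Set.disjoint_left.2 fun x hx hy => ?_
    have h1 : R / 2 ^ j ≤ R / 2 ^ (i + 1) :=
      div_le_div_of_nonneg_left hR.le (by positivity)
        (pow_le_pow_right₀ (by norm_num) hij)
    have h2 : R / 2 ^ (i + 1) = R / 2 ^ i / 2 := by rw [pow_succ, div_div]
    linarith [hx.1, hy.2]
  intro i j hij
  rcases lt_or_gt_of_ne hij with h | h
  · exact key i j h
  · exact (key j i h).symm

theorem lintegral_comp_two_smul (f : Euc N → ℝ≥0∞) :
    ∫⁻ x, f x = 2 ^ N * ∫⁻ x, f ((2 : ℝ) • x) := by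
  have h2 : (2 : ℝ) ≠ 0 := two_ne_zero
  have hmap := Measure.map_addHaar_smul (volume : Measure (Euc N)) h2
  -- The version for measurable equivalences needs no measurability of `f`.
  have e := lintegral_map_equiv (μ := (volume : Measure (Euc N))) f
    (MeasurableEquiv.smul₀ (2 : ℝ) h2)
  have e' : ∫⁻ x, f ((2 : ℝ) • x) = ((2 : ℝ≥0∞) ^ N)⁻¹ * ∫⁻ x, f x := by
    have : ∫⁻ x, f ((2 : ℝ) • x) = ∫⁻ x, f x ∂(Measure.map (fun x : Euc N => (2 : ℝ) • x) volume) :=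
      e.symm
    rw [this, hmap, lintegral_smul_measure, finrank_euclideanSpace_fin, smul_eq_mul]
    congr 1
    rw [abs_of_pos (by positivity), ENNReal.ofReal_inv_of_pos (by positivity),
      ENNReal.ofReal_pow (by norm_num)]
    simp
  rw [e', ← mul_assoc, ENNReal.mul_inv_cancel (by simp) (by simp), one_mul]

variable {g : Euc N → ℝ≥0∞} {s p : ℝ}

/-- Substitute h = 2x and use g(2x) ≤ 2 g(x): the Jacobian, the numerator and the kernel contribute
2^N · 2^p / 2^(N+sp) = 2^(p(1-s)). -/
theorem annulus_integral_half (hg : ∀ h k, g (h + k) ≤ g h + g k) (hp : 1 ≤ p)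
    (R : ℝ) :
    (2 : ℝ≥0∞) ^ (-(p * (1 - s))) *
        (∫⁻ h in annulus N R, g h ^ p / ‖h‖ₑ ^ ((N : ℝ) + s * p)) ≤
      ∫⁻ h in annulus N (R / 2), g h ^ p / ‖h‖ₑ ^ ((N : ℝ) + s * p) := by
  have hp0 : 0 ≤ p := by linarith
  rw [← lintegral_indicator (measurableSet_annulus R),
    ← lintegral_indicator (measurableSet_annulus (R / 2)), lintegral_comp_two_smul, ← mul_assoc]
  have hc : (2 : ℝ≥0∞) ^ (-(p * (1 - s))) * 2 ^ N = 2 ^ ((N : ℝ) + s * p - p) := by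
    rw [← ENNReal.rpow_natCast, ← ENNReal.rpow_add _ _ two_ne_zero ENNReal.ofNat_ne_top]
    congr 1; ring
  rw [hc, ← lintegral_const_mul' _ _ (two_rpow_ne_top _)]
  refine lintegral_mono fun x => ?_
  by_cases hx : x ∈ annulus N (R / 2)
  · have hx2 : (2 : ℝ) • x ∈ annulus N R := by
      simp only [annulus, mem_ofPred_eq, norm_smul, Real.norm_ofNat] at hx ⊢
      constructor <;> linarith [hx.1, hx.2]
    rw [indicator_of_mem hx, indicator_of_mem hx2]
    have h1 : g ((2 : ℝ) • x) ^ p ≤ 2 ^ p * g x ^ p := by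
      rw [← ENNReal.mul_rpow_of_nonneg _ _ hp0, two_mul, two_smul]
      exact ENNReal.rpow_le_rpow (hg x x) hp0
    have h2 : ‖(2 : ℝ) • x‖ₑ ^ ((N : ℝ) + s * p) =
        2 ^ ((N : ℝ) + s * p) * ‖x‖ₑ ^ ((N : ℝ) + s * p) := by
      rw [enorm_smul, ENNReal.mul_rpow_of_ne_top (by simp) (by simp)]
      congr 2
      rw [← ofReal_norm]; norm_num
    calc 2 ^ ((N : ℝ) + s * p - p) * (g ((2 : ℝ) • x) ^ p / ‖(2 : ℝ) • x‖ₑ ^ ((N : ℝ) + s * p))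
        ≤ 2 ^ ((N : ℝ) + s * p - p) * ((2 ^ p * g x ^ p) /
            (2 ^ ((N : ℝ) + s * p) * ‖x‖ₑ ^ ((N : ℝ) + s * p))) := by
          rw [h2]; gcongr
      _ = (2 ^ ((N : ℝ) + s * p - p) * 2 ^ p) / 2 ^ ((N : ℝ) + s * p) *
            (g x ^ p / ‖x‖ₑ ^ ((N : ℝ) + s * p)) := by
          simp only [div_eq_mul_inv]
          rw [ENNReal.mul_inv (Or.inl (two_rpow_ne_zero _))
            (Or.inl (two_rpow_ne_top _))]
          ring
      _ = g x ^ p / ‖x‖ₑ ^ ((N : ℝ) + s * p) := by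
          rw [← ENNReal.rpow_add _ _ two_ne_zero ENNReal.ofNat_ne_top, sub_add_cancel,
            ENNReal.div_self (two_rpow_ne_zero _)
              (two_rpow_ne_top _), one_mul]
  · have hx2 : (2 : ℝ) • x ∉ annulus N R := by
      simp only [annulus, mem_ofPred_eq, norm_smul, Real.norm_ofNat, not_and, not_lt] at hx ⊢
      intro h
      linarith [hx (by linarith)]
    rw [indicator_of_notMem hx2]
    simp

/-- From e^y ≥ 1 + y at y = -x log 2, and log 2 < 1. -/
theorem one_sub_two_rpow_neg_le {x : ℝ} (hx : 0 < x) :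
    1 - (2 : ℝ≥0∞) ^ (-x) ≤ ENNReal.ofReal x := by
  rw [tsub_le_iff_right]
  have h2 : (2 : ℝ≥0∞) = ENNReal.ofReal 2 := by simp
  rw [h2, ENNReal.ofReal_rpow_of_pos two_pos, ← ENNReal.ofReal_add hx.le (by positivity)]
  rw [← ENNReal.ofReal_one]
  apply ENNReal.ofReal_le_ofReal
  have h1 : -x * Real.log 2 + 1 ≤ Real.exp (-x * Real.log 2) := Real.add_one_le_exp _
  rw [Real.rpow_def_of_pos two_pos, mul_comm (Real.log 2)]
  nlinarith [Real.log_two_lt_d9, Real.log_two_gt_d9]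

/-- The annuli of radii R/2^j are disjoint and carry at least θ^j times the integral over the first,
with θ = 2^(-p(1-s)). So the whole integral is at least (1-θ)⁻¹ times that of one annulus. This is
the source of the factor 1 - s that keeps the estimates alive as s → 1. -/
theorem annulus_integral_le (hg : ∀ h k, g (h + k) ≤ g h + g k) (hp : 1 ≤ p)
    (hs : s < 1) {R : ℝ} (hR : 0 < R) :
    ∫⁻ h in annulus N R, g h ^ p / ‖h‖ₑ ^ ((N : ℝ) + s * p) ≤
      ENNReal.ofReal (p * (1 - s)) * ∫⁻ h, g h ^ p / ‖h‖ₑ ^ ((N : ℝ) + s * p) := by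
  set f : Euc N → ℝ≥0∞ := fun h => g h ^ p / ‖h‖ₑ ^ ((N : ℝ) + s * p)
  set θ : ℝ≥0∞ := (2 : ℝ≥0∞) ^ (-(p * (1 - s))) with hθ
  have hps : 0 < p * (1 - s) := mul_pos (by linarith) (by linarith)
  have hθ1 : θ < 1 := ENNReal.rpow_lt_one_of_one_lt_of_neg (by norm_num) (by linarith)
  have hj : ∀ j : ℕ, θ ^ j * ∫⁻ h in annulus N R, f h ≤ ∫⁻ h in annulus N (R / 2 ^ j), f h := by
    intro j
    induction j with
    | zero => simp
    | succ j ih =>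
      calc θ ^ (j + 1) * ∫⁻ h in annulus N R, f h
          = θ * (θ ^ j * ∫⁻ h in annulus N R, f h) := by rw [pow_succ]; ring
        _ ≤ θ * ∫⁻ h in annulus N (R / 2 ^ j), f h := by gcongr
        _ ≤ _ := by
          rw [pow_succ, ← div_div]
          exact annulus_integral_half hg hp _
  have hsum : (1 - θ)⁻¹ * ∫⁻ h in annulus N R, f h ≤ ∫⁻ h, f h := by
    rw [← ENNReal.tsum_geometric, ← ENNReal.tsum_mul_right]
    calc ∑' j : ℕ, θ ^ j * ∫⁻ h in annulus N R, f h
        ≤ ∑' j : ℕ, ∫⁻ h in annulus N (R / 2 ^ j), f h := ENNReal.tsum_le_tsum hj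
      _ = ∫⁻ h in ⋃ j : ℕ, annulus N (R / 2 ^ j), f h :=
          (lintegral_iUnion (fun j => measurableSet_annulus _) (disjoint_annulus hR) f).symm
      _ ≤ ∫⁻ h, f h := setLIntegral_le_lintegral _ _
  have h0 : 1 - θ ≠ 0 := (tsub_pos_of_lt hθ1).ne'
  have ht : 1 - θ ≠ ∞ := (tsub_le_self.trans_lt ENNReal.one_lt_top).ne
  calc ∫⁻ h in annulus N R, f h
      = (1 - θ) * ((1 - θ)⁻¹ * ∫⁻ h in annulus N R, f h) := by
        rw [← mul_assoc, ENNReal.mul_inv_cancel h0 ht, one_mul]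
    _ ≤ (1 - θ) * ∫⁻ h, f h := by gcongr
    _ ≤ _ := by gcongr; exact one_sub_two_rpow_neg_le hps

/-- Integrate g(h)^p ≤ 2^(p-1) (g(k)^p + g(h-k)^p) over k in the ball of radius |h|/8 about h/2.
Reflection k ↦ h - k preserves this ball, and both k and h - k have norm between 3|h|/8 and 5|h|/8,
hence lie in a single dyadic annulus. -/
theorem mul_measure_ball_le (hgm : Measurable g) (hg : ∀ h k, g (h + k) ≤ g h + g k) (hp : 1 ≤ p)
    {h : Euc N} (hh : h ≠ 0) :
    g h ^ p * volume (Metric.ball ((1 / 2 : ℝ) • h) (‖h‖ / 8)) ≤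
      2 ^ p * ∫⁻ k in annulus N (3 * ‖h‖ / 4), g k ^ p := by
  have hr : 0 < ‖h‖ := norm_pos_iff.2 hh
  set B := Metric.ball ((1 / 2 : ℝ) • h) (‖h‖ / 8)
  set A := annulus N (3 * ‖h‖ / 4)
  have hhalf : ‖(1 / 2 : ℝ) • h‖ = ‖h‖ / 2 := by
    rw [norm_smul]; norm_num; ring
  have hBA : B ⊆ A := by
    intro k hk
    have h1 : ‖k - (1 / 2 : ℝ) • h‖ < ‖h‖ / 8 := mem_ball_iff_norm.1 hk
    have h2 := norm_sub_norm_le k ((1 / 2 : ℝ) • h)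
    have h3 := norm_sub_norm_le ((1 / 2 : ℝ) • h) k
    rw [norm_sub_rev] at h3
    rw [hhalf] at h2 h3
    constructor <;> linarith
  have hBA' : ∀ k ∈ B, h - k ∈ A := by
    intro k hk
    apply hBA
    rw [mem_ball_iff_norm] at hk ⊢
    have : h - k - (1 / 2 : ℝ) • h = -(k - (1 / 2 : ℝ) • h) := by
      have : h = (1 / 2 : ℝ) • h + (1 / 2 : ℝ) • h := by rw [← add_smul]; norm_num
      nth_rewrite 1 [this]
      abel
    rwa [this, norm_neg]
  have hpt : ∀ k, g h ^ p ≤ 2 ^ (p - 1) * (g k ^ p + g (h - k) ^ p) := fun k =>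
    calc g h ^ p ≤ (g k + g (h - k)) ^ p := by
          refine ENNReal.rpow_le_rpow ?_ (by linarith)
          have := hg k (h - k)
          rwa [add_sub_cancel] at this
      _ ≤ _ := ENNReal.rpow_add_le_mul_rpow_add_rpow _ _ hp
  have hB2 : ∫⁻ k in B, g (h - k) ^ p ≤ ∫⁻ k in A, g k ^ p := by
    rw [← lintegral_indicator (measurableSet_annulus _),
      ← lintegral_sub_left_eq_self (A.indicator fun k => g k ^ p) h,
      ← lintegral_indicator Metric.isOpen_ball.measurableSet]
    refine lintegral_mono fun k => ?_
    by_cases hk : k ∈ B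
    · rw [indicator_of_mem hk, indicator_of_mem (hBA' k hk)]
    · rw [indicator_of_notMem hk]; exact zero_le
  calc g h ^ p * volume B = ∫⁻ _ in B, g h ^ p := by rw [setLIntegral_const]
    _ ≤ ∫⁻ k in B, 2 ^ (p - 1) * (g k ^ p + g (h - k) ^ p) := lintegral_mono fun k => hpt k
    _ = 2 ^ (p - 1) * ((∫⁻ k in B, g k ^ p) + ∫⁻ k in B, g (h - k) ^ p) := by
        rw [lintegral_const_mul' _ _ (two_rpow_ne_top _), lintegral_add_left (hgm.pow_const p)]
    _ ≤ 2 ^ (p - 1) * ((∫⁻ k in A, g k ^ p) + ∫⁻ k in A, g k ^ p) := by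
        gcongr
    _ = 2 ^ p * ∫⁻ k in A, g k ^ p := by
        rw [← two_mul, ← mul_assoc]
        congr 1
        nth_rewrite 2 [← ENNReal.rpow_one 2]
        rw [← ENNReal.rpow_add _ _ two_ne_zero ENNReal.ofNat_ne_top, sub_add_cancel]

theorem lintegral_annulus_le (hs : 0 < s) (hp : 1 ≤ p) {R : ℝ} (hR : 0 < R) :
    ∫⁻ k in annulus N R, g k ^ p ≤ ENNReal.ofReal (R ^ ((N : ℝ) + s * p)) *
      ∫⁻ k in annulus N R, g k ^ p / ‖k‖ₑ ^ ((N : ℝ) + s * p) := by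
  rw [← lintegral_const_mul' _ _ ENNReal.ofReal_ne_top]
  refine setLIntegral_mono' (measurableSet_annulus R) fun k hk => ?_
  have hk0 : 0 < ‖k‖ := lt_of_lt_of_le (by linarith) hk.1
  have he : (0 : ℝ) ≤ (N : ℝ) + s * p := by positivity
  have hle : ‖k‖ₑ ^ ((N : ℝ) + s * p) ≤ ENNReal.ofReal (R ^ ((N : ℝ) + s * p)) := by
    rw [← ofReal_norm, ENNReal.ofReal_rpow_of_pos hk0]
    exact ENNReal.ofReal_le_ofReal (Real.rpow_le_rpow hk0.le hk.2.le he)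
  have hk1 : ‖k‖ₑ ^ ((N : ℝ) + s * p) ≠ 0 := by
    rw [← ofReal_norm, ENNReal.ofReal_rpow_of_pos hk0]
    simp only [ne_eq, ENNReal.ofReal_eq_zero, not_le]
    positivity
  calc g k ^ p = ‖k‖ₑ ^ ((N : ℝ) + s * p) * (g k ^ p / ‖k‖ₑ ^ ((N : ℝ) + s * p)) := by
        rw [ENNReal.mul_div_cancel hk1]
        exact ENNReal.rpow_ne_top_of_nonneg he enorm_ne_top
    _ ≤ _ := by gcongr

/-- A constant in the estimate of translations by the Gagliardo seminorm. -/
def translationConst (N : ℕ) : ℝ :=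
  4 * max 1 (6 ^ N / (volume (Metric.ball (0 : Euc N) 1)).toReal)

theorem translationConst_pos (N : ℕ) : 0 < translationConst N := by
  unfold translationConst; positivity

theorem unitBall_toReal_pos (N : ℕ) : 0 < (volume (Metric.ball (0 : Euc N) 1)).toReal :=
  ENNReal.toReal_pos (Metric.measure_ball_pos _ _ one_pos).ne' measure_ball_lt_top.ne

theorem translationConst_bound (hs : 0 < s) (hp : 1 ≤ p) {r : ℝ} (hr : 0 < r) :
    2 ^ p * p * (3 * r / 4) ^ ((N : ℝ) + s * p) ≤
      translationConst N ^ p * r ^ (s * p) *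
        ((r / 8) ^ N * (volume (Metric.ball (0 : Euc N) 1)).toReal) := by
  set w := (volume (Metric.ball (0 : Euc N) 1)).toReal with hw
  have hw0 : 0 < w := unitBall_toReal_pos N
  -- Bernoulli. The factor p from `annulus_integral_le` is thus absorbed in a p-th power, so it
  -- disappears into the constant when the root is taken.
  have hp2 : p ≤ 2 ^ p := by
    have := one_add_mul_self_le_rpow_one_add (s := 1) (by norm_num) hp
    norm_num at this; linarith
  have hC : 2 ^ p * 2 ^ p * (6 ^ N / w) ≤ translationConst N ^ p := by
    unfold translationConst
    rw [Real.mul_rpow (by norm_num) (by positivity), ← Real.mul_rpow (by norm_num) (by norm_num)]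
    norm_num only
    gcongr
    calc (6 : ℝ) ^ N / w ≤ max 1 (6 ^ N / w) := le_max_right _ _
      _ = max 1 (6 ^ N / w) ^ (1 : ℝ) := (Real.rpow_one _).symm
      _ ≤ _ := Real.rpow_le_rpow_of_exponent_le (le_max_left _ _) hp
  have hR : (3 * r / 4) ^ ((N : ℝ) + s * p) ≤ (3 / 4) ^ N * r ^ N * r ^ (s * p) := by
    rw [Real.rpow_add (by positivity), Real.rpow_natCast, ← mul_pow,
      show 3 / 4 * r = 3 * r / 4 by ring]
    gcongr
    linarith
  calc 2 ^ p * p * (3 * r / 4) ^ ((N : ℝ) + s * p)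
      ≤ 2 ^ p * 2 ^ p * ((3 / 4) ^ N * r ^ N * r ^ (s * p)) := by gcongr
    _ = 2 ^ p * 2 ^ p * (6 ^ N / w) * r ^ (s * p) * ((r / 8) ^ N * w) := by
        -- 6 = 8 · 3/4: the ratio of the radius 3r/4 of the annulus to the radius r/8 of the ball.
        have : (6 : ℝ) ^ N * (r / 8) ^ N = (3 / 4) ^ N * r ^ N := by
          rw [← mul_pow, ← mul_pow]; congr 1; ring
        field_simp
        rw [← this]
    _ ≤ _ := by gcongr

/-- Chain the ball estimate, the kernel bound on the annulus and the dyadic estimate, divide by the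
measure of the ball and take p-th roots. The constant depends on neither s nor p. -/
theorem subadditive_le_of_integral (hgm : Measurable g) (hg : ∀ h k, g (h + k) ≤ g h + g k)
    (hs : 0 < s) (hs1 : s < 1) (hp : 1 ≤ p) {h : Euc N} (hh : h ≠ 0) :
    g h ≤ ENNReal.ofReal (translationConst N * ‖h‖ ^ s) * (ENNReal.ofReal ((1 - s) ^ (1 / p)) *
      (∫⁻ k, g k ^ p / ‖k‖ₑ ^ ((N : ℝ) + s * p)) ^ (1 / p)) := by
  have hr : 0 < ‖h‖ := norm_pos_iff.2 hh
  have hp0 : 0 < p := by linarith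
  have hR : 0 < 3 * ‖h‖ / 4 := by positivity
  have hC := translationConst_pos N
  set S := ∫⁻ k, g k ^ p / ‖k‖ₑ ^ ((N : ℝ) + s * p)
  set w := (volume (Metric.ball (0 : Euc N) 1)).toReal with hw
  have hw0 : 0 < w := unitBall_toReal_pos N
  have hball : volume (Metric.ball ((1 / 2 : ℝ) • h) (‖h‖ / 8)) =
      ENNReal.ofReal ((‖h‖ / 8) ^ N * w) := by
    rw [Measure.addHaar_ball_of_pos _ _ (by positivity), finrank_euclideanSpace_fin,
      ENNReal.ofReal_mul (by positivity), hw, ENNReal.ofReal_toReal measure_ball_lt_top.ne]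
  set a := (‖h‖ / 8) ^ N * w
  have ha : 0 < a := by positivity
  have h1s : 0 < 1 - s := by linarith
  have hmain : g h ^ p * ENNReal.ofReal a ≤
      (ENNReal.ofReal (translationConst N ^ p * ‖h‖ ^ (s * p) * (1 - s)) * S) *
        ENNReal.ofReal a := by
    calc g h ^ p * ENNReal.ofReal a ≤ 2 ^ p * ∫⁻ k in annulus N (3 * ‖h‖ / 4), g k ^ p :=
          hball ▸ mul_measure_ball_le hgm hg hp hh
      _ ≤ 2 ^ p * (ENNReal.ofReal ((3 * ‖h‖ / 4) ^ ((N : ℝ) + s * p)) *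
            (ENNReal.ofReal (p * (1 - s)) * S)) := by
          gcongr
          refine (lintegral_annulus_le hs hp hR).trans ?_
          gcongr
          exact annulus_integral_le hg hp hs1 hR
      _ = ENNReal.ofReal ((2 ^ p * p * (3 * ‖h‖ / 4) ^ ((N : ℝ) + s * p)) * (1 - s)) * S := by
          have : (2 : ℝ≥0∞) ^ p = ENNReal.ofReal (2 ^ p) := by
            rw [← ENNReal.ofReal_rpow_of_pos two_pos]; simp
          rw [this, ← mul_assoc, ← mul_assoc, ← ENNReal.ofReal_mul (by positivity),
            ← ENNReal.ofReal_mul (by positivity)]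
          congr 2; ring
      _ ≤ ENNReal.ofReal ((translationConst N ^ p * ‖h‖ ^ (s * p) * a) * (1 - s)) * S := by
          refine mul_le_mul_left (ENNReal.ofReal_le_ofReal ?_) S
          exact mul_le_mul_of_nonneg_right (translationConst_bound hs hp hr) h1s.le
      _ = _ := by
          rw [mul_right_comm, mul_comm _ S, ENNReal.ofReal_mul (by positivity)]; ring
  have hmain' := (ENNReal.mul_le_mul_iff_left (ENNReal.ofReal_pos.2 ha).ne'
    ENNReal.ofReal_ne_top).1 hmain
  calc g h = (g h ^ p) ^ (1 / p) := by
        rw [← ENNReal.rpow_mul, mul_one_div_cancel hp0.ne', ENNReal.rpow_one]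
    _ ≤ (ENNReal.ofReal (translationConst N ^ p * ‖h‖ ^ (s * p) * (1 - s)) * S) ^ (1 / p) :=
        ENNReal.rpow_le_rpow hmain' (by positivity)
    _ = _ := by
        rw [ENNReal.mul_rpow_of_nonneg _ _ (by positivity), ← mul_assoc]
        congr 1
        rw [ENNReal.ofReal_rpow_of_pos (by positivity), ← ENNReal.ofReal_mul (by positivity),
          Real.mul_rpow (by positivity) (by positivity), Real.mul_rpow (by positivity)
            (by positivity), ← Real.rpow_mul hC.le, ← Real.rpow_mul hr.le]
        rw [mul_assoc s, mul_one_div_cancel hp0.ne', mul_one, Real.rpow_one]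

end DyadicEstimate

/-! ### Translations and the Gagliardo seminorm -/

section Translation

variable {N : ℕ} {u : Euc N → ℝ}

theorem measurable_translation_sub (hu : Measurable u) (h : Euc N) :
    Measurable fun x => u (x + h) - u x :=
  (hu.comp (measurable_add_const h)).sub hu

theorem eLpNorm_translation (hu : AEStronglyMeasurable u volume) (p : ℝ≥0∞) (h : Euc N) :
    eLpNorm (fun x => u (x + h)) p volume = eLpNorm u p volume :=
  eLpNorm_comp_measurePreserving hu (measurePreserving_add_right volume h)

theorem eLpNorm_translation_sub_add_le (hu : Measurable u) {p : ℝ≥0∞} (hp : 1 ≤ p)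
    (h k : Euc N) :
    eLpNorm (fun x => u (x + (h + k)) - u x) p volume ≤
      eLpNorm (fun x => u (x + h) - u x) p volume + eLpNorm (fun x => u (x + k) - u x) p volume := by
  have e : (fun x => u (x + (h + k)) - u x) =
      (fun x => u (x + k + h) - u (x + k)) + fun x => u (x + k) - u x := by
    ext x
    simp only [Pi.add_apply]
    rw [add_comm h k, ← add_assoc]; ring
  have hm := (measurable_translation_sub hu h)
  rw [e]
  refine (eLpNorm_add_le (hm.comp (measurable_add_const k)).aestronglyMeasurable
    (measurable_translation_sub hu k).aestronglyMeasurable hp).trans ?_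
  gcongr
  exact (eLpNorm_translation hm.aestronglyMeasurable p k).le

theorem measurable_uncurry_translation_sub (hu : Measurable u) :
    Measurable (Function.uncurry fun (h x : Euc N) => u (x + h) - u x) :=
  (hu.comp (measurable_snd.add measurable_fst)).sub (hu.comp measurable_snd)

theorem measurable_eLpNorm_translation_sub (hu : Measurable u) {p : ℝ≥0∞} (hp : 1 ≤ p)
    (hpt : p ≠ ∞) :
    Measurable fun h : Euc N => eLpNorm (fun x => u (x + h) - u x) p volume := by
  simp_rw [eLpNorm_eq_lintegral_rpow_enorm_toReal (one_pos.trans_le hp).ne' hpt]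
  refine Measurable.pow_const ?_ _
  exact Measurable.lintegral_prod_right
    (((measurable_uncurry_translation_sub hu).enorm).pow_const _)

/-- Substitute y = x + h and apply Tonelli. In this form the estimates for subadditive functions
apply. -/
theorem gagliardo_eq_translation (hu : Measurable u) (s : ℝ) {p : ℝ≥0∞} (hp : 1 ≤ p)
    (hpt : p ≠ ∞) :
    gagliardo s p.toReal u = (∫⁻ h, eLpNorm (fun x => u (x + h) - u x) p volume ^ p.toReal /
      ‖h‖ₑ ^ ((N : ℝ) + s * p.toReal)) ^ (1 / p.toReal) := by
  have hp0 : p ≠ 0 := (one_pos.trans_le hp).ne'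
  have hpr : p.toReal ≠ 0 := (ENNReal.toReal_pos hp0 hpt).ne'
  unfold gagliardo
  congr 1
  have hm : Measurable (Function.uncurry fun (x h : Euc N) =>
      ‖u (x + h) - u x‖ₑ ^ p.toReal / ‖h‖ₑ ^ ((N : ℝ) + s * p.toReal)) := by
    have h1 := (measurable_uncurry_translation_sub hu).comp
      (measurable_swap (α := Euc N) (β := Euc N))
    exact (h1.enorm.pow_const _).div (measurable_snd.enorm.pow_const _)
  calc ∫⁻ x, ∫⁻ y, ‖u x - u y‖ₑ ^ p.toReal / ‖x - y‖ₑ ^ ((N : ℝ) + s * p.toReal)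
      = ∫⁻ x, ∫⁻ h, ‖u (x + h) - u x‖ₑ ^ p.toReal / ‖h‖ₑ ^ ((N : ℝ) + s * p.toReal) := by
        refine lintegral_congr fun x => ?_
        rw [← lintegral_add_left_eq_self _ x]
        refine lintegral_congr fun h => ?_
        rw [enorm_sub_rev, enorm_sub_rev x]
        simp
    _ = ∫⁻ h, ∫⁻ x, ‖u (x + h) - u x‖ₑ ^ p.toReal / ‖h‖ₑ ^ ((N : ℝ) + s * p.toReal) :=
        lintegral_lintegral_swap hm.aemeasurable
    _ = _ := by
        refine lintegral_congr fun h => ?_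
        rw [eLpNorm_eq_lintegral_rpow_enorm_toReal hp0 hpt, ← ENNReal.rpow_mul,
          one_div_mul_cancel hpr, ENNReal.rpow_one]
        simp only [div_eq_mul_inv]
        rw [lintegral_mul_const _ ((measurable_translation_sub hu h).enorm.pow_const _)]

/-- Translations are controlled by the Gagliardo seminorm, with the factor `(1 - s) ^ (1 / p)` and
with a constant depending only on the dimension. -/
theorem eLpNorm_translation_sub_le (hu : Measurable u) {s : ℝ} (hs : 0 < s) (hs1 : s < 1)
    {p : ℝ≥0∞} (hp : 1 ≤ p) (hpt : p ≠ ∞) (h : Euc N) :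
    eLpNorm (fun x => u (x + h) - u x) p volume ≤
      ENNReal.ofReal (translationConst N * ‖h‖ ^ s) *
        (ENNReal.ofReal ((1 - s) ^ (1 / p.toReal)) * gagliardo s p.toReal u) := by
  rcases eq_or_ne h 0 with rfl | hh
  · simp
  rw [gagliardo_eq_translation hu s hp hpt]
  have hpr : 1 ≤ p.toReal := by
    rw [← ENNReal.toReal_one]; exact ENNReal.toReal_mono hpt hp
  exact subadditive_le_of_integral (measurable_eLpNorm_translation_sub hu hp hpt)
    (eLpNorm_translation_sub_add_le hu hp) hs hs1 hpr hh

end Translation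

/-! ### Approximation by ball averages -/

section Averages

variable {N : ℕ} {u : Euc N → ℝ}

/-- The uniform probability measure on the ball of radius `ε` about the origin. -/
def ballMeasure (N : ℕ) (ε : ℝ) : Measure (Euc N) :=
  (volume (Metric.ball (0 : Euc N) ε))⁻¹ • volume.restrict (Metric.ball (0 : Euc N) ε)

theorem volume_ball_ne_zero {ε : ℝ} (hε : 0 < ε) : volume (Metric.ball (0 : Euc N) ε) ≠ 0 :=
  (Metric.measure_ball_pos _ _ hε).ne'

theorem isProbabilityMeasure_ballMeasure {ε : ℝ} (hε : 0 < ε) :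
    IsProbabilityMeasure (ballMeasure N ε) := by
  constructor
  rw [ballMeasure, Measure.smul_apply, Measure.restrict_apply_univ, smul_eq_mul,
    ENNReal.inv_mul_cancel (volume_ball_ne_zero hε) measure_ball_lt_top.ne]

/-- For ε ≤ 0 the measure is zero. Allowing this lets `measurable_ballAvg` do without a sign
condition. -/
instance isFiniteMeasure_ballMeasure (ε : ℝ) : IsFiniteMeasure (ballMeasure N ε) := by
  constructor
  rcases le_or_gt ε 0 with hε | hε
  · simp [ballMeasure, Metric.ball_eq_empty.2 hε]
  · have := isProbabilityMeasure_ballMeasure (N := N) hε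
    exact measure_lt_top _ _

theorem ae_mem_ball_ballMeasure (ε : ℝ) : ∀ᵐ z ∂(ballMeasure N ε), z ∈ Metric.ball (0 : Euc N) ε :=
  Measure.ae_smul_measure (ae_restrict_mem Metric.isOpen_ball.measurableSet) _

theorem ballMeasure_le (ε : ℝ) :
    ballMeasure N ε ≤ (volume (Metric.ball (0 : Euc N) ε))⁻¹ • volume := by
  intro s
  simp only [ballMeasure, Measure.smul_apply, smul_eq_mul]
  gcongr
  exact Measure.restrict_le_self

theorem eLpNorm_ballMeasure_le {f : Euc N → ℝ} (hf : Measurable f) {p : ℝ≥0∞} (hpt : p ≠ ∞)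
    (ε : ℝ) (x : Euc N) :
    eLpNorm (fun z => f (x + z)) p (ballMeasure N ε) ≤
      (volume (Metric.ball (0 : Euc N) ε))⁻¹ ^ (1 / p.toReal) * eLpNorm f p volume := by
  refine (eLpNorm_mono_measure _ (ballMeasure_le ε)).trans ?_
  rw [eLpNorm_smul_measure_of_ne_top hpt, smul_eq_mul,
    show (1 / p).toReal = 1 / p.toReal by simp]
  gcongr
  have := eLpNorm_translation hf.aestronglyMeasurable p x
  rw [show (fun z => f (x + z)) = fun z => f (z + x) from funext fun z => by rw [add_comm]]
  exact this.le

theorem lintegral_ballMeasure_le {f : Euc N → ℝ} (hf : Measurable f) {p : ℝ≥0∞} (hp : 1 ≤ p)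
    (hpt : p ≠ ∞) {ε : ℝ} (hε : 0 < ε) (x : Euc N) :
    ∫⁻ z, ‖f (x + z)‖ₑ ∂(ballMeasure N ε) ≤
      (volume (Metric.ball (0 : Euc N) ε))⁻¹ ^ (1 / p.toReal) * eLpNorm f p volume := by
  have := isProbabilityMeasure_ballMeasure (N := N) hε
  rw [← eLpNorm_one_eq_lintegral_enorm]
  exact (eLpNorm_le_eLpNorm_of_exponent_le hp
    (hf.comp (measurable_const_add x)).aestronglyMeasurable).trans
    (eLpNorm_ballMeasure_le hf hpt ε x)

theorem integrable_ballMeasure (hu : Measurable u) {p : ℝ≥0∞} (hp : 1 ≤ p)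
    (hpt : p ≠ ∞) (hup : MemLp u p volume) {ε : ℝ} (hε : 0 < ε) (x : Euc N) :
    Integrable (fun z => u (x + z)) (ballMeasure N ε) := by
  refine ⟨(hu.comp (measurable_const_add x)).aestronglyMeasurable, ?_⟩
  refine (lintegral_ballMeasure_le hu hp hpt hε x).trans_lt (ENNReal.mul_lt_top ?_ hup.2)
  refine ENNReal.rpow_lt_top_of_nonneg (by positivity) ?_
  exact ENNReal.inv_ne_top.2 (volume_ball_ne_zero hε)

/-- The average of `u` over the ball of radius `ε` about `x`. -/
def ballAvg (ε : ℝ) (u : Euc N → ℝ) (x : Euc N) : ℝ := ∫ z, u (x + z) ∂(ballMeasure N ε)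

theorem measurable_uncurry_translation (hu : Measurable u) :
    Measurable (Function.uncurry fun (x z : Euc N) => u (x + z)) :=
  hu.comp (measurable_fst.add measurable_snd)

theorem measurable_ballAvg (hu : Measurable u) (ε : ℝ) : Measurable (ballAvg ε u) :=
  (StronglyMeasurable.integral_prod_right
    (measurable_uncurry_translation hu).stronglyMeasurable).measurable

theorem enorm_ballAvg_sub_le (hu : Measurable u) {p : ℝ≥0∞} (hp : 1 ≤ p)
    (hpt : p ≠ ∞) (hup : MemLp u p volume) {ε : ℝ} (hε : 0 < ε) (x : Euc N) (c : ℝ) :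
    ‖ballAvg ε u x - c‖ₑ ≤ ∫⁻ z, ‖u (x + z) - c‖ₑ ∂(ballMeasure N ε) := by
  have := isProbabilityMeasure_ballMeasure (N := N) hε
  have e : ballAvg ε u x - c = ∫ z, (u (x + z) - c) ∂(ballMeasure N ε) := by
    rw [integral_sub (integrable_ballMeasure hu hp hpt hup hε x) (integrable_const c)]
    simp [ballAvg]
  rw [e]
  exact enorm_integral_le_lintegral_enorm _

theorem enorm_ballAvg_le (hu : Measurable u) {p : ℝ≥0∞} (hp : 1 ≤ p)
    (hpt : p ≠ ∞) {ε : ℝ} (hε : 0 < ε) (x : Euc N) :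
    ‖ballAvg ε u x‖ₑ ≤
      (volume (Metric.ball (0 : Euc N) ε))⁻¹ ^ (1 / p.toReal) * eLpNorm u p volume :=
  (enorm_integral_le_lintegral_enorm _).trans (lintegral_ballMeasure_le hu hp hpt hε x)

/-- The difference of the averages is the average about y of the translation difference by x - y. -/
theorem enorm_ballAvg_sub_ballAvg_le (hu : Measurable u) {p : ℝ≥0∞} (hp : 1 ≤ p)
    (hpt : p ≠ ∞) (hup : MemLp u p volume) {ε : ℝ} (hε : 0 < ε) (x y : Euc N) :
    ‖ballAvg ε u x - ballAvg ε u y‖ₑ ≤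
      (volume (Metric.ball (0 : Euc N) ε))⁻¹ ^ (1 / p.toReal) *
        eLpNorm (fun z => u (z + (x - y)) - u z) p volume := by
  have e : ballAvg ε u x - ballAvg ε u y =
      ∫ z, (u (y + z + (x - y)) - u (y + z)) ∂(ballMeasure N ε) := by
    unfold ballAvg
    rw [← integral_sub (integrable_ballMeasure hu hp hpt hup hε x)
      (integrable_ballMeasure hu hp hpt hup hε y)]
    congr 1 with z
    congr 2
    abel
  rw [e]
  exact (enorm_integral_le_lintegral_enorm _).trans
    (lintegral_ballMeasure_le (measurable_translation_sub hu (x - y)) hp hpt hε y)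

/-- Translations of `u` are Hölder continuous of order `s` in `L^p`, with constant `C`. -/
def TranslationBound (u : Euc N → ℝ) (p : ℝ≥0∞) (s C : ℝ) : Prop :=
  ∀ h : Euc N, eLpNorm (fun x => u (x + h) - u x) p volume ≤ ENNReal.ofReal (C * ‖h‖ ^ s)

theorem TranslationBound.of_norm_le {p : ℝ≥0∞} {s C : ℝ} (h : TranslationBound u p s C)
    (hs : 0 < s) (hC : 0 < C) {ε : ℝ} {z : Euc N} (hz : z ∈ Metric.ball (0 : Euc N) ε) :
    eLpNorm (fun x => u (x + z) - u x) p volume ≤ ENNReal.ofReal (C * ε ^ s) := by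
  refine (h z).trans (ENNReal.ofReal_le_ofReal ?_)
  have : ‖z‖ < ε := mem_ball_zero_iff.1 hz
  gcongr

/-- Jensen's inequality for the probability measure on the ball, then Tonelli, so that only
translations by vectors of norm below ε occur. -/
theorem eLpNorm_ballAvg_sub_le (hu : Measurable u) {p : ℝ≥0∞} (hp : 1 ≤ p)
    (hpt : p ≠ ∞) (hup : MemLp u p volume) {s C : ℝ} (h : TranslationBound u p s C)
    (hs : 0 < s) (hC : 0 < C) {ε : ℝ} (hε : 0 < ε) :
    eLpNorm (fun x => ballAvg ε u x - u x) p volume ≤ ENNReal.ofReal (C * ε ^ s) := by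
  have hpm := isProbabilityMeasure_ballMeasure (N := N) hε
  have hp0 : p ≠ 0 := (one_pos.trans_le hp).ne'
  have hpr : 0 < p.toReal := ENNReal.toReal_pos hp0 hpt
  set K := ENNReal.ofReal (C * ε ^ s)
  have hm : Measurable (Function.uncurry fun (x z : Euc N) => ‖u (x + z) - u x‖ₑ ^ p.toReal) :=
    ((measurable_uncurry_translation hu).sub (hu.comp measurable_fst)).enorm.pow_const _
  have h1 : ∀ x, ‖ballAvg ε u x - u x‖ₑ ^ p.toReal ≤
      ∫⁻ z, ‖u (x + z) - u x‖ₑ ^ p.toReal ∂(ballMeasure N ε) := by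
    intro x
    have hmx : Measurable fun z => u (x + z) - u x :=
      (hu.comp (measurable_const_add x)).sub_const _
    calc ‖ballAvg ε u x - u x‖ₑ ^ p.toReal
        ≤ eLpNorm (fun z => u (x + z) - u x) p (ballMeasure N ε) ^ p.toReal := by
          refine ENNReal.rpow_le_rpow ?_ hpr.le
          refine (enorm_ballAvg_sub_le hu hp hpt hup hε x _).trans ?_
          rw [← eLpNorm_one_eq_lintegral_enorm]
          exact eLpNorm_le_eLpNorm_of_exponent_le hp hmx.aestronglyMeasurable
      _ = _ := by
          rw [eLpNorm_eq_lintegral_rpow_enorm_toReal hp0 hpt, ← ENNReal.rpow_mul,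
            one_div_mul_cancel hpr.ne', ENNReal.rpow_one]
  have h2 : ∫⁻ x, ‖ballAvg ε u x - u x‖ₑ ^ p.toReal ≤ K ^ p.toReal := by
    calc ∫⁻ x, ‖ballAvg ε u x - u x‖ₑ ^ p.toReal
        ≤ ∫⁻ x, ∫⁻ z, ‖u (x + z) - u x‖ₑ ^ p.toReal ∂(ballMeasure N ε) := lintegral_mono h1
      _ = ∫⁻ z, (∫⁻ x, ‖u (x + z) - u x‖ₑ ^ p.toReal) ∂(ballMeasure N ε) :=
          lintegral_lintegral_swap hm.aemeasurable
      _ ≤ ∫⁻ _, K ^ p.toReal ∂(ballMeasure N ε) := by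
          refine lintegral_mono_ae ?_
          filter_upwards [ae_mem_ball_ballMeasure ε] with z hz
          have := h.of_norm_le hs hC hz
          rw [eLpNorm_eq_lintegral_rpow_enorm_toReal hp0 hpt] at this
          have h3 := ENNReal.rpow_le_rpow this hpr.le
          rwa [← ENNReal.rpow_mul, one_div_mul_cancel hpr.ne', ENNReal.rpow_one] at h3
      _ = K ^ p.toReal := by simp
  rw [eLpNorm_eq_lintegral_rpow_enorm_toReal hp0 hpt]
  calc _ ≤ (K ^ p.toReal) ^ (1 / p.toReal) := ENNReal.rpow_le_rpow h2 (by positivity)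
    _ = K := by rw [← ENNReal.rpow_mul, mul_one_div_cancel hpr.ne', ENNReal.rpow_one]

/-- Comparison of averages over balls of two radii, by means of the double average. -/
theorem enorm_ballAvg_sub_ballAvg_radius_le (hu : Measurable u) {p : ℝ≥0∞} (hp : 1 ≤ p)
    (hpt : p ≠ ∞) (hup : MemLp u p volume) {s C : ℝ} (h : TranslationBound u p s C)
    (hs : 0 < s) (hC : 0 < C) {ε δ : ℝ} (hε : 0 < ε) (hδ : 0 < δ) (x : Euc N) :
    ‖ballAvg ε u x - ballAvg δ u x‖ₑ ≤
      (volume (Metric.ball (0 : Euc N) ε))⁻¹ ^ (1 / p.toReal) * ENNReal.ofReal (C * δ ^ s) +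
      (volume (Metric.ball (0 : Euc N) δ))⁻¹ ^ (1 / p.toReal) * ENNReal.ofReal (C * ε ^ s) := by
  have hpm := isProbabilityMeasure_ballMeasure (N := N) hε
  have hpm' := isProbabilityMeasure_ballMeasure (N := N) hδ
  set μ := ballMeasure N ε with hμ
  set ν := ballMeasure N δ with hν
  have hzw : Measurable (Function.uncurry fun (w z : Euc N) => u (x + z + w)) :=
    hu.comp ((measurable_snd.const_add x).add measurable_fst)
  have hz : Measurable (Function.uncurry fun (_ z : Euc N) => u (x + z)) :=
    hu.comp (measurable_snd.const_add x)
  have hw : Measurable (Function.uncurry fun (w _ : Euc N) => u (x + w)) :=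
    hu.comp (measurable_fst.const_add x)
  have bound : ∀ {η θ : ℝ}, 0 < η → ∀ w ∈ Metric.ball (0 : Euc N) θ,
      ∫⁻ z, ‖u (x + z + w) - u (x + z)‖ₑ ∂(ballMeasure N η) ≤
        (volume (Metric.ball (0 : Euc N) η))⁻¹ ^ (1 / p.toReal) * ENNReal.ofReal (C * θ ^ s) := by
    intro η θ hη w hw
    refine (lintegral_ballMeasure_le (measurable_translation_sub hu w) hp hpt hη x).trans ?_
    gcongr
    exact h.of_norm_le hs hC hw
  calc ‖ballAvg ε u x - ballAvg δ u x‖ₑ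
      ≤ ∫⁻ w, ‖u (x + w) - ballAvg ε u x‖ₑ ∂ν := by
        rw [enorm_sub_rev]
        exact enorm_ballAvg_sub_le hu hp hpt hup hδ x _
    _ ≤ ∫⁻ w, ∫⁻ z, ‖u (x + z) - u (x + w)‖ₑ ∂μ ∂ν := by
        refine lintegral_mono fun w => ?_
        rw [enorm_sub_rev]
        exact enorm_ballAvg_sub_le hu hp hpt hup hε x _
    -- The points x + z and x + w are joined through x + z + w. The first increment is a translation
    -- by w, averaged in z, the second a translation by z, averaged in w.
    _ ≤ ∫⁻ w, ((∫⁻ z, ‖u (x + z + w) - u (x + z)‖ₑ ∂μ) +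
          ∫⁻ z, ‖u (x + z + w) - u (x + w)‖ₑ ∂μ) ∂ν := by
        refine lintegral_mono fun w => ?_
        rw [← lintegral_add_right _ (by fun_prop)]
        refine lintegral_mono fun z => ?_
        have e : u (x + z) - u (x + w) =
            (u (x + z + w) - u (x + w)) - (u (x + z + w) - u (x + z)) := by ring
        rw [e]
        exact enorm_sub_le.trans_eq (add_comm _ _)
    _ = (∫⁻ w, ∫⁻ z, ‖u (x + z + w) - u (x + z)‖ₑ ∂μ ∂ν) +
          ∫⁻ w, ∫⁻ z, ‖u (x + z + w) - u (x + w)‖ₑ ∂μ ∂ν :=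
        lintegral_add_left (Measurable.lintegral_prod_right (hzw.sub hz).enorm) _
    _ = (∫⁻ w, ∫⁻ z, ‖u (x + z + w) - u (x + z)‖ₑ ∂μ ∂ν) +
          ∫⁻ z, ∫⁻ w, ‖u (x + w + z) - u (x + w)‖ₑ ∂ν ∂μ := by
        rw [lintegral_lintegral_swap
          (f := fun w z => ‖u (x + z + w) - u (x + w)‖ₑ) (hzw.sub hw).enorm.aemeasurable]
        simp_rw [add_right_comm]
    _ ≤ (∫⁻ _, (volume (Metric.ball (0 : Euc N) ε))⁻¹ ^ (1 / p.toReal) *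
            ENNReal.ofReal (C * δ ^ s) ∂ν) +
          ∫⁻ _, (volume (Metric.ball (0 : Euc N) δ))⁻¹ ^ (1 / p.toReal) *
            ENNReal.ofReal (C * ε ^ s) ∂μ := by
        refine add_le_add (lintegral_mono_ae ?_) (lintegral_mono_ae ?_)
        · filter_upwards [ae_mem_ball_ballMeasure δ] with w hw using bound hε w hw
        · filter_upwards [ae_mem_ball_ballMeasure ε] with z hz using bound hδ z hz
    _ = _ := by simp

/-- A bound of `|B_1| ^ (-1 / p)`. -/
def ballConst (N : ℕ) : ℝ := max 1 (volume (Metric.ball (0 : Euc N) 1)).toReal⁻¹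

theorem one_le_ballConst (N : ℕ) : 1 ≤ ballConst N := le_max_left _ _

theorem volume_ball_inv_rpow_le {p : ℝ≥0∞} (hp : 1 ≤ p) (hpt : p ≠ ∞) {ε : ℝ} (hε : 0 < ε) :
    (volume (Metric.ball (0 : Euc N) ε))⁻¹ ^ (1 / p.toReal) ≤
      ENNReal.ofReal (ballConst N * ε ^ (-(N / p.toReal) : ℝ)) := by
  have hpr : 1 ≤ p.toReal := by
    rw [← ENNReal.toReal_one]; exact ENNReal.toReal_mono hpt hp
  have hpr0 : 0 < p.toReal := by linarith
  have hw := unitBall_toReal_pos N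
  set w := (volume (Metric.ball (0 : Euc N) 1)).toReal with hw'
  have hv : volume (Metric.ball (0 : Euc N) ε) = ENNReal.ofReal (ε ^ N * w) := by
    rw [Measure.addHaar_ball_of_pos _ _ hε, finrank_euclideanSpace_fin,
      ENNReal.ofReal_mul (by positivity), hw', ENNReal.ofReal_toReal measure_ball_lt_top.ne]
  rw [hv, ← ENNReal.ofReal_inv_of_pos (by positivity), ENNReal.ofReal_rpow_of_pos (by positivity)]
  apply ENNReal.ofReal_le_ofReal
  rw [mul_inv, Real.mul_rpow (by positivity) (by positivity), mul_comm]
  have h1 : (ε ^ N)⁻¹ ^ (1 / p.toReal) = ε ^ (-(N / p.toReal) : ℝ) := by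
    rw [← Real.rpow_natCast, ← Real.rpow_neg hε.le, ← Real.rpow_mul hε.le]
    congr 1; ring
  rw [h1]
  gcongr
  calc w⁻¹ ^ (1 / p.toReal) ≤ ballConst N ^ (1 / p.toReal) := by
        gcongr; exact le_max_right _ _
    _ ≤ ballConst N ^ (1 : ℝ) := Real.rpow_le_rpow_of_exponent_le (one_le_ballConst N)
        (by rw [div_le_one hpr0]; exact hpr)
    _ = _ := Real.rpow_one _

/-- A constant in the comparison of averages over concentric balls. -/
def radiusConst (N : ℕ) : ℝ := ballConst N * (1 + 2 ^ N)

theorem two_le_radiusConst (N : ℕ) : 2 ≤ radiusConst N := by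
  have h1 := one_le_ballConst N
  have h2 : (1 : ℝ) ≤ 2 ^ N := one_le_pow₀ (by norm_num)
  unfold radiusConst; nlinarith

theorem enorm_ballAvg_sub_ballAvg_half_le (hu : Measurable u) {p : ℝ≥0∞} (hp : 1 ≤ p)
    (hpt : p ≠ ∞) (hup : MemLp u p volume) {s C : ℝ} (h : TranslationBound u p s C)
    (hs : 0 < s) (hC : 0 < C) {ε : ℝ} (hε : 0 < ε) (x : Euc N) :
    ‖ballAvg (ε / 2) u x - ballAvg ε u x‖ₑ ≤
      ENNReal.ofReal (radiusConst N * C * ε ^ (s - N / p.toReal)) := by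
  have hpr : 1 ≤ p.toReal := by
    rw [← ENNReal.toReal_one]; exact ENNReal.toReal_mono hpt hp
  have hpr0 : 0 < p.toReal := by linarith
  have hb := one_le_ballConst N
  rw [enorm_sub_rev]
  refine (enorm_ballAvg_sub_ballAvg_radius_le hu hp hpt hup h hs hC hε (half_pos hε) x).trans ?_
  refine (add_le_add (mul_le_mul_left (volume_ball_inv_rpow_le hp hpt hε) _)
    (mul_le_mul_left (volume_ball_inv_rpow_le hp hpt (half_pos hε)) _)).trans ?_
  rw [← ENNReal.ofReal_mul (by positivity), ← ENNReal.ofReal_mul (by positivity),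
    ← ENNReal.ofReal_add (by positivity) (by positivity)]
  apply ENNReal.ofReal_le_ofReal
  have e1 : ε ^ (s - N / p.toReal) = ε ^ (-(N / p.toReal) : ℝ) * ε ^ s := by
    rw [← Real.rpow_add hε]; congr 1; ring
  have e2 : (ε / 2) ^ (-(N / p.toReal) : ℝ) ≤ ε ^ (-(N / p.toReal) : ℝ) * 2 ^ N := by
    rw [Real.div_rpow hε.le (by norm_num), Real.rpow_neg (x := 2) (by norm_num), div_inv_eq_mul]
    gcongr
    rw [← Real.rpow_natCast]
    apply Real.rpow_le_rpow_of_exponent_le (by norm_num)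
    exact div_le_self (by positivity) hpr
  have e3 : (ε / 2) ^ s ≤ ε ^ s := by gcongr; linarith
  calc ballConst N * ε ^ (-(N / p.toReal) : ℝ) * (C * (ε / 2) ^ s) +
        ballConst N * (ε / 2) ^ (-(N / p.toReal) : ℝ) * (C * ε ^ s)
      ≤ ballConst N * ε ^ (-(N / p.toReal) : ℝ) * (C * ε ^ s) +
        ballConst N * (ε ^ (-(N / p.toReal) : ℝ) * 2 ^ N) * (C * ε ^ s) := by gcongr
    _ = _ := by rw [e1, radiusConst]; ring

/-- Both averages are compared with `u` itself, so unlike in the supremum bound no power of ε is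
lost. -/
theorem eLpNorm_ballAvg_sub_ballAvg_half_le (hu : Measurable u) {p : ℝ≥0∞} (hp : 1 ≤ p)
    (hpt : p ≠ ∞) (hup : MemLp u p volume) {s C : ℝ} (h : TranslationBound u p s C)
    (hs : 0 < s) (hC : 0 < C) {ε : ℝ} (hε : 0 < ε) :
    eLpNorm (fun x => ballAvg (ε / 2) u x - ballAvg ε u x) p volume ≤
      ENNReal.ofReal (radiusConst N * C * ε ^ s) := by
  have e : (fun x => ballAvg (ε / 2) u x - ballAvg ε u x) =
      (fun x => ballAvg (ε / 2) u x - u x) - fun x => ballAvg ε u x - u x := by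
    ext x; simp
  rw [e]
  refine (eLpNorm_sub_le ((measurable_ballAvg hu _).sub hu).aestronglyMeasurable
    ((measurable_ballAvg hu _).sub hu).aestronglyMeasurable hp).trans ?_
  refine (add_le_add (eLpNorm_ballAvg_sub_le hu hp hpt hup h hs hC (half_pos hε))
    (eLpNorm_ballAvg_sub_le hu hp hpt hup h hs hC hε)).trans ?_
  rw [← ENNReal.ofReal_add (by positivity) (by positivity)]
  apply ENNReal.ofReal_le_ofReal
  have e3 : (ε / 2) ^ s ≤ ε ^ s := by gcongr; linarith
  have h2 := two_le_radiusConst N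
  calc C * (ε / 2) ^ s + C * ε ^ s ≤ C * ε ^ s + C * ε ^ s := by gcongr
    _ = 2 * C * ε ^ s := by ring
    _ ≤ _ := by gcongr

/-- For finite q, |f|^q ≤ b^(q-p) |f|^p. -/
theorem eLpNorm_le_of_interpolation {α : Type*} {m : MeasurableSpace α} {μ : Measure α}
    {f : α → ℝ} {p q : ℝ≥0∞} (hp : 1 ≤ p) (hpq : p ≤ q) {a b : ℝ} (ha : 0 < a) (hb : 0 < b)
    (hfp : eLpNorm f p μ ≤ ENNReal.ofReal a) (hf : ∀ x, ‖f x‖ₑ ≤ ENNReal.ofReal b) :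
    eLpNorm f q μ ≤
      ENNReal.ofReal (b ^ (1 - p.toReal * (1 / q.toReal)) * a ^ (p.toReal * (1 / q.toReal))) := by
  rcases eq_or_ne q ∞ with rfl | hq
  -- With 1/∞ read as 1/0 = 0, the right side reduces to b.
  · simp only [ENNReal.toReal_top, div_zero, mul_zero, sub_zero, Real.rpow_one, Real.rpow_zero,
      mul_one, eLpNorm_exponent_top]
    exact essSup_le_of_ae_le _ (Eventually.of_forall hf)
  have hpt : p ≠ ∞ := (hpq.trans_lt (lt_top_iff_ne_top.2 hq)).ne
  have hp0 : p ≠ 0 := (one_pos.trans_le hp).ne'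
  have hq0 : q ≠ 0 := (one_pos.trans_le (hp.trans hpq)).ne'
  have hpr : 0 < p.toReal := ENNReal.toReal_pos hp0 hpt
  have hqr : 0 < q.toReal := ENNReal.toReal_pos hq0 hq
  have hpqr : p.toReal ≤ q.toReal := ENNReal.toReal_mono hq hpq
  have h1 : ∫⁻ x, ‖f x‖ₑ ^ p.toReal ∂μ ≤ ENNReal.ofReal a ^ p.toReal := by
    have := ENNReal.rpow_le_rpow hfp hpr.le
    rwa [eLpNorm_eq_lintegral_rpow_enorm_toReal hp0 hpt, ← ENNReal.rpow_mul,
      one_div_mul_cancel hpr.ne', ENNReal.rpow_one] at this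
  have h2 : ∫⁻ x, ‖f x‖ₑ ^ q.toReal ∂μ ≤
      ENNReal.ofReal b ^ (q.toReal - p.toReal) * ENNReal.ofReal a ^ p.toReal := by
    calc ∫⁻ x, ‖f x‖ₑ ^ q.toReal ∂μ
        ≤ ∫⁻ x, ENNReal.ofReal b ^ (q.toReal - p.toReal) * ‖f x‖ₑ ^ p.toReal ∂μ := by
          refine lintegral_mono fun x => ?_
          have : ‖f x‖ₑ ^ q.toReal = ‖f x‖ₑ ^ (q.toReal - p.toReal) * ‖f x‖ₑ ^ p.toReal := by
            rw [← ENNReal.rpow_add_of_nonneg _ _ (by linarith) hpr.le, sub_add_cancel]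
          rw [this]
          gcongr
          exact hf x
      _ = ENNReal.ofReal b ^ (q.toReal - p.toReal) * ∫⁻ x, ‖f x‖ₑ ^ p.toReal ∂μ :=
          lintegral_const_mul' _ _ (ENNReal.rpow_ne_top_of_nonneg (by linarith)
            ENNReal.ofReal_ne_top)
      _ ≤ _ := by gcongr
  rw [eLpNorm_eq_lintegral_rpow_enorm_toReal hq0 hq]
  refine (ENNReal.rpow_le_rpow h2 (by positivity)).trans_eq ?_
  rw [ENNReal.ofReal_rpow_of_pos ha, ENNReal.ofReal_rpow_of_pos hb,
    ← ENNReal.ofReal_mul (by positivity), ENNReal.ofReal_rpow_of_pos (by positivity),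
    Real.mul_rpow (by positivity) (by positivity), ← Real.rpow_mul hb.le, ← Real.rpow_mul ha.le]
  congr 3
  field_simp

/-- Interpolate between the exponents s in L^p and s - N/p in the supremum norm: (p/q) s + (1 -
p/q)(s - N/p) = s - N(1/p - 1/q). -/
theorem eLpNorm_ballAvg_half_le_of_exponent (hu : Measurable u) {p q : ℝ≥0∞} (hp : 1 ≤ p)
    (hpt : p ≠ ∞) (hpq : p ≤ q) (hup : MemLp u p volume) {s C : ℝ}
    (h : TranslationBound u p s C) (hs : 0 < s) (hC : 0 < C) {ε : ℝ} (hε : 0 < ε) :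
    eLpNorm (fun x => ballAvg (ε / 2) u x - ballAvg ε u x) q volume ≤
      ENNReal.ofReal (radiusConst N * C * ε ^ (s - N * (1 / p.toReal - 1 / q.toReal))) := by
  have hR := two_le_radiusConst N
  have hpr : 0 < p.toReal := ENNReal.toReal_pos (one_pos.trans_le hp).ne' hpt
  set K := radiusConst N * C with hK
  have hK0 : 0 < K := by positivity
  refine (eLpNorm_le_of_interpolation hp hpq (a := K * ε ^ s)
    (b := K * ε ^ (s - N / p.toReal)) (by positivity) (by positivity)
    (eLpNorm_ballAvg_sub_ballAvg_half_le hu hp hpt hup h hs hC hε)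
    (enorm_ballAvg_sub_ballAvg_half_le hu hp hpt hup h hs hC hε)).trans_eq ?_
  congr 1
  rw [Real.mul_rpow hK0.le (by positivity), Real.mul_rpow hK0.le (by positivity),
    mul_mul_mul_comm, ← Real.rpow_add hK0, sub_add_cancel, Real.rpow_one,
    ← Real.rpow_mul hε.le, ← Real.rpow_mul hε.le, ← Real.rpow_add hε]
  congr 2
  field_simp
  ring

/-- A constant in the approximation of a function by its averages. -/
def avgConst (N : ℕ) (γ : ℝ) : ℝ := radiusConst N * (1 - 2 ^ (-γ))⁻¹

theorem two_rpow_neg_lt_one {γ : ℝ} (hγ : 0 < γ) : (2 : ℝ) ^ (-γ) < 1 :=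
  Real.rpow_lt_one_of_one_lt_of_neg (by norm_num) (by linarith)

/-- Telescope over the radii ε/2^i. As these are at most 1, each exponent may be lowered to γ, and
the geometric series gives a constant free of p, q and s. -/
theorem eLpNorm_ballAvg_dyadic_le (hu : Measurable u) {p q : ℝ≥0∞} (hp : 1 ≤ p)
    (hpt : p ≠ ∞) (hpq : p ≤ q) (hup : MemLp u p volume) {s C : ℝ}
    (h : TranslationBound u p s C) (hs : 0 < s) (hC : 0 < C) {γ : ℝ} (hγ : 0 < γ)
    (hγs : γ ≤ s - N * (1 / p.toReal - 1 / q.toReal)) {ε : ℝ} (hε : 0 < ε) (hε1 : ε ≤ 1) (j : ℕ) :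
    eLpNorm (fun x => ballAvg (ε / 2 ^ j) u x - ballAvg ε u x) q volume ≤
      ENNReal.ofReal (avgConst N γ * C * ε ^ γ) := by
  have hR := two_le_radiusConst N
  have hr1 := two_rpow_neg_lt_one hγ
  have hr0 : (0 : ℝ) ≤ 2 ^ (-γ) := by positivity
  have key : eLpNorm (fun x => ballAvg (ε / 2 ^ j) u x - ballAvg ε u x) q volume ≤
      ENNReal.ofReal (radiusConst N * C * ε ^ γ * ∑ i ∈ Finset.range j, ((2 : ℝ) ^ (-γ)) ^ i) := by
    induction j with
    | zero => simp
    | succ j ih =>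
      have hεj : 0 < ε / 2 ^ j := by positivity
      have hεj1 : ε / 2 ^ j ≤ 1 := (div_le_self hε.le (one_le_pow₀ (by norm_num))).trans hε1
      have e : (fun x => ballAvg (ε / 2 ^ (j + 1)) u x - ballAvg ε u x) =
          (fun x => ballAvg (ε / 2 ^ j / 2) u x - ballAvg (ε / 2 ^ j) u x) +
            fun x => ballAvg (ε / 2 ^ j) u x - ballAvg ε u x := by
        ext x; simp [pow_succ, div_div]
      rw [e]
      refine (eLpNorm_add_le ((measurable_ballAvg hu _).sub
        (measurable_ballAvg hu _)).aestronglyMeasurable ((measurable_ballAvg hu _).sub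
        (measurable_ballAvg hu _)).aestronglyMeasurable (hp.trans hpq)).trans ?_
      refine (add_le_add
        (eLpNorm_ballAvg_half_le_of_exponent hu hp hpt hpq hup h hs hC hεj) ih).trans ?_
      rw [← ENNReal.ofReal_add (by positivity)
        (mul_nonneg (by positivity) (Finset.sum_nonneg fun i _ => pow_nonneg hr0 i))]
      apply ENNReal.ofReal_le_ofReal
      rw [Finset.sum_range_succ, mul_add, add_comm]
      refine add_le_add le_rfl ?_
      have : (ε / 2 ^ j) ^ (s - N * (1 / p.toReal - 1 / q.toReal)) ≤ (ε / 2 ^ j) ^ γ :=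
        Real.rpow_le_rpow_of_exponent_ge hεj hεj1 hγs
      have e2 : (ε / 2 ^ j) ^ γ = ε ^ γ * (2 ^ (-γ)) ^ j := by
        rw [Real.div_rpow hε.le (by positivity), ← Real.rpow_natCast, ← Real.rpow_natCast,
          ← Real.rpow_mul (by norm_num), ← Real.rpow_mul (by norm_num), div_eq_mul_inv,
          ← Real.rpow_neg (by norm_num)]
        congr 2; ring
      rw [mul_assoc (radiusConst N * C), ← e2]
      gcongr
  refine key.trans (ENNReal.ofReal_le_ofReal ?_)
  have hsum : ∑ i ∈ Finset.range j, ((2 : ℝ) ^ (-γ)) ^ i ≤ (1 - 2 ^ (-γ))⁻¹ := by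
    rw [← tsum_geometric_of_lt_one hr0 hr1]
    exact (summable_geometric_of_lt_one hr0 hr1).sum_le_tsum _ fun i _ => pow_nonneg hr0 i
  calc _ ≤ radiusConst N * C * ε ^ γ * (1 - 2 ^ (-γ))⁻¹ := by gcongr
    _ = _ := by unfold avgConst; ring

/-- Functions with Hölder continuous translations in `L^p` are approximated by their averages in
`L^q`, at a rate depending on `s - N (1 / p - 1 / q)` only. -/
theorem eLpNorm_sub_ballAvg_le (hu : Measurable u) {p q : ℝ≥0∞} (hp : 1 ≤ p)
    (hpt : p ≠ ∞) (hpq : p ≤ q) (hup : MemLp u p volume) {s C : ℝ}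
    (h : TranslationBound u p s C) (hs : 0 < s) (hC : 0 < C) {γ : ℝ} (hγ : 0 < γ)
    (hγs : γ ≤ s - N * (1 / p.toReal - 1 / q.toReal)) {ε : ℝ} (hε : 0 < ε) (hε1 : ε ≤ 1) :
    eLpNorm (fun x => u x - ballAvg ε u x) q volume ≤
      ENNReal.ofReal (avgConst N γ * C * ε ^ γ) := by
  have hm := fun δ : ℝ => measurable_ballAvg hu δ
  refine eLpNorm_le_of_tendstoInMeasure (u := atTop) (p := q)
    (f := fun (j : ℕ) x => ballAvg (ε / 2 ^ j) u x - ballAvg ε u x)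
    (Eventually.of_forall fun j =>
      eLpNorm_ballAvg_dyadic_le hu hp hpt hpq hup h hs hC hγ hγs hε hε1 j) ?_
    fun j => ((hm _).sub (hm _)).aestronglyMeasurable
  -- The averages converge to `u` in L^p, hence in measure, and the L^q norm is lower semicontinuous
  -- under that convergence. No membership of `u` in L^q is presupposed.
  refine tendstoInMeasure_of_tendsto_eLpNorm (p := p) (one_pos.trans_le hp).ne'
    (fun j => ((hm _).sub (hm _)).aestronglyMeasurable) (hu.sub (hm _)).aestronglyMeasurable ?_
  have hlim : Tendsto (fun j : ℕ => ENNReal.ofReal (C * (ε / 2 ^ j) ^ s)) atTop (𝓝 0) := by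
    have h0 : Tendsto (fun j : ℕ => ε / 2 ^ j) atTop (𝓝 0) :=
      tendsto_const_nhds.div_atTop (tendsto_pow_atTop_atTop_of_one_lt (by norm_num))
    have h1 := ((h0.rpow_const (p := s) (Or.inr hs.le)).const_mul C)
    rw [Real.zero_rpow hs.ne', mul_zero] at h1
    simpa using ENNReal.tendsto_ofReal h1
  refine tendsto_of_tendsto_of_tendsto_of_le_of_le tendsto_const_nhds hlim
    (fun _ => zero_le) fun j => ?_
  have e : ((fun x => ballAvg (ε / 2 ^ j) u x - ballAvg ε u x) - fun x => u x - ballAvg ε u x) =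
      fun x => ballAvg (ε / 2 ^ j) u x - u x := by
    ext x; simp
  simp only [e]
  exact eLpNorm_ballAvg_sub_le hu hp hpt hup h hs hC (by positivity)

end Averages

/-! ### Uniform estimates and finite determination -/

section Family

variable {N : ℕ} {Ω : Set (Euc N)} {q : ℝ≥0∞} {γ C : ℝ} {u w : Euc N → ℝ}

/-- Functions vanishing off `Ω`, in the unit ball of some `L^p` with `p ≤ q`, and with Hölder
continuous translations of an order that controls the `L^q` norm. -/
structure InFamily (Ω : Set (Euc N)) (q : ℝ≥0∞) (γ C : ℝ) (u : Euc N → ℝ) : Prop where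
  measurable : Measurable u
  zero_off : ∀ x, x ∉ Ω → u x = 0
  exists_bound : ∃ (p : ℝ≥0∞) (s : ℝ), 1 ≤ p ∧ p ≠ ∞ ∧ p ≤ q ∧ 0 < s ∧
    γ ≤ s - N * (1 / p.toReal - 1 / q.toReal) ∧ eLpNorm u p volume ≤ 1 ∧
    TranslationBound u p s C

theorem one_div_toReal_anti {p q : ℝ≥0∞} (hp : 1 ≤ p) (hpq : p ≤ q) :
    1 / q.toReal ≤ 1 / p.toReal := by
  rcases eq_or_ne q ∞ with rfl | hq
  · simp
  · exact one_div_le_one_div_of_le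
      (ENNReal.toReal_pos (one_pos.trans_le hp).ne' (hpq.trans_lt (lt_top_iff_ne_top.2 hq)).ne)
      (ENNReal.toReal_mono hq hpq)

theorem support_subset_of_zero_off (hu : ∀ x, x ∉ Ω → u x = 0) : Function.support u ⊆ Ω :=
  fun x hx => by_contra fun h => hx (hu x h)

theorem InFamily.eLpNorm_sub_ballAvg_le (hu : InFamily Ω q γ C u) (hγ : 0 < γ) (hC : 0 < C)
    {ε : ℝ} (hε : 0 < ε) (hε1 : ε ≤ 1) :
    eLpNorm (fun x => u x - ballAvg ε u x) q volume ≤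
      ENNReal.ofReal (avgConst N γ * C * ε ^ γ) := by
  obtain ⟨p, s, hp, hpt, hpq, hs, hγs, hn, ht⟩ := hu.exists_bound
  exact FracEig.eLpNorm_sub_ballAvg_le hu.measurable hp hpt hpq
    ⟨hu.measurable.aestronglyMeasurable, hn.trans_lt ENNReal.one_lt_top⟩ ht hs hC hγ hγs hε hε1

/-- A bound of `|B_ε| ^ (-1 / p)` uniform in `p`. -/
def ballBound (N : ℕ) (ε : ℝ) : ℝ := ballConst N * ε ^ (-(N : ℝ))

theorem ballBound_pos (N : ℕ) {ε : ℝ} (hε : 0 < ε) : 0 < ballBound N ε :=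
  mul_pos (one_pos.trans_le (one_le_ballConst N)) (Real.rpow_pos_of_pos hε _)

theorem volume_ball_inv_rpow_le_ballBound {p : ℝ≥0∞} (hp : 1 ≤ p) (hpt : p ≠ ∞) {ε : ℝ}
    (hε : 0 < ε) (hε1 : ε ≤ 1) :
    (volume (Metric.ball (0 : Euc N) ε))⁻¹ ^ (1 / p.toReal) ≤ ENNReal.ofReal (ballBound N ε) := by
  have hpr : 1 ≤ p.toReal := by
    rw [← ENNReal.toReal_one]; exact ENNReal.toReal_mono hpt hp
  refine (volume_ball_inv_rpow_le hp hpt hε).trans (ENNReal.ofReal_le_ofReal ?_)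
  have := one_le_ballConst N
  unfold ballBound
  gcongr ?_ * ?_
  refine Real.rpow_le_rpow_of_exponent_ge hε hε1 (neg_le_neg ?_)
  exact div_le_self (by positivity) hpr

theorem InFamily.enorm_ballAvg_le (hu : InFamily Ω q γ C u) {ε : ℝ} (hε : 0 < ε) (hε1 : ε ≤ 1)
    (x : Euc N) : ‖ballAvg ε u x‖ₑ ≤ ENNReal.ofReal (ballBound N ε) := by
  obtain ⟨p, s, hp, hpt, hpq, hs, hγs, hn, ht⟩ := hu.exists_bound
  refine (FracEig.enorm_ballAvg_le hu.measurable hp hpt hε x).trans ?_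
  calc _ ≤ ENNReal.ofReal (ballBound N ε) * 1 :=
        mul_le_mul' (volume_ball_inv_rpow_le_ballBound hp hpt hε hε1) hn
    _ = _ := mul_one _

/-- Equicontinuity of the averages. Since 1/p ≥ 1/q, one has γ ≤ s, and for points at distance at
most 1 the member's own exponent s may be lowered to the common γ. -/
theorem InFamily.enorm_ballAvg_sub_le (hu : InFamily Ω q γ C u) (hC : 0 < C) {ε : ℝ}
    (hε : 0 < ε) (hε1 : ε ≤ 1) {x y : Euc N} (hxy : ‖x - y‖ ≤ 1) :
    ‖ballAvg ε u x - ballAvg ε u y‖ₑ ≤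
      ENNReal.ofReal (ballBound N ε * (C * ‖x - y‖ ^ γ)) := by
  obtain ⟨p, s, hp, hpt, hpq, hs, hγs, hn, ht⟩ := hu.exists_bound
  have hb := ballBound_pos N hε
  rcases eq_or_ne x y with rfl | hne
  · simp
  have hpos : 0 < ‖x - y‖ := norm_pos_iff.2 (sub_ne_zero.2 hne)
  refine (enorm_ballAvg_sub_ballAvg_le hu.measurable hp hpt
    ⟨hu.measurable.aestronglyMeasurable, hn.trans_lt ENNReal.one_lt_top⟩ hε x y).trans ?_
  rw [ENNReal.ofReal_mul hb.le]
  refine mul_le_mul' (volume_ball_inv_rpow_le_ballBound hp hpt hε hε1)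
    ((ht _).trans (ENNReal.ofReal_le_ofReal ?_))
  have hγs' : γ ≤ s := by
    have := one_div_toReal_anti hp hpq
    have : 0 ≤ (N : ℝ) * (1 / p.toReal - 1 / q.toReal) := mul_nonneg (by positivity) (by linarith)
    linarith
  gcongr ?_ * ?_
  exact Real.rpow_le_rpow_of_exponent_ge hpos hxy hγs'

/-- Split `u` on Ω into its average of radius 1 and the remainder. The average is bounded and Ω has
finite measure. -/
theorem InFamily.eLpNorm_le (hu : InFamily Ω q γ C u) (hγ : 0 < γ) (hC : 0 < C) (hq : 1 ≤ q) :
    eLpNorm u q volume ≤ ENNReal.ofReal (avgConst N γ * C) +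
      ENNReal.ofReal (ballBound N 1) * volume Ω ^ q.toReal⁻¹ := by
  have hm := measurable_ballAvg hu.measurable 1
  have h1 := hu.eLpNorm_sub_ballAvg_le hγ hC one_pos le_rfl
  rw [← eLpNorm_restrict_eq_of_support_subset (support_subset_of_zero_off hu.zero_off)]
  have e : u = (fun x => u x - ballAvg 1 u x) + ballAvg 1 u := by ext x; simp
  calc eLpNorm u q (volume.restrict Ω)
      = eLpNorm ((fun x => u x - ballAvg 1 u x) + ballAvg 1 u) q (volume.restrict Ω) := by
        rw [← e]
    _ ≤ eLpNorm (fun x => u x - ballAvg 1 u x) q (volume.restrict Ω) +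
          eLpNorm (ballAvg 1 u) q (volume.restrict Ω) :=
        eLpNorm_add_le (hu.measurable.sub hm).aestronglyMeasurable hm.aestronglyMeasurable hq
    _ ≤ _ := by
        refine add_le_add ?_ ?_
        · refine (eLpNorm_mono_measure _ Measure.restrict_le_self).trans (h1.trans_eq ?_)
          simp
        · refine (eLpNorm_le_of_ae_enorm_bound (C := ENNReal.ofReal (ballBound N 1))
            (Eventually.of_forall fun x => hu.enorm_ballAvg_le one_pos le_rfl x)).trans_eq ?_
          rw [Measure.restrict_apply_univ, smul_eq_mul]

/-- Averages of functions of the family are uniformly small at infinity. -/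
theorem exists_radius_enorm_ballAvg_le (hΩ : MeasurableSet Ω) (hΩf : volume Ω < ∞)
    (hγ : 0 < γ) (hC : 0 < C) (hq : 1 < q) {ε : ℝ} (hε : 0 < ε) (hε1 : ε ≤ 1) {η : ℝ≥0∞}
    (hη : 0 < η) :
    ∃ R : ℝ, ∀ u, InFamily Ω q γ C u → ∀ x : Euc N, R ≤ ‖x‖ → ‖ballAvg ε u x‖ₑ ≤ η := by
  set D := ENNReal.ofReal (avgConst N γ * C) +
    ENNReal.ofReal (ballBound N 1) * volume Ω ^ q.toReal⁻¹ with hD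
  have hDt : D ≠ ∞ := by
    refine ENNReal.add_ne_top.2 ⟨ENNReal.ofReal_ne_top, ENNReal.mul_ne_top ENNReal.ofReal_ne_top ?_⟩
    exact ENNReal.rpow_ne_top_of_nonneg (by positivity) hΩf.ne
  set T : ℝ → Set (Euc N) := fun R => Ω ∩ {x | R ≤ ‖x‖} with hT
  have hTm : ∀ R, MeasurableSet (T R) := fun R =>
    hΩ.inter (measurableSet_le measurable_const measurable_norm)
  -- Here q > 1 enters: Hölder's inequality bounds the mass on the tail `T R` of Ω by a positive
  -- power of its measure.
  have hexp : 0 < (1 : ℝ≥0∞).toReal⁻¹ - q.toReal⁻¹ := by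
    rcases eq_or_ne q ∞ with rfl | hqt
    · simp
    · have : 1 < q.toReal := by
        rw [← ENNReal.toReal_one]; exact (ENNReal.toReal_lt_toReal ENNReal.one_ne_top hqt).2 hq
      have := inv_lt_one_of_one_lt₀ this
      simp only [ENNReal.toReal_one, inv_one]; linarith
  have hlim0 : Tendsto (fun R => volume (T R)) atTop (𝓝 0) := by
    have h := tendsto_measure_iInter_atTop (μ := volume) (s := T)
      (fun R => (hTm R).nullMeasurableSet)
      (fun R R' h x hx => ⟨hx.1, h.trans hx.2⟩)
      ⟨0, ((measure_mono inter_subset_left).trans_lt hΩf).ne⟩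
    have he : ⋂ R, T R = ∅ := by
      ext x
      simp only [mem_iInter, mem_empty_iff_false, iff_false, not_forall]
      exact ⟨‖x‖ + 1, fun hx => by have : ‖x‖ + 1 ≤ ‖x‖ := hx.2; linarith⟩
    rw [he, measure_empty] at h
    exact h
  have hlim : Tendsto (fun R => (volume (Metric.ball (0 : Euc N) ε))⁻¹ *
      (D * volume (T R) ^ ((1 : ℝ≥0∞).toReal⁻¹ - q.toReal⁻¹))) atTop (𝓝 0) := by
    have h1 := hlim0.ennrpow_const ((1 : ℝ≥0∞).toReal⁻¹ - q.toReal⁻¹)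
    rw [ENNReal.zero_rpow_of_pos hexp] at h1
    have h2 := ENNReal.Tendsto.const_mul h1 (Or.inr hDt)
    have h3 := ENNReal.Tendsto.const_mul h2
      (Or.inr (ENNReal.inv_ne_top.2 (volume_ball_ne_zero (N := N) hε)))
    simpa using h3
  obtain ⟨R, hR⟩ := (hlim.eventually (gt_mem_nhds hη)).exists
  -- A ball of radius ε ≤ 1 about a point of norm at least R + 1 stays outside the ball of radius R.
  refine ⟨R + 1, fun u hu x hx => le_trans ?_ hR.le⟩
  have hcongr : ballAvg ε u x = ballAvg ε ((T R).indicator u) x := by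
    refine integral_congr_ae ?_
    filter_upwards [ae_mem_ball_ballMeasure ε] with z hz
    by_cases hxz : x + z ∈ Ω
    · have : x + z ∈ T R := by
        refine ⟨hxz, ?_⟩
        have h1 : ‖z‖ < ε := mem_ball_zero_iff.1 hz
        have h2 : ‖x‖ ≤ ‖x + z‖ + ‖z‖ := by
          simpa using norm_sub_le (x + z) z
        change R ≤ ‖x + z‖
        linarith
      rw [indicator_of_mem this]
    · rw [indicator_of_notMem (fun h => hxz h.1), hu.zero_off _ hxz]
  rw [hcongr]
  refine (FracEig.enorm_ballAvg_le (hu.measurable.indicator (hTm R)) le_rfl ENNReal.one_ne_top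
    hε x).trans ?_
  simp only [ENNReal.toReal_one, div_one, ENNReal.rpow_one]
  gcongr
  rw [eLpNorm_indicator_eq_eLpNorm_restrict (hTm R)]
  refine (eLpNorm_le_eLpNorm_mul_rpow_measure_univ hq.le
    hu.measurable.aestronglyMeasurable).trans ?_
  rw [Measure.restrict_apply_univ, one_div, one_div]
  simp only [ENNReal.toReal_one]
  gcongr
  exact (eLpNorm_mono_measure _ Measure.restrict_le_self).trans (hu.eLpNorm_le hγ hC hq.le)

theorem eLpNorm_sub_le_of_ballAvg (hΩ : MeasurableSet Ω) (hq : 1 ≤ q) (hu : Measurable u)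
    (hw : Measurable w) (hu0 : ∀ x, x ∉ Ω → u x = 0) (hw0 : ∀ x, x ∉ Ω → w x = 0)
    {a b c : ℝ≥0∞} (ε : ℝ)
    (ha : eLpNorm (fun x => u x - ballAvg ε u x) q volume ≤ a)
    (hb : eLpNorm (fun x => w x - ballAvg ε w x) q volume ≤ b)
    (hc : ∀ x ∈ Ω, ‖ballAvg ε u x - ballAvg ε w x‖ₑ ≤ c) :
    eLpNorm (fun x => u x - w x) q volume ≤ a + b + c * volume Ω ^ q.toReal⁻¹ := by
  have hmu := measurable_ballAvg hu ε
  have hmw := measurable_ballAvg hw ε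
  have h0 : ∀ x, x ∉ Ω → u x - w x = 0 := fun x hx => by rw [hu0 x hx, hw0 x hx, sub_zero]
  rw [← eLpNorm_restrict_eq_of_support_subset (support_subset_of_zero_off h0)]
  have e : (fun x => u x - w x) = ((fun x => u x - ballAvg ε u x) - fun x => w x - ballAvg ε w x) +
      fun x => ballAvg ε u x - ballAvg ε w x := by
    ext x; simp only [Pi.add_apply, Pi.sub_apply]; ring
  rw [e]
  refine (eLpNorm_add_le ((hu.sub hmu).sub (hw.sub hmw)).aestronglyMeasurable
    (hmu.sub hmw).aestronglyMeasurable hq).trans (add_le_add ?_ ?_)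
  · refine (eLpNorm_sub_le (hu.sub hmu).aestronglyMeasurable (hw.sub hmw).aestronglyMeasurable
      hq).trans (add_le_add ?_ ?_)
    · exact (eLpNorm_mono_measure _ Measure.restrict_le_self).trans ha
    · exact (eLpNorm_mono_measure _ Measure.restrict_le_self).trans hb
  · refine (eLpNorm_le_of_ae_enorm_bound (C := c) ?_).trans_eq ?_
    · filter_upwards [ae_restrict_mem hΩ] with x hx using hc x hx
    · rw [Measure.restrict_apply_univ, smul_eq_mul]

/-- Members of the family are close in `L^q` as soon as suitable averages are close at finitely
many points. -/
theorem exists_finset_eLpNorm_sub_le (hΩ : MeasurableSet Ω) (hΩf : volume Ω < ∞)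
    (hγ : 0 < γ) (hC : 0 < C) (hq : 1 < q) {η : ℝ≥0∞} (hη : 0 < η) :
    ∃ (t : Finset (Euc N)) (ε δ B : ℝ), 0 < δ ∧
      (∀ u, InFamily Ω q γ C u → ∀ x, |ballAvg ε u x| ≤ B) ∧
      ∀ u w, InFamily Ω q γ C u → InFamily Ω q γ C w →
        (∀ x ∈ t, |ballAvg ε u x - ballAvg ε w x| ≤ δ) →
        eLpNorm (fun x => u x - w x) q volume < η := by
  set L := volume Ω ^ q.toReal⁻¹ with hL
  have hLt : L ≠ ∞ := ENNReal.rpow_ne_top_of_nonneg (by positivity) hΩf.ne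
  have hηlim : ∀ {f : ℝ → ℝ≥0∞}, Tendsto f (𝓝[>] 0) (𝓝 0) → ∃ ε, 0 < ε ∧ ε ≤ 1 ∧ f ε < η := by
    intro f hf
    have h1 := hf.eventually (gt_mem_nhds hη)
    have h2 : ∀ᶠ ε : ℝ in 𝓝[>] 0, ε ∈ Ioc (0 : ℝ) 1 := Ioc_mem_nhdsGT one_pos
    obtain ⟨ε, h3, h4⟩ := (h1.and h2).exists
    exact ⟨ε, h4.1, h4.2, h3⟩
  have hpow : ∀ c : ℝ, Tendsto (fun ε : ℝ => ENNReal.ofReal (c * ε ^ γ)) (𝓝[>] 0) (𝓝 0) := by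
    intro c
    have h1 : ContinuousAt (fun ε : ℝ => c * ε ^ γ) 0 :=
      continuousAt_const.mul (Real.continuousAt_rpow_const _ _ (Or.inr hγ.le))
    have h2 := ENNReal.tendsto_ofReal h1.tendsto
    simp only [Real.zero_rpow hγ.ne', mul_zero, ENNReal.ofReal_zero] at h2
    exact h2.mono_left nhdsWithin_le_nhds
  -- The budget: 2a for approximating the two functions by averages of radius ε, and then κ for the
  -- uniform distance between the averages on Ω.
  obtain ⟨ε, hε, hε1, hsmall⟩ : ∃ ε, 0 < ε ∧ ε ≤ 1 ∧
      ENNReal.ofReal (avgConst N γ * C * ε ^ γ) + ENNReal.ofReal (avgConst N γ * C * ε ^ γ) < η :=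
    hηlim (by simpa using (hpow (avgConst N γ * C)).add (hpow (avgConst N γ * C)))
  set a := ENNReal.ofReal (avgConst N γ * C * ε ^ γ)
  obtain ⟨κ, hκ, hκη⟩ : ∃ κ : ℝ, 0 < κ ∧ a + a + ENNReal.ofReal κ * L < η := by
    have h1 : Tendsto (fun κ : ℝ => a + a + ENNReal.ofReal κ * L) (𝓝 0)
        (𝓝 (a + a + ENNReal.ofReal 0 * L)) :=
      tendsto_const_nhds.add (ENNReal.Tendsto.mul_const
        (ENNReal.tendsto_ofReal tendsto_id) (Or.inr hLt))
    rw [ENNReal.ofReal_zero, zero_mul, add_zero] at h1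
    have h2 := (h1.mono_left (nhdsWithin_le_nhds (s := Ioi 0))).eventually (gt_mem_nhds hsmall)
    obtain ⟨κ, h3, h4⟩ := (h2.and self_mem_nhdsWithin).exists
    exact ⟨κ, h4, h3⟩
  -- Quarters of κ: at distance R or more each average contributes one. Closer in, moving both
  -- averages to a net point costs two and comparing them there costs a third.
  obtain ⟨R, hR⟩ := exists_radius_enorm_ballAvg_le (γ := γ) (C := C) hΩ hΩf hγ hC hq hε hε1
    (η := ENNReal.ofReal (κ / 4)) (by simpa using hκ)
  obtain ⟨r, hr, hr1, hrκ⟩ : ∃ r : ℝ, 0 < r ∧ r ≤ 1 ∧ ballBound N ε * (C * r ^ γ) ≤ κ / 4 := by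
    have h1 : ContinuousAt (fun r : ℝ => ballBound N ε * (C * r ^ γ)) 0 :=
      continuousAt_const.mul (continuousAt_const.mul
        (Real.continuousAt_rpow_const _ _ (Or.inr hγ.le)))
    have h2 := h1.tendsto.mono_left (nhdsWithin_le_nhds (s := Ioi 0))
    rw [Real.zero_rpow hγ.ne', mul_zero, mul_zero] at h2
    have h3 := h2.eventually (gt_mem_nhds (show 0 < κ / 4 by linarith))
    have h4 : ∀ᶠ ε : ℝ in 𝓝[>] 0, ε ∈ Ioc (0 : ℝ) 1 := Ioc_mem_nhdsGT one_pos
    obtain ⟨r, h5, h6⟩ := (h3.and h4).exists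
    exact ⟨r, h6.1, h6.2, h5.le⟩
  obtain ⟨t, -, htf, htc⟩ := (isCompact_closedBall (0 : Euc N) R).finite_cover_balls hr
  refine ⟨htf.toFinset, ε, κ / 4, ballBound N ε, by linarith, fun u hu x => ?_,
    fun u w hu hw h => lt_of_le_of_lt ?_ hκη⟩
  · have := hu.enorm_ballAvg_le hε hε1 x
    rw [← ofReal_norm] at this
    exact (ENNReal.ofReal_le_ofReal_iff (ballBound_pos N hε).le).1 this
  · refine eLpNorm_sub_le_of_ballAvg hΩ hq.le hu.measurable hw.measurable hu.zero_off hw.zero_off ε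
      (hu.eLpNorm_sub_ballAvg_le hγ hC hε hε1) (hw.eLpNorm_sub_ballAvg_le hγ hC hε hε1)
      fun x _ => ?_
    rw [← ofReal_norm]
    apply ENNReal.ofReal_le_ofReal
    have conv : ∀ {y c : ℝ}, 0 ≤ c → ‖y‖ₑ ≤ ENNReal.ofReal c → |y| ≤ c := by
      intro y c hc h
      rw [← ofReal_norm] at h
      exact (ENNReal.ofReal_le_ofReal_iff hc).1 h
    rw [Real.norm_eq_abs]
    by_cases hx : R ≤ ‖x‖
    · have h1 := conv (by linarith) (hR u hu x hx)
      have h2 := conv (by linarith) (hR w hw x hx)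
      have := abs_sub (ballAvg ε u x) (ballAvg ε w x)
      linarith
    · have hxR : x ∈ Metric.closedBall (0 : Euc N) R := by
        rw [mem_closedBall_zero_iff]; linarith
      obtain ⟨y, hyt, hxy⟩ := mem_iUnion₂.1 (htc hxR)
      have hxy' : ‖x - y‖ < r := mem_ball_iff_norm.1 hxy
      have hbd : ∀ v, InFamily Ω q γ C v → |ballAvg ε v x - ballAvg ε v y| ≤ κ / 4 := by
        intro v hv
        have hb := ballBound_pos N hε
        refine (conv (by positivity)
          (hv.enorm_ballAvg_sub_le hC hε hε1 (hxy'.le.trans hr1))).trans (le_trans ?_ hrκ)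
        gcongr
      have h1 := abs_le.1 (hbd u hu)
      have h2 := abs_le.1 (hbd w hw)
      have h3 := abs_le.1 (h y (htf.mem_toFinset.2 hyt))
      rw [abs_le]
      constructor <;> linarith [h1.1, h1.2, h2.1, h2.2, h3.1, h3.2]

end Family

/-! ### Continuity of L^r norms in the exponent -/

section NormLimits

variable {α : Type*} {m : MeasurableSpace α} {μ : Measure α} {f : α → ℝ}

theorem tendsto_eLpNorm_exponent_of_ne_top [IsFiniteMeasure μ] {p₀ q : ℝ≥0∞} {r : ℕ → ℝ≥0∞}
    (hf : MemLp f q μ) (hp₀ : 1 ≤ p₀) (hp₀t : p₀ ≠ ∞)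
    (hr : Tendsto r atTop (𝓝 p₀)) (hr1 : ∀ n, 1 ≤ r n) (hrq : ∀ᶠ n in atTop, r n ≤ q) :
    Tendsto (fun n => eLpNorm f (r n) μ) atTop (𝓝 (eLpNorm f p₀ μ)) := by
  -- The cap `p₀ + 1` keeps b finite when q = ∞, and 1 + |f|^b dominates |f|^(r n) for large n.
  set b := min q (p₀ + 1) with hb
  have hbt : b ≠ ∞ := (lt_of_le_of_lt (min_le_right _ _)
    (ENNReal.add_lt_top.2 ⟨lt_top_iff_ne_top.2 hp₀t, ENNReal.one_lt_top⟩)).ne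
  have hfb : MemLp f b μ := hf.mono_exponent (min_le_left _ _)
  have hrb : ∀ᶠ n in atTop, r n ≤ b := by
    have h1 : ∀ᶠ n in atTop, r n < p₀ + 1 :=
      hr.eventually (gt_mem_nhds (ENNReal.lt_add_right hp₀t one_ne_zero))
    filter_upwards [h1, hrq] with n h1 h2 using le_min h2 h1.le
  have hp₀r : 0 < p₀.toReal := ENNReal.toReal_pos (one_pos.trans_le hp₀).ne' hp₀t
  have hb0 : b ≠ 0 := by
    obtain ⟨n, hn⟩ := hrb.exists
    exact (one_pos.trans_le ((hr1 n).trans hn)).ne'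
  have hrr : Tendsto (fun n => (r n).toReal) atTop (𝓝 p₀.toReal) :=
    (ENNReal.tendsto_toReal hp₀t).comp hr
  have hint : Tendsto (fun n => ∫⁻ x, ‖f x‖ₑ ^ (r n).toReal ∂μ) atTop
      (𝓝 (∫⁻ x, ‖f x‖ₑ ^ p₀.toReal ∂μ)) := by
    obtain ⟨g, hgm, hfg⟩ := hf.1
    have hcongr : ∀ c : ℝ, ∫⁻ x, ‖f x‖ₑ ^ c ∂μ = ∫⁻ x, ‖g x‖ₑ ^ c ∂μ := fun c =>
      lintegral_congr_ae (hfg.mono fun x hx => by simp only [hx])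
    simp_rw [hcongr]
    refine tendsto_lintegral_filter_of_dominated_convergence
      (fun x => 1 + ‖g x‖ₑ ^ b.toReal) ?_ ?_ ?_ ?_
    · exact Eventually.of_forall fun n => hgm.measurable.enorm.pow_const _
    · filter_upwards [hrb] with n hn
      refine Eventually.of_forall fun x => ?_
      rcases le_total ‖g x‖ₑ 1 with h | h
      · exact (ENNReal.rpow_le_one h ENNReal.toReal_nonneg).trans le_self_add
      · exact (ENNReal.rpow_le_rpow_of_exponent_le h (ENNReal.toReal_mono hbt hn)).trans
          le_add_self
    · rw [lintegral_add_left measurable_const, ← hcongr]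
      refine ENNReal.add_ne_top.2 ⟨by simp, ?_⟩
      exact (lintegral_rpow_enorm_lt_top_of_eLpNorm_lt_top hb0 hbt hfb.2).ne
    · refine Eventually.of_forall fun x => ?_
      have h1 : Tendsto (fun n => ‖g x‖ ^ (r n).toReal) atTop (𝓝 (‖g x‖ ^ p₀.toReal)) :=
        tendsto_const_nhds.rpow hrr (Or.inr hp₀r)
      have h2 := ENNReal.tendsto_ofReal h1
      have h3 : ∀ c : ℝ, 0 ≤ c → ENNReal.ofReal (‖g x‖ ^ c) = ‖g x‖ₑ ^ c := fun c hc => by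
        rw [← ofReal_norm, ENNReal.ofReal_rpow_of_nonneg (norm_nonneg _) hc]
      rw [h3 _ hp₀r.le] at h2
      exact h2.congr fun n => h3 _ ENNReal.toReal_nonneg
  have hfin : ∫⁻ x, ‖f x‖ₑ ^ p₀.toReal ∂μ ≠ ∞ := by
    refine (lintegral_rpow_enorm_lt_top_of_eLpNorm_lt_top (one_pos.trans_le hp₀).ne' hp₀t ?_).ne
    exact (hfb.mono_exponent (le_of_tendsto hr hrb)).2
  have hpow : Tendsto (fun n => (∫⁻ x, ‖f x‖ₑ ^ (r n).toReal ∂μ) ^ (1 / (r n).toReal)) atTop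
      (𝓝 ((∫⁻ x, ‖f x‖ₑ ^ p₀.toReal ∂μ) ^ (1 / p₀.toReal))) := by
    set I := fun n => ∫⁻ x, ‖f x‖ₑ ^ (r n).toReal ∂μ
    set I₀ := ∫⁻ x, ‖f x‖ₑ ^ p₀.toReal ∂μ
    have hI : Tendsto (fun n => (I n).toReal) atTop (𝓝 I₀.toReal) :=
      (ENNReal.tendsto_toReal hfin).comp hint
    have hinv : Tendsto (fun n => 1 / (r n).toReal) atTop (𝓝 (1 / p₀.toReal)) :=
      tendsto_const_nhds.div hrr hp₀r.ne'
    have h1 := ENNReal.tendsto_ofReal (hI.rpow hinv (Or.inr (by positivity)))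
    rw [← ENNReal.ofReal_rpow_of_nonneg ENNReal.toReal_nonneg (by positivity),
      ENNReal.ofReal_toReal hfin] at h1
    refine h1.congr' ?_
    filter_upwards [hint.eventually (gt_mem_nhds (lt_top_iff_ne_top.2 hfin))] with n hn
    rw [← ENNReal.ofReal_rpow_of_nonneg ENNReal.toReal_nonneg (by positivity),
      ENNReal.ofReal_toReal hn.ne]
  rw [eLpNorm_eq_lintegral_rpow_enorm_toReal (one_pos.trans_le hp₀).ne' hp₀t]
  refine hpow.congr' ?_
  filter_upwards [hrb] with n hn
  rw [eLpNorm_eq_lintegral_rpow_enorm_toReal (one_pos.trans_le (hr1 n)).ne'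
    (hn.trans_lt (lt_top_iff_ne_top.2 hbt)).ne]

theorem tendsto_rpow_inv_of_tendsto_top {c : ℝ≥0∞} (hc : c ≠ 0) (hct : c ≠ ∞) {r : ℕ → ℝ}
    (hr : Tendsto r atTop atTop) : Tendsto (fun n => c ^ (1 / r n)) atTop (𝓝 1) := by
  have hc0 : 0 < c.toReal := ENNReal.toReal_pos hc hct
  have h0 : Tendsto (fun n => 1 / r n) atTop (𝓝 0) := tendsto_const_nhds.div_atTop hr
  have h1 := ENNReal.tendsto_ofReal
    ((tendsto_const_nhds (x := c.toReal)).rpow h0 (Or.inl hc0.ne'))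
  rw [Real.rpow_zero, ENNReal.ofReal_one] at h1
  refine h1.congr fun n => ?_
  rw [← ENNReal.ofReal_rpow_of_pos hc0, ENNReal.ofReal_toReal hct]

/-- From below, Chebyshev on {|f| ≥ b} for b under the essential supremum. From above, Hölder. In
both, c^(1/r) → 1 for the measure c of a set. -/
theorem tendsto_eLpNorm_exponent_top [IsFiniteMeasure μ] {r : ℕ → ℝ≥0∞}
    (hf : AEStronglyMeasurable f μ)
    (hr : Tendsto r atTop (𝓝 ∞)) (hr1 : ∀ n, 1 ≤ r n) (hrt : ∀ n, r n ≠ ∞) :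
    Tendsto (fun n => eLpNorm f (r n) μ) atTop (𝓝 (eLpNorm f ∞ μ)) := by
  rcases eq_or_ne μ 0 with rfl | hμ
  · simp
  have hrr : Tendsto (fun n => (r n).toReal) atTop atTop := by
    refine tendsto_atTop.2 fun c => ?_
    have h := hr.eventually (lt_mem_nhds (ENNReal.ofReal_lt_top (r := c)))
    filter_upwards [h] with n hn
    exact (ENNReal.ofReal_le_iff_le_toReal (hrt n)).1 hn.le
  have hr0 : ∀ n, 0 < (r n).toReal := fun n =>
    ENNReal.toReal_pos (one_pos.trans_le (hr1 n)).ne' (hrt n)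
  refine tendsto_of_le_liminf_of_limsup_le ?_ ?_
  · refine le_of_forall_lt fun a ha => ?_
    obtain ⟨b, hab, hb⟩ := exists_between ha
    refine lt_of_lt_of_le hab ?_
    have hbt : b ≠ ∞ := hb.ne_top
    have hpos : μ {x | b ≤ ‖f x‖ₑ} ≠ 0 := by
      intro h0
      have : ∀ᵐ x ∂μ, ‖f x‖ₑ ≤ b := by
        rw [ae_iff]
        refine measure_mono_null (fun x hx => ?_) h0
        exact (not_le.1 hx).le
      have h1 : eLpNorm f ∞ μ ≤ b := by
        rw [eLpNorm_exponent_top]; exact essSup_le_of_ae_le _ this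
      exact absurd hb (not_lt.2 h1)
    have h1 := tendsto_rpow_inv_of_tendsto_top hpos (measure_ne_top _ _) hrr
    have h2 : Tendsto (fun n => b * μ {x | b ≤ ‖f x‖ₑ} ^ (1 / (r n).toReal)) atTop (𝓝 b) := by
      simpa using ENNReal.Tendsto.const_mul h1 (Or.inr hbt)
    rw [← h2.liminf_eq]
    refine liminf_le_liminf (Eventually.of_forall fun n => ?_)
    have h3 := mul_meas_ge_le_pow_eLpNorm' μ (one_pos.trans_le (hr1 n)).ne' (hrt n) hf b
    have h4 := ENNReal.rpow_le_rpow h3 (one_div_nonneg.2 (hr0 n).le)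
    rwa [ENNReal.mul_rpow_of_nonneg _ _ (one_div_nonneg.2 (hr0 n).le), ← ENNReal.rpow_mul,
      ← ENNReal.rpow_mul, mul_one_div_cancel (hr0 n).ne', ENNReal.rpow_one, ENNReal.rpow_one] at h4
  · have h1 := tendsto_rpow_inv_of_tendsto_top (c := μ univ)
      (by simpa using hμ) (measure_ne_top _ _) hrr
    rcases eq_or_ne (eLpNorm f ∞ μ) ∞ with ht | ht
    · rw [ht]; exact le_top
    have h2 : Tendsto (fun n => eLpNorm f ∞ μ * μ univ ^ (1 / (r n).toReal)) atTop
        (𝓝 (eLpNorm f ∞ μ)) := by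
      simpa using ENNReal.Tendsto.const_mul h1 (Or.inr ht)
    rw [← h2.limsup_eq]
    refine limsup_le_limsup (Eventually.of_forall fun n => ?_)
    have := eLpNorm_le_eLpNorm_mul_rpow_measure_univ (μ := μ) (p := r n) (q := ∞) le_top hf
    simpa using this

/-- On a finite measure space the `L^r` norm is continuous in the exponent. -/
theorem tendsto_eLpNorm_exponent [IsFiniteMeasure μ] {p₀ q : ℝ≥0∞} {r : ℕ → ℝ≥0∞}
    (hf : MemLp f q μ) (hp₀ : 1 ≤ p₀)
    (hr : Tendsto r atTop (𝓝 p₀)) (hr1 : ∀ n, 1 ≤ r n) (hrt : ∀ n, r n ≠ ∞)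
    (hrq : ∀ᶠ n in atTop, r n ≤ q) :
    Tendsto (fun n => eLpNorm f (r n) μ) atTop (𝓝 (eLpNorm f p₀ μ)) := by
  rcases eq_or_ne p₀ ∞ with rfl | hp₀t
  · exact tendsto_eLpNorm_exponent_top hf.1 hr hr1 hrt
  · exact tendsto_eLpNorm_exponent_of_ne_top hf hp₀ hp₀t hr hr1 hrq

theorem measure_univ_rpow_le [IsFiniteMeasure μ] {r q : ℝ≥0∞} (hr1 : 1 ≤ r) (hrq : r ≤ q) :
    μ univ ^ (1 / r.toReal - 1 / q.toReal) ≤ max 1 (μ univ) := by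
  have h0 : 0 ≤ 1 / r.toReal - 1 / q.toReal := by
    have := one_div_toReal_anti hr1 hrq; linarith
  have h1 : 1 / r.toReal - 1 / q.toReal ≤ 1 := by
    have h2 : 0 ≤ 1 / q.toReal := by positivity
    have h3 : 1 / r.toReal ≤ 1 := by
      simpa using one_div_toReal_anti le_rfl hr1
    linarith
  calc _ ≤ (max 1 (μ univ)) ^ (1 / r.toReal - 1 / q.toReal) :=
        ENNReal.rpow_le_rpow (le_max_right _ _) h0
    _ ≤ (max 1 (μ univ)) ^ (1 : ℝ) := ENNReal.rpow_le_rpow_of_exponent_le (le_max_left _ _) h1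
    _ = _ := ENNReal.rpow_one _

theorem eLpNorm_le_mul_of_exponent_le [IsFiniteMeasure μ] {r q : ℝ≥0∞} (hr1 : 1 ≤ r)
    (hrq : r ≤ q) (hf : AEStronglyMeasurable f μ) :
    eLpNorm f r μ ≤ eLpNorm f q μ * max 1 (μ univ) :=
  (eLpNorm_le_eLpNorm_mul_rpow_measure_univ hrq hf).trans
    (mul_le_mul_right (measure_univ_rpow_le hr1 hrq) _)

/-- Function and exponent move together. The change of function is measured in the fixed L^q, which
controls every L^(r n) with one constant. This carries the sphere constraint to the limit. -/
theorem tendsto_eLpNorm_of_tendsto [IsFiniteMeasure μ] {p₀ q : ℝ≥0∞} {r : ℕ → ℝ≥0∞}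
    {F : ℕ → α → ℝ} (hF : ∀ n, AEStronglyMeasurable (F n) μ)
    (hf : MemLp f q μ) (hp₀ : 1 ≤ p₀)
    (hr : Tendsto r atTop (𝓝 p₀)) (hr1 : ∀ n, 1 ≤ r n) (hrt : ∀ n, r n ≠ ∞)
    (hrq : ∀ᶠ n in atTop, r n ≤ q)
    (hlim : Tendsto (fun n => eLpNorm (fun x => F n x - f x) q μ) atTop (𝓝 0)) :
    Tendsto (fun n => eLpNorm (F n) (r n) μ) atTop (𝓝 (eLpNorm f p₀ μ)) := by
  have h1 := tendsto_eLpNorm_exponent hf hp₀ hr hr1 hrt hrq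
  have hK : max 1 (μ univ) ≠ ∞ := by simp
  have h2 : Tendsto (fun n => eLpNorm (fun x => F n x - f x) q μ * max 1 (μ univ)) atTop (𝓝 0) := by
    simpa using ENNReal.Tendsto.mul_const hlim (Or.inr hK)
  have hle : ∀ᶠ n in atTop, eLpNorm (fun x => F n x - f x) (r n) μ ≤
      eLpNorm (fun x => F n x - f x) q μ * max 1 (μ univ) := by
    filter_upwards [hrq] with n hn
    exact eLpNorm_le_mul_of_exponent_le (hr1 n) hn ((hF n).sub hf.1)
  refine tendsto_of_tendsto_of_tendsto_of_le_of_le'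
    (g := fun n => eLpNorm f (r n) μ - eLpNorm (fun x => F n x - f x) q μ * max 1 (μ univ))
    (h := fun n => eLpNorm f (r n) μ + eLpNorm (fun x => F n x - f x) q μ * max 1 (μ univ))
    ?_ ?_ ?_ ?_
  · simpa using ENNReal.Tendsto.sub h1 h2 (Or.inr ENNReal.zero_ne_top)
  · simpa using h1.add h2
  · filter_upwards [hle] with n hn
    rw [tsub_le_iff_right]
    have e : f = F n - fun x => F n x - f x := by ext x; simp
    calc eLpNorm f (r n) μ = eLpNorm (F n - fun x => F n x - f x) (r n) μ := by rw [← e]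
      _ ≤ _ := (eLpNorm_sub_le (hF n) ((hF n).sub hf.1) (hr1 n)).trans (add_le_add le_rfl hn)
  · filter_upwards [hle] with n hn
    have e : F n = f + fun x => F n x - f x := by ext x; simp
    calc eLpNorm (F n) (r n) μ = eLpNorm (f + fun x => F n x - f x) (r n) μ := by rw [← e]
      _ ≤ _ := (eLpNorm_add_le hf.1 ((hF n).sub hf.1) (hr1 n)).trans (add_le_add le_rfl hn)

end NormLimits

/-! ### Limits of the family -/

section FamilyLimits

variable {N : ℕ} {Ω : Set (Euc N)} {q : ℝ≥0∞} {γ C : ℝ} {v : Euc N → ℝ} {u : ℕ → Euc N → ℝ}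

theorem enorm_ballAvg_sub_le_eLpNorm_one {f g : Euc N → ℝ} (hf : Measurable f) (hg : Measurable g)
    (hf1 : MemLp f 1 volume) (hg1 : MemLp g 1 volume) {ε : ℝ} (hε : 0 < ε) (x : Euc N) :
    ‖ballAvg ε f x - ballAvg ε g x‖ₑ ≤ (volume (Metric.ball (0 : Euc N) ε))⁻¹ *
      eLpNorm (fun x => f x - g x) 1 volume := by
  have e : ballAvg ε f x - ballAvg ε g x = ballAvg ε (fun x => f x - g x) x := by
    unfold ballAvg
    rw [integral_sub (integrable_ballMeasure hf le_rfl ENNReal.one_ne_top hf1 hε x)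
      (integrable_ballMeasure hg le_rfl ENNReal.one_ne_top hg1 hε x)]
  rw [e]
  have h := enorm_ballAvg_le (hf.sub hg) le_rfl ENNReal.one_ne_top hε x
  rwa [ENNReal.toReal_one, div_one, ENNReal.rpow_one] at h

theorem InFamily.memLp_one (hu : InFamily Ω q γ C v) (hΩf : volume Ω < ∞) :
    MemLp v 1 volume := by
  obtain ⟨p, s, hp, hpt, -, -, -, hn, -⟩ := hu.exists_bound
  have : Fact (volume Ω < ∞) := ⟨hΩf⟩
  refine ⟨hu.measurable.aestronglyMeasurable, ?_⟩
  have hsub := support_subset_of_zero_off hu.zero_off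
  rw [← eLpNorm_restrict_eq_of_support_subset hsub]
  refine (eLpNorm_le_mul_of_exponent_le le_rfl hp hu.measurable.aestronglyMeasurable).trans_lt ?_
  rw [eLpNorm_restrict_eq_of_support_subset hsub]
  refine ENNReal.mul_lt_top (hn.trans_lt ENNReal.one_lt_top) ?_
  simp [hΩf]

theorem ae_tendsto_ballAvg (hu : ∀ n, Measurable (u n))
    (hu1 : ∀ n, MemLp (u n) 1 volume) (hv : Measurable v) (hv1 : MemLp v 1 volume)
    (hlim : Tendsto (fun n => eLpNorm (fun x => u n x - v x) 1 volume) atTop (𝓝 0))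
    {ε : ℝ} (hε : 0 < ε) (x : Euc N) :
    Tendsto (fun n => ballAvg ε (u n) x) atTop (𝓝 (ballAvg ε v x)) := by
  rw [tendsto_iff_edist_tendsto_0]
  have h2 : Tendsto (fun n => (volume (Metric.ball (0 : Euc N) ε))⁻¹ *
      eLpNorm (fun x => u n x - v x) 1 volume) atTop (𝓝 0) := by
    simpa using ENNReal.Tendsto.const_mul hlim
      (Or.inr (ENNReal.inv_ne_top.2 (volume_ball_ne_zero (N := N) hε)))
  refine tendsto_of_tendsto_of_tendsto_of_le_of_le tendsto_const_nhds h2 (fun _ => zero_le)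
    fun n => ?_
  rw [edist_eq_enorm_sub]
  exact enorm_ballAvg_sub_le_eLpNorm_one (hu n) hv (hu1 n) hv1 hε x

/-- `L^1` convergence in the family improves to `L^q` convergence. -/
theorem tendsto_eLpNorm_sub_of_family (hΩ : MeasurableSet Ω) (hΩf : volume Ω < ∞) (hq : 1 ≤ q)
    (hγ : 0 < γ) (hC : 0 < C) (hu : ∀ᶠ n in atTop, InFamily Ω q γ C (u n)) (hv : Measurable v)
    (hv0 : ∀ x, x ∉ Ω → v x = 0) (hv1 : MemLp v 1 volume)
    (hlim : Tendsto (fun n => eLpNorm (fun x => u n x - v x) 1 volume) atTop (𝓝 0)) :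
    Tendsto (fun n => eLpNorm (fun x => u n x - v x) q volume) atTop (𝓝 0) := by
  obtain ⟨n₀, hn₀⟩ := eventually_atTop.1 hu
  rw [← tendsto_add_atTop_iff_nat n₀] at hlim ⊢
  set w : ℕ → Euc N → ℝ := fun n => u (n + n₀) with hw
  have hwF : ∀ n, InFamily Ω q γ C (w n) := fun n => hn₀ _ (Nat.le_add_left _ _)
  change Tendsto (fun n => eLpNorm (fun x => w n x - v x) 1 volume) atTop (𝓝 0) at hlim
  change Tendsto (fun n => eLpNorm (fun x => w n x - v x) q volume) atTop (𝓝 0)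
  have hw1 : ∀ n, MemLp (w n) 1 volume := fun n => (hwF n).memLp_one hΩf
  -- The limit is not known to belong to the family. It inherits the approximation rate through
  -- Fatou's lemma along an almost everywhere convergent subsequence.
  have hvavg : ∀ ε : ℝ, 0 < ε → ε ≤ 1 → eLpNorm (fun x => v x - ballAvg ε v x) q volume ≤
      ENNReal.ofReal (avgConst N γ * C * ε ^ γ) := by
    intro ε hε hε1
    obtain ⟨ns, hns, hae⟩ := (tendstoInMeasure_of_tendsto_eLpNorm one_ne_zero
      (fun n => (hw1 n).1) hv1.1 hlim).exists_seq_tendsto_ae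
    refine Lp.eLpNorm_le_of_ae_tendsto (u := atTop)
      (f := fun k x => w (ns k) x - ballAvg ε (w (ns k)) x)
      (Eventually.of_forall fun k => (hwF _).eLpNorm_sub_ballAvg_le hγ hC hε hε1)
      (fun k => ((hwF _).measurable.sub
        (measurable_ballAvg (hwF _).measurable ε)).aestronglyMeasurable) ?_
    filter_upwards [hae] with x hx
    exact hx.sub ((ae_tendsto_ballAvg (fun n => (hwF n).measurable) hw1 hv hv1 hlim hε x).comp
      hns.tendsto_atTop)
  set L := volume Ω ^ q.toReal⁻¹
  have hLt : L ≠ ∞ := ENNReal.rpow_ne_top_of_nonneg (by positivity) hΩf.ne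
  rw [ENNReal.tendsto_nhds_zero]
  intro η hη
  obtain ⟨ε, hε, hε1, hsmall⟩ : ∃ ε : ℝ, 0 < ε ∧ ε ≤ 1 ∧
      ENNReal.ofReal (avgConst N γ * C * ε ^ γ) + ENNReal.ofReal (avgConst N γ * C * ε ^ γ) < η := by
    have h1 : ContinuousAt (fun ε : ℝ => avgConst N γ * C * ε ^ γ) 0 :=
      continuousAt_const.mul (Real.continuousAt_rpow_const _ _ (Or.inr hγ.le))
    have h2 := ENNReal.tendsto_ofReal (h1.tendsto.mono_left (nhdsWithin_le_nhds (s := Ioi 0)))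
    simp only [Real.zero_rpow hγ.ne', mul_zero, ENNReal.ofReal_zero] at h2
    have h3 := h2.add h2
    rw [add_zero] at h3
    have h4 : ∀ᶠ ε : ℝ in 𝓝[>] 0, ε ∈ Ioc (0 : ℝ) 1 := Ioc_mem_nhdsGT one_pos
    obtain ⟨ε, h5, h6⟩ := ((h3.eventually (gt_mem_nhds hη)).and h4).exists
    exact ⟨ε, h6.1, h6.2, h5⟩
  set a := ENNReal.ofReal (avgConst N γ * C * ε ^ γ)
  have hlim2 : Tendsto (fun n => a + a + (volume (Metric.ball (0 : Euc N) ε))⁻¹ *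
      eLpNorm (fun x => w n x - v x) 1 volume * L) atTop (𝓝 (a + a + 0)) := by
    refine tendsto_const_nhds.add ?_
    have h2 := ENNReal.Tendsto.const_mul hlim
      (Or.inr (ENNReal.inv_ne_top.2 (volume_ball_ne_zero (N := N) hε)))
    rw [mul_zero] at h2
    simpa using ENNReal.Tendsto.mul_const h2 (Or.inr hLt)
  rw [add_zero] at hlim2
  filter_upwards [hlim2.eventually (gt_mem_nhds hsmall)] with n hn
  refine le_trans ?_ hn.le
  exact eLpNorm_sub_le_of_ballAvg hΩ hq (hwF n).measurable hv (hwF n).zero_off hv0 ε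
    ((hwF n).eLpNorm_sub_ballAvg_le hγ hC hε hε1) (hvavg ε hε hε1)
    fun x _ => enorm_ballAvg_sub_le_eLpNorm_one (hwF n).measurable hv (hw1 n) hv1 hε x

/-- Fatou's lemma for the Gagliardo seminorm with varying exponents. -/
theorem gagliardo_le_of_tendsto_ae {s : ℕ → ℝ} {p : ℕ → ℝ} {s₀ p₀ : ℝ} (hu : ∀ n, Measurable (u n))
    (hs : Tendsto s atTop (𝓝 s₀)) (hp : Tendsto p atTop (𝓝 p₀)) (hp₀ : 0 < p₀)
    (hp1 : ∀ n, 0 < p n) (hlim : ∀ᵐ x, Tendsto (fun n => u n x) atTop (𝓝 (v x)))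
    {A : ℕ → ℝ≥0∞} {B : ℝ≥0∞} (hA : Tendsto A atTop (𝓝 B))
    (hle : ∀ᶠ n in atTop, gagliardo (s n) (p n) (u n) ^ p n ≤ A n) :
    gagliardo s₀ p₀ v ≤ B ^ (1 / p₀) := by
  set G : ℕ → Euc N → Euc N → ℝ≥0∞ := fun n x y =>
    ‖u n x - u n y‖ₑ ^ p n / ‖x - y‖ₑ ^ ((N : ℝ) + s n * p n) with hG
  have hGm : ∀ n, Measurable (Function.uncurry (G n)) := fun n =>
    ((((hu n).comp measurable_fst).sub ((hu n).comp measurable_snd)).enorm.pow_const _).div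
      ((measurable_fst.sub measurable_snd).enorm.pow_const _)
  have hpt : ∀ x y, Tendsto (fun n => u n x) atTop (𝓝 (v x)) →
      Tendsto (fun n => u n y) atTop (𝓝 (v y)) →
      ‖v x - v y‖ₑ ^ p₀ / ‖x - y‖ₑ ^ ((N : ℝ) + s₀ * p₀) ≤ liminf (fun n => G n x y) atTop := by
    intro x y hx hy
    rcases eq_or_ne x y with rfl | hxy
    · simp [ENNReal.zero_rpow_of_pos hp₀]
    have hd : 0 < ‖x - y‖ := norm_pos_iff.2 (sub_ne_zero.2 hxy)
    have h1 : Tendsto (fun n => ENNReal.ofReal (‖u n x - u n y‖ ^ p n /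
        ‖x - y‖ ^ ((N : ℝ) + s n * p n))) atTop
        (𝓝 (ENNReal.ofReal (‖v x - v y‖ ^ p₀ / ‖x - y‖ ^ ((N : ℝ) + s₀ * p₀)))) := by
      refine ENNReal.tendsto_ofReal (Tendsto.div ((hx.sub hy).norm.rpow hp (Or.inr hp₀)) ?_
        (by positivity))
      exact tendsto_const_nhds.rpow (tendsto_const_nhds.add (hs.mul hp)) (Or.inl hd.ne')
    have conv : ∀ (a c e : ℝ), 0 < c → ENNReal.ofReal (‖a‖ ^ c / ‖x - y‖ ^ e) =
        ‖a‖ₑ ^ c / ‖x - y‖ₑ ^ e := by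
      intro a c e hc
      rw [ENNReal.ofReal_div_of_pos (by positivity), ← ofReal_norm, ← ofReal_norm (x - y),
        ENNReal.ofReal_rpow_of_pos hd, ENNReal.ofReal_rpow_of_nonneg (norm_nonneg _) hc.le]
    rw [conv _ _ _ hp₀] at h1
    have h2 : Tendsto (fun n => G n x y) atTop
        (𝓝 (‖v x - v y‖ₑ ^ p₀ / ‖x - y‖ₑ ^ ((N : ℝ) + s₀ * p₀))) :=
      h1.congr fun n => conv _ _ _ (hp1 n)
    exact h2.liminf_eq.ge
  have hpow : ∀ n, gagliardo (s n) (p n) (u n) ^ p n = ∫⁻ x, ∫⁻ y, G n x y := fun n => by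
    rw [gagliardo, ← ENNReal.rpow_mul, one_div_mul_cancel (hp1 n).ne', ENNReal.rpow_one]
  unfold gagliardo
  refine ENNReal.rpow_le_rpow ?_ (by positivity)
  calc ∫⁻ x, ∫⁻ y, ‖v x - v y‖ₑ ^ p₀ / ‖x - y‖ₑ ^ ((N : ℝ) + s₀ * p₀)
      ≤ ∫⁻ x, ∫⁻ y, liminf (fun n => G n x y) atTop := by
        refine lintegral_mono_ae ?_
        filter_upwards [hlim] with x hx
        refine lintegral_mono_ae ?_
        filter_upwards [hlim] with y hy using hpt x y hx hy
    _ ≤ ∫⁻ x, liminf (fun n => ∫⁻ y, G n x y) atTop :=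
        lintegral_mono fun x => lintegral_liminf_le fun n =>
          (hGm n).comp (measurable_const.prodMk measurable_id)
    _ ≤ liminf (fun n => ∫⁻ x, ∫⁻ y, G n x y) atTop :=
        lintegral_liminf_le fun n => (hGm n).lintegral_prod_right
    _ ≤ liminf A atTop := by
        refine liminf_le_liminf ?_
        filter_upwards [hle] with n hn
        rw [← hpow]; exact hn
    _ = B := hA.liminf_eq

end FamilyLimits

/-! ### The base space and its embedding in L^1 -/

section BaseSpace

variable {N : ℕ} {Ω : Set (Euc N)} {p₀ : ℝ≥0∞}

theorem measurable_extZero (hΩ : MeasurableSet Ω) {p : ℝ≥0∞} (v : LpOn Ω p) :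
    Measurable (extZero v) :=
  (Lp.stronglyMeasurable v).measurable.indicator hΩ

theorem extZero_of_notMem {p : ℝ≥0∞} (v : LpOn Ω p) {x : Euc N} (hx : x ∉ Ω) : extZero v x = 0 :=
  indicator_of_notMem hx _

theorem eLpNorm_extZero (hΩ : MeasurableSet Ω) {p : ℝ≥0∞} (v : LpOn Ω p) (r : ℝ≥0∞) :
    eLpNorm (extZero v) r volume = eLpNorm v r (volume.restrict Ω) :=
  eLpNorm_indicator_eq_eLpNorm_restrict hΩ

theorem eLpNorm_extZero_sub (hΩ : MeasurableSet Ω) {p : ℝ≥0∞} (v w : LpOn Ω p) (r : ℝ≥0∞) :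
    eLpNorm (fun x => extZero v x - extZero w x) r volume =
      eLpNorm (fun x => v x - w x) r (volume.restrict Ω) := by
  rw [← eLpNorm_indicator_eq_eLpNorm_restrict hΩ]
  congr 1
  ext x
  by_cases hx : x ∈ Ω <;> simp [extZero, hx]

theorem extZero_sub_ae (hΩ : MeasurableSet Ω) {p : ℝ≥0∞} (v w : LpOn Ω p) (r : ℝ≥0∞) :
    eLpNorm (extZero (v - w)) r volume = eLpNorm (fun x => extZero v x - extZero w x) r volume := by
  rw [eLpNorm_extZero_sub hΩ, eLpNorm_extZero hΩ]
  exact eLpNorm_congr_ae (Lp.coeFn_sub v w)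

variable [Fact (1 ≤ p₀)]

theorem isClosed_baseSpace : IsClosed (baseSpace Ω p₀ : Set (LpOn Ω p₀)) := by
  unfold baseSpace
  split_ifs
  · exact Submodule.isClosed_topologicalClosure _
  · exact isClosed_univ

instance completeSpace_baseSpace : CompleteSpace (baseSpace Ω p₀) :=
  isClosed_baseSpace.completeSpace_coe

variable [Fact (volume Ω < ∞)]

theorem toL1_add (v w : baseSpace Ω p₀) : toL1 (v + w) = toL1 v + toL1 w := rfl

theorem toL1_neg (v : baseSpace Ω p₀) : toL1 (-v) = -toL1 v := rfl

theorem toL1_smul (c : ℝ) (v : baseSpace Ω p₀) : toL1 (c • v) = c • toL1 v := rfl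

theorem eLpNorm_sub_eq_edist (hΩ : MeasurableSet Ω) (v w : baseSpace Ω p₀) :
    eLpNorm (fun x => extZero (toL1 v) x - extZero (toL1 w) x) p₀ volume = edist v w := by
  rw [eLpNorm_extZero_sub hΩ, Subtype.edist_eq, Lp.edist_def]
  rfl

theorem edist_toL1_le (v w : baseSpace Ω p₀) :
    edist (toL1 v) (toL1 w) ≤ edist v w * max 1 (volume Ω) := by
  rw [Lp.edist_def, Subtype.edist_eq, Lp.edist_def]
  have := eLpNorm_le_mul_of_exponent_le (μ := (volume : Measure (Euc N)).restrict Ω)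
    (f := ((v : LpOn Ω p₀) - (w : LpOn Ω p₀) : Euc N → ℝ)) le_rfl (Fact.out : 1 ≤ p₀)
    ((Lp.stronglyMeasurable _).sub (Lp.stronglyMeasurable _)).aestronglyMeasurable
  rwa [Measure.restrict_apply_univ] at this

theorem max_one_volume_ne_top : max 1 (volume Ω) ≠ ∞ := by
  simp [(Fact.out : volume Ω < ∞).ne]

theorem continuous_toL1 : Continuous (toL1 : baseSpace Ω p₀ → LpOn Ω 1) := by
  rw [continuous_iff_continuousAt]
  intro v
  rw [ContinuousAt, tendsto_iff_edist_tendsto_0]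
  have h1 : Tendsto (fun w : baseSpace Ω p₀ => edist w v * max 1 (volume Ω)) (𝓝 v) (𝓝 0) := by
    simpa using ENNReal.Tendsto.mul_const (tendsto_iff_edist_tendsto_0.1 (tendsto_id (x := 𝓝 v)))
      (Or.inr (max_one_volume_ne_top (Ω := Ω)))
  exact tendsto_of_tendsto_of_tendsto_of_le_of_le tendsto_const_nhds h1 (fun _ => zero_le)
    fun w => edist_toL1_le w v

theorem memLp_toL1 (v : baseSpace Ω p₀) : MemLp (toL1 v) p₀ (volume.restrict Ω) :=
  Lp.memLp (v : LpOn Ω p₀)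

/-- The condition of being closed in `W_0^{s,p}` is automatic for compact sets. -/
theorem admissible_closed (hΩ : MeasurableSet Ω) (G : Ksym Ω p₀) {s : ℝ} {p : ℝ≥0∞} (hp : 1 ≤ p)
    (w : LpOn Ω 1)
    (h : ∀ ε : ℝ≥0∞, 0 < ε → ∃ v ∈ G.1, normSP s p (extZero (toL1 v - w)) < ε) :
    ∃ v ∈ G.1, toL1 v = w := by
  have hc : IsClosed (toL1 '' (G.1 : Set (baseSpace Ω p₀))) :=
    (G.1.isCompact.image continuous_toL1).isClosed
  -- Closeness in `normSP` implies closeness in L^1, where the image of G is compact and therefore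
  -- closed.
  have hmem : w ∈ closure (toL1 '' (G.1 : Set (baseSpace Ω p₀))) := by
    rw [EMetric.mem_closure_iff]
    intro ε hε
    have hK := max_one_volume_ne_top (Ω := Ω)
    have hK0 : max 1 (volume Ω) ≠ 0 := (one_pos.trans_le (le_max_left _ _)).ne'
    obtain ⟨v, hv, hvε⟩ := h (ε / max 1 (volume Ω)) (ENNReal.div_pos hε.ne' hK)
    refine ⟨toL1 v, ⟨v, hv, rfl⟩, ?_⟩
    have h1 : eLpNorm (toL1 v - w) p (volume.restrict Ω) < ε / max 1 (volume Ω) := by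
      rw [← eLpNorm_extZero hΩ]
      exact lt_of_le_of_lt le_self_add hvε
    have h2 := eLpNorm_le_mul_of_exponent_le (μ := (volume : Measure (Euc N)).restrict Ω)
      le_rfl hp (Lp.aestronglyMeasurable (toL1 v - w))
    rw [Measure.restrict_apply_univ] at h2
    rw [edist_comm, edist_eq_enorm_sub, Lp.enorm_def]
    refine h2.trans_lt ?_
    exact (ENNReal.lt_div_iff_mul_lt (Or.inl hK0) (Or.inl hK)).1 h1
  rw [hc.closure_eq] at hmem
  exact hmem

/-- The members of the base space in the family form a totally bounded set. -/
theorem totallyBounded_family (hΩ : MeasurableSet Ω) {q : ℝ≥0∞} {γ C : ℝ} (hq : 1 < q)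
    (hpq : p₀ ≤ q) (hγ : 0 < γ) (hC : 0 < C) :
    TotallyBounded {v : baseSpace Ω p₀ | InFamily Ω q γ C (extZero (toL1 v))} := by
  have hΩf : volume Ω < ∞ := Fact.out
  refine Metric.totallyBounded_of_finite_discretization fun η hη => ?_
  have hK := max_one_volume_ne_top (Ω := Ω)
  have hK0 : max 1 (volume Ω) ≠ 0 := (one_pos.trans_le (le_max_left _ _)).ne'
  obtain ⟨t, ε, δ, B, hδ, hB, hclose⟩ := exists_finset_eLpNorm_sub_le (γ := γ) (C := C) hΩ hΩf hγ hC
    hq (η := ENNReal.ofReal η / max 1 (volume Ω))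
    (ENNReal.div_pos (ENNReal.ofReal_pos.2 hη).ne' hK)
  -- Sampling the averages at the points of `t` maps the family into a bounded box of a
  -- finite-dimensional space. Functions whose samples share the centre of a δ/2 ball have samples
  -- within δ.
  let T : baseSpace Ω p₀ → t → ℝ := fun v x => ballAvg ε (extZero (toL1 v)) x
  have hcompact : IsCompact (Metric.closedBall (0 : t → ℝ) B) := isCompact_closedBall _ _
  obtain ⟨c, -, hcf, hcc⟩ := hcompact.finite_cover_balls (half_pos hδ)
  have hex : ∀ v : {v : baseSpace Ω p₀ | InFamily Ω q γ C (extZero (toL1 v))},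
      ∃ y ∈ c, dist (T v) y < δ / 2 := by
    intro v
    have hv : T v ∈ Metric.closedBall (0 : t → ℝ) B := by
      have hB0 : 0 ≤ B := (abs_nonneg _).trans (hB _ v.2 0)
      rw [mem_closedBall_zero_iff, pi_norm_le_iff_of_nonneg hB0]
      exact fun x => hB _ v.2 _
    obtain ⟨y, hy, hvy⟩ := mem_iUnion₂.1 (hcc hv)
    exact ⟨y, hy, hvy⟩
  choose f hfc hfd using hex
  refine ⟨c, hcf.fintype, fun v => ⟨f v, hfc v⟩, fun v w hvw => ?_⟩
  have hfvw : f v = f w := congrArg Subtype.val hvw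
  have hd : dist (T v) (T w) < δ := by
    have h1 := hfd v
    have h2 := hfd w
    rw [hfvw] at h1
    linarith [dist_triangle_right (T v) (T w) (f w)]
  have h1 := hclose _ _ v.2 w.2 fun x hx =>
    (dist_le_pi_dist (T v) (T w) ⟨x, hx⟩).trans hd.le
  have h2 : edist (v : baseSpace Ω p₀) w < ENNReal.ofReal η := by
    rw [← eLpNorm_sub_eq_edist hΩ]
    have h0 : ∀ x, x ∉ Ω → extZero (toL1 (v : baseSpace Ω p₀)) x -
        extZero (toL1 (w : baseSpace Ω p₀)) x = 0 := fun x hx => by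
      rw [extZero_of_notMem _ hx, extZero_of_notMem _ hx, sub_zero]
    have hsub := support_subset_of_zero_off h0
    rw [← eLpNorm_restrict_eq_of_support_subset hsub]
    refine (eLpNorm_le_mul_of_exponent_le
      (f := fun x => extZero (toL1 (v : baseSpace Ω p₀)) x - extZero (toL1 (w : baseSpace Ω p₀)) x)
      (Fact.out : 1 ≤ p₀) hpq ((measurable_extZero hΩ _).sub (measurable_extZero hΩ _)).aestronglyMeasurable).trans_lt ?_
    rw [eLpNorm_restrict_eq_of_support_subset hsub, Measure.restrict_apply_univ]
    exact (ENNReal.lt_div_iff_mul_lt (Or.inl hK0) (Or.inl hK)).1 h1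
  rw [edist_dist] at h2
  exact (ENNReal.ofReal_lt_ofReal_iff hη).1 h2

end BaseSpace

/-! ### Symmetric compact sets in the Hausdorff metric -/

section SymmetricCompacts

variable {E : Type*} [NormedAddCommGroup E]

theorem exists_mem_dist_lt {K L : TopologicalSpace.NonemptyCompacts E} {v : E} (hv : v ∈ K) {r : ℝ}
    (h : dist K L < r) : ∃ w ∈ L, dist v w < r :=
  Metric.exists_dist_lt_of_hausdorffDist_lt hv h
    (Metric.hausdorffEDist_ne_top_of_nonempty_of_bounded K.nonempty L.nonempty
      K.isCompact.isBounded L.isCompact.isBounded)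

/-- Move v to a nearby symmetric set, reflect there, and move back: -v is then arbitrarily close to
K, which is closed. -/
theorem isClosed_symmetric :
    IsClosed {K : TopologicalSpace.NonemptyCompacts E | ∀ v ∈ K, -v ∈ K} := by
  rw [← closure_subset_iff_isClosed]
  intro K hK v hv
  have hcl : IsClosed (K : Set E) := K.isCompact.isClosed
  change -v ∈ (K : Set E)
  rw [← hcl.closure_eq, Metric.mem_closure_iff]
  intro ε hε
  obtain ⟨L, hL, hKL⟩ := Metric.mem_closure_iff.1 hK (ε / 2) (half_pos hε)
  obtain ⟨w, hw, hvw⟩ := exists_mem_dist_lt hv hKL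
  obtain ⟨z, hz, hwz⟩ := exists_mem_dist_lt (hL w hw) (by rwa [dist_comm] at hKL)
  refine ⟨z, hz, ?_⟩
  have : dist (-v) (-w) = dist v w := dist_neg_neg v w
  linarith [dist_triangle (-v) (-w) z]

theorem isCompact_symmetric_subsets {S : Set E} (hS : IsCompact S) :
    IsCompact {K : {K : TopologicalSpace.NonemptyCompacts E // ∀ v ∈ K, -v ∈ K} |
      (K.1 : Set E) ⊆ S} := by
  rw [Subtype.isCompact_iff]
  have h := (TopologicalSpace.NonemptyCompacts.isCompact_subsets_of_isCompact hS).inter_right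
    (isClosed_symmetric (E := E))
  convert h using 1
  ext K
  constructor
  · rintro ⟨K, hK, rfl⟩
    exact ⟨hK, K.2⟩
  · rintro ⟨h1, h2⟩
    exact ⟨⟨K, h2⟩, h1, rfl⟩

end SymmetricCompacts

/-! ### Krasnoselskii genus -/

section Genus

variable {E E' : Type*} [NormedAddCommGroup E] [NormedAddCommGroup E']

/-- Compose maps into ℝ^m without zeros on B with f. -/
theorem genus_le_of_odd_map {A : Set E} {B : Set E'} (f : E → E') (hf : ContinuousOn f A)
    (hAB : MapsTo f A B) (hodd : ∀ x ∈ A, f (-x) = -f x) : genus A ≤ genus B := by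
  refine le_iInf₂ fun m h => ?_
  obtain ⟨φ, hφ, hφodd, hφ0⟩ := h
  refine iInf₂_le m ⟨φ ∘ f, hφ.comp hf hAB, fun x hx => ?_, fun x hx => hφ0 _ (hAB hx)⟩
  simp only [Function.comp_apply]
  rw [hodd x hx, hφodd _ (hAB hx)]

/-- Tietze's extension theorem, followed by taking the odd part. -/
theorem exists_odd_extension [NormedSpace ℝ E] {m : ℕ} {K : Set E} (hK : IsClosed K)
    (hsymm : ∀ x ∈ K, -x ∈ K) {φ : E → EuclideanSpace ℝ (Fin m)} (hφ : ContinuousOn φ K)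
    (hodd : ∀ x ∈ K, φ (-x) = -φ x) :
    ∃ ψ : E → EuclideanSpace ℝ (Fin m), Continuous ψ ∧ (∀ x, ψ (-x) = -ψ x) ∧
      ∀ x ∈ K, ψ x = φ x := by
  obtain ⟨g, hg⟩ := ContinuousMap.exists_restrict_eq hK ⟨K.domRestrict φ, hφ.domRestrict⟩
  have hgK : ∀ x ∈ K, g x = φ x := fun x hx => congrArg (fun f => f ⟨x, hx⟩) hg
  refine ⟨fun x => (1 / 2 : ℝ) • (g x - g (-x)),
    by fun_prop, fun x => ?_, fun x hx => ?_⟩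
  · beta_reduce
    rw [neg_neg, ← smul_neg, neg_sub]
  · beta_reduce
    rw [hgK x hx, hgK _ (hsymm x hx), hodd x hx, sub_neg_eq_add, ← two_smul ℝ, smul_smul]
    norm_num

/-- The genus does not drop in the Hausdorff limit. -/
theorem le_genus_of_tendsto [NormedSpace ℝ E]
    {G : ℕ → {K : TopologicalSpace.NonemptyCompacts E // ∀ v ∈ K, -v ∈ K}}
    {G₀ : {K : TopologicalSpace.NonemptyCompacts E // ∀ v ∈ K, -v ∈ K}}
    (hG : Tendsto G atTop (𝓝 G₀)) {k : ℕ∞} (hk : ∀ n, k ≤ genus ((G n).1 : Set E)) :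
    k ≤ genus (G₀.1 : Set E) := by
  refine le_iInf₂ fun m h => ?_
  obtain ⟨φ, hφ, hφodd, hφ0⟩ := h
  obtain ⟨ψ, hψ, hψodd, hψφ⟩ := exists_odd_extension G₀.1.isCompact.isClosed G₀.2 hφ hφodd
  -- The extension has no zeros on a neighbourhood of the compact limit, and that neighbourhood
  -- contains some `G n`.
  obtain ⟨δ, hδ, hsub⟩ := G₀.1.isCompact.exists_thickening_subset_open
    (isOpen_ne_fun hψ continuous_const) (fun x hx => show ψ x ≠ 0 by rw [hψφ x hx]; exact hφ0 x hx)
  obtain ⟨n, hn⟩ := ((Metric.tendsto_nhds.1 hG) δ hδ).exists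
  refine (hk n).trans (iInf₂_le m ⟨ψ, hψ.continuousOn, fun x _ => hψodd x, fun x hx => ?_⟩)
  refine hsub (Metric.mem_thickening_iff.2 ?_)
  obtain ⟨w, hw, hxw⟩ := exists_mem_dist_lt hx hn
  exact ⟨w, hw, hxw⟩

end Genus

/-! ### Approximating points of a Hausdorff limit -/

section HausdorffLimits

variable {E : Type*} [NormedAddCommGroup E]

theorem exists_seq_of_tendsto {G : ℕ → {K : TopologicalSpace.NonemptyCompacts E // ∀ v ∈ K, -v ∈ K}}
    {G₀ : {K : TopologicalSpace.NonemptyCompacts E // ∀ v ∈ K, -v ∈ K}}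
    (hG : Tendsto G atTop (𝓝 G₀)) {v : E} (hv : v ∈ G₀.1) :
    ∃ w : ℕ → E, (∀ n, w n ∈ (G n).1) ∧ Tendsto w atTop (𝓝 v) := by
  have h : ∀ n : ℕ, ∃ w ∈ (G n).1, dist v w < dist (G n) G₀ + 1 / ((n : ℝ) + 1) := fun n =>
    exists_mem_dist_lt hv (by
      rw [dist_comm]
      exact lt_add_of_pos_right _ Nat.one_div_pos_of_nat)
  choose w hw hd using h
  refine ⟨w, hw, tendsto_iff_dist_tendsto_zero.2 ?_⟩
  have h1 : Tendsto (fun n : ℕ => dist (G n) G₀ + 1 / ((n : ℝ) + 1)) atTop (𝓝 0) := by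
    simpa using (tendsto_iff_dist_tendsto_zero.1 hG).add tendsto_one_div_add_atTop_nhds_zero_nat
  exact squeeze_zero (fun _ => dist_nonneg) (fun n => by rw [dist_comm]; exact (hd n).le) h1

end HausdorffLimits

/-! ### Choice of the common exponents -/

section Exponents

/-- Inversion in [0, ∞] is continuous, which also covers p₀ = ∞, where 1/∞ is 0. -/
theorem tendsto_one_div_toReal {p : ℕ → ℝ≥0∞} {p₀ : ℝ≥0∞} (hp₀ : 1 ≤ p₀)
    (hp : Tendsto p atTop (𝓝 p₀)) :
    Tendsto (fun n => 1 / (p n).toReal) atTop (𝓝 (1 / p₀.toReal)) := by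
  have h1 : Tendsto (fun n => (p n)⁻¹) atTop (𝓝 p₀⁻¹) := hp.inv
  have h2 := (ENNReal.tendsto_toReal (ENNReal.inv_ne_top.2 (one_pos.trans_le hp₀).ne')).comp h1
  simpa [Function.comp_def, one_div, ENNReal.toReal_inv] using h2

/-- An exponent `q` beyond the limit exponent that is still controlled along the sequence. -/
theorem exists_exponent (N : ℕ) {p : ℕ → ℝ≥0∞} {s : ℕ → ℝ} {p₀ : ℝ≥0∞} {s₀ : ℝ} (hp₀ : 1 ≤ p₀)
    (hp : Tendsto p atTop (𝓝 p₀)) (hs : Tendsto s atTop (𝓝 s₀)) (hs₀ : 0 < s₀) :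
    ∃ (q : ℝ≥0∞) (γ : ℝ), 1 < q ∧ p₀ ≤ q ∧ 0 < γ ∧
      ∀ᶠ n in atTop, p n ≤ q ∧ γ ≤ s n - N * (1 / (p n).toReal - 1 / q.toReal) := by
  obtain ⟨q, hq1, hpq, hev, hlt⟩ : ∃ q : ℝ≥0∞, 1 < q ∧ p₀ ≤ q ∧ (∀ᶠ n in atTop, p n ≤ q) ∧
      N * (1 / p₀.toReal - 1 / q.toReal) < s₀ / 2 := by
    rcases eq_or_ne p₀ ∞ with rfl | ht
    · exact ⟨∞, ENNReal.one_lt_top, le_rfl, Eventually.of_forall fun _ => le_top,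
        by simpa using hs₀⟩
    · have h1 : 1 ≤ p₀.toReal := by
        rw [← ENNReal.toReal_one]; exact ENNReal.toReal_mono ht hp₀
      -- As p₀ ≥ 1, moving from p₀ to p₀ + δ changes 1/p by at most δ, so the loss Nδ is at most
      -- s₀/4.
      set δ := s₀ / (4 * (N + 1)) with hδ
      have hδ0 : 0 < δ := by positivity
      have hlt : p₀ < ENNReal.ofReal (p₀.toReal + δ) := by
        rw [ENNReal.lt_ofReal_iff_toReal_lt ht]; linarith
      refine ⟨ENNReal.ofReal (p₀.toReal + δ), hp₀.trans_lt hlt, hlt.le,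
        (hp.eventually (gt_mem_nhds hlt)).mono fun n h => h.le, ?_⟩
      rw [ENNReal.toReal_ofReal (by positivity)]
      have h2 : 1 / p₀.toReal - 1 / (p₀.toReal + δ) ≤ δ := by
        rw [div_sub_div _ _ (by positivity) (by positivity), div_le_iff₀ (by positivity)]
        have : 1 ≤ p₀.toReal * (p₀.toReal + δ) := by nlinarith
        nlinarith
      have h3 : (N : ℝ) * δ ≤ s₀ / 4 := by
        rw [hδ, mul_div_assoc', div_le_div_iff₀ (by positivity) (by positivity)]
        nlinarith
      calc (N : ℝ) * (1 / p₀.toReal - 1 / (p₀.toReal + δ)) ≤ N * δ := by gcongr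
        _ < s₀ / 2 := by linarith
  -- The loss at the limit is below s₀/2, so the limit of the available exponents exceeds γ = s₀/2.
  refine ⟨q, s₀ / 2, hq1, hpq, half_pos hs₀, hev.and ?_⟩
  have hlim : Tendsto (fun n => s n - N * (1 / (p n).toReal - 1 / q.toReal)) atTop
      (𝓝 (s₀ - N * (1 / p₀.toReal - 1 / q.toReal))) :=
    hs.sub (((tendsto_one_div_toReal hp₀ hp).sub_const _).const_mul _)
  exact (hlim.eventually (lt_mem_nhds (by linarith))).mono fun n h => h.le

end Exponents

/-! ### Functions of bounded level -/

section Members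

variable {N : ℕ} {Ω : Set (Euc N)}

/-- `v` is an admissible function of level at most `t`. -/
structure IsMember (s : ℝ) (p : ℝ≥0∞) (F : LpOn Ω 1 → ℝ≥0∞) (t : ℝ≥0) (v : LpOn Ω 1) : Prop where
  memW0 : MemW0 s p v
  sphere : eLpNorm v p (volume.restrict Ω) = 1
  level : F v ≤ t

variable {s α β : ℝ} {p : ℝ≥0∞} {F : LpOn Ω 1 → ℝ≥0∞} {t : ℝ≥0} {v : LpOn Ω 1}

theorem seminormSP_eq_gagliardo (hs1 : s < 1) (hpt : p ≠ ∞) (u : Euc N → ℝ) :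
    seminormSP s p u = gagliardo s p.toReal u := if_pos ⟨hs1, hpt⟩

theorem IsMember.seminorm_le (hv : IsMember s p F t v) (hF : Comparable α β s p F) (hα : 0 < α)
    (hs1 : s < 1) (hpt : p ≠ ∞) :
    ENNReal.ofReal ((1 - s) ^ (1 / p.toReal)) * gagliardo s p.toReal (extZero v) ≤
      ENNReal.ofReal (t / α) := by
  have h := (hF.lower v hv.memW0).trans hv.level
  rw [seminormSP_eq_gagliardo hs1 hpt, ENNReal.ofReal_mul hα.le, mul_assoc] at h
  rw [ENNReal.ofReal_div_of_pos hα, ENNReal.ofReal_coe_nnreal,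
    ENNReal.le_div_iff_mul_le (Or.inl (ENNReal.ofReal_pos.2 hα).ne')
      (Or.inl ENNReal.ofReal_ne_top), mul_comm]
  exact h

/-- The Hölder constant of translations of admissible functions of level `t`. -/
def memberConst (N : ℕ) (α : ℝ) (t : ℝ≥0) : ℝ := translationConst N * (t / α + 1)

/-- The summand 1 in `memberConst` makes this true at t = 0. -/
theorem memberConst_pos (N : ℕ) (hα : 0 < α) (t : ℝ≥0) : 0 < memberConst N α t :=
  mul_pos (translationConst_pos N) (by positivity)

/-- The factor (1-s)^(1/p) of the translation estimate is matched by the one in the lower bound of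
`Comparable`, leaving a constant independent of s and p. -/
theorem IsMember.translationBound (hΩ : MeasurableSet Ω) (hv : IsMember s p F t v)
    (hF : Comparable α β s p F) (hα : 0 < α) (hs : 0 < s) (hs1 : s < 1) (hp : 1 ≤ p)
    (hpt : p ≠ ∞) : TranslationBound (extZero v) p s (memberConst N α t) := by
  intro h
  have hC := translationConst_pos N
  refine (eLpNorm_translation_sub_le (measurable_extZero hΩ v) hs hs1 hp hpt h).trans ?_
  calc _ ≤ ENNReal.ofReal (translationConst N * ‖h‖ ^ s) * ENNReal.ofReal (t / α) := by
        gcongr; exact hv.seminorm_le hF hα hs1 hpt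
    _ = ENNReal.ofReal (translationConst N * ‖h‖ ^ s * (t / α)) := by
        rw [ENNReal.ofReal_mul (p := translationConst N * ‖h‖ ^ s) (by positivity)]
    _ ≤ _ := by
        apply ENNReal.ofReal_le_ofReal
        have : (0 : ℝ) ≤ translationConst N * ‖h‖ ^ s := by positivity
        calc translationConst N * ‖h‖ ^ s * (t / α)
            ≤ translationConst N * ‖h‖ ^ s * (t / α + 1) := by gcongr; linarith
          _ = _ := by unfold memberConst; ring

theorem IsMember.inFamily (hΩ : MeasurableSet Ω) (hv : IsMember s p F t v)
    (hF : Comparable α β s p F) (hα : 0 < α) (hs : 0 < s) (hs1 : s < 1) (hp : 1 ≤ p)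
    (hpt : p ≠ ∞) {q : ℝ≥0∞} {γ : ℝ} (hpq : p ≤ q)
    (hγ : γ ≤ s - N * (1 / p.toReal - 1 / q.toReal)) :
    InFamily Ω q γ (memberConst N α t) (extZero v) :=
  ⟨measurable_extZero hΩ v, fun _ hx => extZero_of_notMem v hx,
    p, s, hp, hpt, hpq, hs, hγ, ((eLpNorm_extZero hΩ v p).trans hv.sphere).le,
    hv.translationBound hΩ hF hα hs hs1 hp hpt⟩

/-- The p-th power is the form in which Fatou's lemma is applied. The bound stays finite in the
limit when s₀ < 1. -/
theorem IsMember.gagliardo_rpow_le (hv : IsMember s p F t v)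
    (hF : Comparable α β s p F) (hα : 0 < α) (hs1 : s < 1) (hp : 1 ≤ p) (hpt : p ≠ ∞) :
    gagliardo s p.toReal (extZero v) ^ p.toReal ≤
      ENNReal.ofReal ((t / α) ^ p.toReal / (1 - s)) := by
  have hpr : 0 < p.toReal := ENNReal.toReal_pos (one_pos.trans_le hp).ne' hpt
  have h1s : 0 < 1 - s := by linarith
  have h := ENNReal.rpow_le_rpow (hv.seminorm_le hF hα hs1 hpt) hpr.le
  rw [ENNReal.mul_rpow_of_nonneg _ _ hpr.le, ENNReal.ofReal_rpow_of_pos (by positivity),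
    ← Real.rpow_mul h1s.le, one_div_mul_cancel hpr.ne', Real.rpow_one,
    ENNReal.ofReal_rpow_of_nonneg (by positivity) hpr.le] at h
  rw [ENNReal.ofReal_div_of_pos h1s, ENNReal.le_div_iff_mul_le
    (Or.inl (ENNReal.ofReal_pos.2 h1s).ne') (Or.inl ENNReal.ofReal_ne_top), mul_comm]
  exact h

end Members

/-! ### Equicoercivity and the liminf inequality -/

section LimitMembers

variable {N : ℕ} {Ω : Set (Euc N)} {p₀ : ℝ≥0∞} [Fact (1 ≤ p₀)] [Fact (volume Ω < ∞)]

theorem J_le_iff {k : ℕ} {s : ℝ} {p : ℝ≥0∞} {F : LpOn Ω 1 → ℝ≥0∞} {G : Ksym Ω p₀} {t : ℝ≥0∞}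
    (ht : t ≠ ∞) : J k s p F G ≤ t ↔ Admissible k s p G ∧ ∀ v ∈ G.1, F (toL1 v) ≤ t := by
  unfold J
  split_ifs with h
  · simp [h]
  · simp [h, ht]

theorem isMember_of_J_le {k : ℕ} {s : ℝ} {p : ℝ≥0∞} {F : LpOn Ω 1 → ℝ≥0∞} {G : Ksym Ω p₀}
    {t : ℝ≥0} (h : J k s p F G ≤ t) {v : baseSpace Ω p₀} (hv : v ∈ G.1) :
    IsMember s p F t (toL1 v) := by
  obtain ⟨hA, hF⟩ := (J_le_iff ENNReal.coe_ne_top).1 h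
  exact ⟨hA.memW0 v hv, hA.sphere v hv, hF v hv⟩

/-- All sets of level t consist of members of one totally bounded family, whose closure is compact
because the base space is complete. The index `n₀` depends only on the exponents, so it is fixed
before t. -/
theorem equicoercive (hΩ : MeasurableSet Ω) {F : ℕ → LpOn Ω 1 → ℝ≥0∞}
    {p : ℕ → ℝ≥0∞} {s : ℕ → ℝ} {s₀ α β : ℝ}
    (hp : ∀ n, 1 ≤ p n ∧ p n < ∞) (hs : ∀ n, 0 < s n ∧ s n < 1) (hα : 0 < α)
    (hF : ∀ n, Comparable α β (s n) (p n) (F n))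
    (hp₀ : Tendsto p atTop (𝓝 p₀)) (hs₀ : Tendsto s atTop (𝓝 s₀)) (hs₀pos : 0 < s₀) (k : ℕ) :
    EventuallyEquicoercive (fun n (G : Ksym Ω p₀) => J k (s n) (p n) (F n) G) := by
  obtain ⟨q, γ, hq1, hpq, hγ, hev⟩ := exists_exponent N (Fact.out : 1 ≤ p₀) hp₀ hs₀ hs₀pos
  obtain ⟨n₀, hn₀⟩ := eventually_atTop.1 hev
  refine ⟨n₀, fun t => ?_⟩
  have htb := totallyBounded_family (Ω := Ω) (p₀ := p₀) hΩ hq1 hpq hγ (memberConst_pos N hα t)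
  refine ⟨_, isCompact_symmetric_subsets (htb.closure.isCompact_of_isClosed isClosed_closure),
    fun n hn G hG v hv => subset_closure ?_⟩
  exact (isMember_of_J_le hG hv).inFamily hΩ (hF n) hα (hs n).1 (hs n).2 (hp n).1 (hp n).2.ne
    (hn₀ n hn).1 (hn₀ n hn).2

/-- A bound for the limit seminorm. -/
def limitBound (N : ℕ) (s₀ α : ℝ) (p₀ : ℝ≥0∞) (t : ℝ≥0) : ℝ≥0∞ :=
  max (ENNReal.ofReal (memberConst N α t))
    (ENNReal.ofReal ((t / α) ^ p₀.toReal / (1 - s₀)) ^ (1 / p₀.toReal))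

theorem limitBound_lt_top (N : ℕ) (s₀ α : ℝ) (p₀ : ℝ≥0∞) (t : ℝ≥0) :
    limitBound N s₀ α p₀ t < ∞ :=
  max_lt ENNReal.ofReal_lt_top (ENNReal.rpow_lt_top_of_nonneg (by positivity)
    ENNReal.ofReal_ne_top)

theorem tendsto_eLpNorm_one_of_tendsto (hΩ : MeasurableSet Ω) {v : baseSpace Ω p₀}
    {u : ℕ → baseSpace Ω p₀} (hu : Tendsto u atTop (𝓝 v)) :
    Tendsto (fun n => eLpNorm (fun x => extZero (toL1 (u n)) x - extZero (toL1 v) x) 1 volume)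
      atTop (𝓝 0) := by
  have h1 := tendsto_iff_edist_tendsto_0.1 ((continuous_toL1 (Ω := Ω) (p₀ := p₀)).tendsto v |>.comp hu)
  refine h1.congr fun n => ?_
  rw [← extZero_sub_ae hΩ, Function.comp_apply, edist_eq_enorm_sub, Lp.enorm_def,
    eLpNorm_extZero hΩ]

/-- Convergence in the base space gives convergence in L^1, which the family improves to L^q with q
≥ p n eventually. This makes the varying norms converge, both of the functions and of their
translation differences. -/
theorem limit_member (hΩ : MeasurableSet Ω) {F : ℕ → LpOn Ω 1 → ℝ≥0∞}
    {p : ℕ → ℝ≥0∞} {s : ℕ → ℝ} {s₀ α β : ℝ}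
    (hp : ∀ n, 1 ≤ p n ∧ p n < ∞) (hs : ∀ n, 0 < s n ∧ s n < 1) (hα : 0 < α)
    (hF : ∀ n, Comparable α β (s n) (p n) (F n))
    (hp₀ : Tendsto p atTop (𝓝 p₀)) (hs₀ : Tendsto s atTop (𝓝 s₀)) (hs₀pos : 0 < s₀)
    {t : ℝ≥0} {v : baseSpace Ω p₀} {u : ℕ → baseSpace Ω p₀} (hu : Tendsto u atTop (𝓝 v))
    (hmem : ∀ n, IsMember (s n) (p n) (F n) t (toL1 (u n))) :
    eLpNorm (toL1 v) p₀ (volume.restrict Ω) = 1 ∧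
      seminormSP s₀ p₀ (extZero (toL1 v)) ≤ limitBound N s₀ α p₀ t := by
  have hΩf : volume Ω < ∞ := Fact.out
  have hp₀1 : 1 ≤ p₀ := Fact.out
  obtain ⟨q, γ, hq1, hpq, hγ, hev⟩ := exists_exponent N hp₀1 hp₀ hs₀ hs₀pos
  set C := memberConst N α t with hCdef
  have hC : 0 < C := memberConst_pos N hα t
  set w : ℕ → Euc N → ℝ := fun n => extZero (toL1 (u n)) with hw
  set f : Euc N → ℝ := extZero (toL1 v) with hf
  have hwm : ∀ n, Measurable (w n) := fun n => measurable_extZero hΩ _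
  have hfm : Measurable f := measurable_extZero hΩ _
  have hf0 : ∀ x, x ∉ Ω → f x = 0 := fun x hx => extZero_of_notMem _ hx
  have hfam : ∀ᶠ n in atTop, InFamily Ω q γ C (w n) := by
    filter_upwards [hev] with n hn
    exact (hmem n).inFamily hΩ (hF n) hα (hs n).1 (hs n).2 (hp n).1 (hp n).2.ne hn.1 hn.2
  have hlim1 := tendsto_eLpNorm_one_of_tendsto hΩ hu
  have hf1 : MemLp f 1 volume :=
    ⟨hfm.aestronglyMeasurable, by rw [eLpNorm_extZero hΩ]; exact (Lp.memLp (toL1 v)).2⟩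
  have hlimq : Tendsto (fun n => eLpNorm (fun x => w n x - f x) q volume) atTop (𝓝 0) :=
    tendsto_eLpNorm_sub_of_family hΩ hΩf hq1.le hγ hC hfam hfm hf0 hf1 hlim1
  have hfq : MemLp f q volume := by
    refine ⟨hfm.aestronglyMeasurable, ?_⟩
    obtain ⟨n, hn1, hn2⟩ := (hfam.and (hlimq.eventually (gt_mem_nhds ENNReal.zero_lt_top))).exists
    have e : f = w n - fun x => w n x - f x := by ext x; simp
    rw [e]
    refine (eLpNorm_sub_le (hwm n).aestronglyMeasurable
      ((hwm n).sub hfm).aestronglyMeasurable hq1.le).trans_lt (ENNReal.add_lt_top.2 ⟨?_, hn2⟩)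
    refine (hn1.eLpNorm_le hγ hC hq1.le).trans_lt (ENNReal.add_lt_top.2
      ⟨ENNReal.ofReal_lt_top, ENNReal.mul_lt_top ENNReal.ofReal_lt_top ?_⟩)
    exact ENNReal.rpow_lt_top_of_nonneg (by positivity) hΩf.ne
  have hrestr : ∀ T : Set (Euc N), Tendsto
      (fun n => eLpNorm (fun x => w n x - f x) q (volume.restrict T)) atTop (𝓝 0) := fun T =>
    tendsto_of_tendsto_of_tendsto_of_le_of_le tendsto_const_nhds hlimq (fun _ => zero_le)
      fun n => eLpNorm_mono_measure _ Measure.restrict_le_self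
  have hpev : ∀ᶠ n in atTop, p n ≤ q := hev.mono fun n hn => hn.1
  constructor
  · have h1 := tendsto_eLpNorm_of_tendsto (μ := volume.restrict Ω) (F := w) (f := f)
      (fun n => (hwm n).aestronglyMeasurable) (hfq.restrict Ω) hp₀1 hp₀ (fun n => (hp n).1)
      (fun n => (hp n).2.ne) hpev (hrestr Ω)
    have h2 : ∀ (z : LpOn Ω 1) r, eLpNorm (extZero z) r (volume.restrict Ω) =
        eLpNorm z r (volume.restrict Ω) := fun z r => by
      rw [eLpNorm_restrict_eq_of_support_subset
        (support_subset_of_zero_off fun x hx => extZero_of_notMem z hx), eLpNorm_extZero hΩ]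
    rw [← h2]
    refine tendsto_nhds_unique h1 ?_
    refine tendsto_const_nhds.congr fun n => ?_
    rw [hw, h2, (hmem n).sphere]
  · unfold seminormSP
    split_ifs with hcase
    · refine le_trans ?_ (le_max_right _ _)
      obtain ⟨ns, hns, hae⟩ := (tendstoInMeasure_of_tendsto_eLpNorm one_ne_zero
        (fun n => (hwm n).aestronglyMeasurable) hfm.aestronglyMeasurable hlim1).exists_seq_tendsto_ae
      have hsns := hs₀.comp hns.tendsto_atTop
      have hpns := (ENNReal.tendsto_toReal hcase.2).comp (hp₀.comp hns.tendsto_atTop)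
      have hp₀r : 0 < p₀.toReal := ENNReal.toReal_pos (one_pos.trans_le hp₀1).ne' hcase.2
      refine gagliardo_le_of_tendsto_ae (u := fun k => w (ns k)) (s := fun k => s (ns k))
        (p := fun k => (p (ns k)).toReal) (fun k => hwm _) hsns hpns hp₀r
        (fun k => ENNReal.toReal_pos (one_pos.trans_le (hp _).1).ne' (hp _).2.ne) hae
        (A := fun k => ENNReal.ofReal ((t / α) ^ (p (ns k)).toReal / (1 - s (ns k)))) ?_
        (Eventually.of_forall fun k => (hmem _).gagliardo_rpow_le (hF _) hα (hs _).2 (hp _).1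
          (hp _).2.ne)
      refine ENNReal.tendsto_ofReal (Tendsto.div ?_ (tendsto_const_nhds.sub hsns)
        (by linarith [hcase.1]))
      exact tendsto_const_nhds.rpow hpns (Or.inr hp₀r)
    · refine le_trans ?_ (le_max_left _ _)
      refine iSup₂_le fun h hh => ?_
      have hpos : 0 < ‖h‖ := norm_pos_iff.2 hh
      have hden : ‖h‖ₑ ^ s₀ = ENNReal.ofReal (‖h‖ ^ s₀) := by
        rw [← ofReal_norm, ENNReal.ofReal_rpow_of_pos hpos]
      rw [hden, ENNReal.div_le_iff (ENNReal.ofReal_pos.2 (by positivity)).ne'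
        ENNReal.ofReal_ne_top, ← ENNReal.ofReal_mul hC.le]
      -- A set of finite measure off which translation differences by h vanish. The limit theorem
      -- for norms needs a finite measure.
      set T : Set (Euc N) := Ω ∪ (fun x => x + h) ⁻¹' Ω with hT
      have hTf : volume T < ∞ := by
        refine (measure_union_le _ _).trans_lt (ENNReal.add_lt_top.2 ⟨hΩf, ?_⟩)
        rwa [measure_preimage_add_right]
      have : Fact (volume T < ∞) := ⟨hTf⟩
      have hsupp : ∀ z : Euc N → ℝ, (∀ x, x ∉ Ω → z x = 0) → ∀ r,
          eLpNorm (fun x => z (x + h) - z x) r (volume.restrict T) =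
            eLpNorm (fun x => z (x + h) - z x) r volume := fun z hz r => by
        refine eLpNorm_restrict_eq_of_support_subset (support_subset_of_zero_off fun x hx => ?_)
        simp only [hT, mem_union, mem_preimage, not_or] at hx
        rw [hz _ hx.1, hz _ hx.2, sub_zero]
      have hshift : MemLp (fun x => f (x + h)) q volume :=
        hfq.comp_measurePreserving (measurePreserving_add_right volume h)
      have hlimT : Tendsto (fun n => eLpNorm (fun x => (w n (x + h) - w n x) - (f (x + h) - f x)) q
          (volume.restrict T)) atTop (𝓝 0) := by
        have h2 := hlimq.add hlimq
        rw [add_zero] at h2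
        refine tendsto_of_tendsto_of_tendsto_of_le_of_le tendsto_const_nhds h2 (fun _ => zero_le)
          fun n => (eLpNorm_mono_measure _ Measure.restrict_le_self).trans ?_
        have hd : Measurable fun x => w n x - f x := (hwm n).sub hfm
        have e : (fun x => (w n (x + h) - w n x) - (f (x + h) - f x)) =
            (fun x => w n (x + h) - f (x + h)) - fun x => w n x - f x := by
          ext x; simp only [Pi.sub_apply]; ring
        rw [e]
        refine (eLpNorm_sub_le (hd.comp (measurable_add_const h)).aestronglyMeasurable
          hd.aestronglyMeasurable hq1.le).trans ?_
        gcongr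
        exact (eLpNorm_translation hd.aestronglyMeasurable q h).le
      have h1 := tendsto_eLpNorm_of_tendsto (μ := volume.restrict T)
        (F := fun n x => w n (x + h) - w n x) (f := fun x => f (x + h) - f x)
        (fun n => (measurable_translation_sub (hwm n) h).aestronglyMeasurable)
        ((hshift.sub hfq).restrict T) hp₀1 hp₀ (fun n => (hp n).1) (fun n => (hp n).2.ne) hpev hlimT
      rw [hsupp f hf0] at h1
      have h2 : Tendsto (fun n => ENNReal.ofReal (C * ‖h‖ ^ s n)) atTop
          (𝓝 (ENNReal.ofReal (C * ‖h‖ ^ s₀))) :=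
        ENNReal.tendsto_ofReal ((tendsto_const_nhds.rpow hs₀ (Or.inl hpos.ne')).const_mul C)
      refine le_of_tendsto_of_tendsto' h1 h2 fun n => ?_
      rw [hsupp (w n) fun x hx => extZero_of_notMem _ hx]
      exact (hmem n).translationBound hΩ (hF n) hα (hs n).1 (hs n).2 (hp n).1 (hp n).2.ne h

theorem J_gammaLiminf (hΩ : MeasurableSet Ω) {F : ℕ → LpOn Ω 1 → ℝ≥0∞} {F₀ : LpOn Ω 1 → ℝ≥0∞}
    {p : ℕ → ℝ≥0∞} {s : ℕ → ℝ} {s₀ α β : ℝ}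
    (hp : ∀ n, 1 ≤ p n ∧ p n < ∞) (hs : ∀ n, 0 < s n ∧ s n < 1) (hα : 0 < α)
    (hF : ∀ n, Comparable α β (s n) (p n) (F n))
    (hp₀ : Tendsto p atTop (𝓝 p₀)) (hs₀ : Tendsto s atTop (𝓝 s₀)) (hs₀pos : 0 < s₀)
    (hΓ : GammaLiminf (fun n (v : baseSpace Ω p₀) => F n (toL1 v))
      (fun v : baseSpace Ω p₀ => F₀ (toL1 v))) (k : ℕ) :
    GammaLiminf (fun n (G : Ksym Ω p₀) => J k (s n) (p n) (F n) G)
      (fun G : Ksym Ω p₀ => J k s₀ p₀ F₀ G) := by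
  intro G₀ G hG
  have hp₀1 : 1 ≤ p₀ := Fact.out
  refine le_of_forall_gt fun c hc => ?_
  obtain ⟨t', hlt, htc⟩ := exists_between hc
  lift t' to ℝ≥0 using htc.ne_top with t
  -- A subsequence of level t suffices to show that `G₀` is admissible.
  obtain ⟨φ, hφ, hφt⟩ := extraction_of_frequently_atTop (frequently_lt_of_liminf_lt (by isBoundedDefault) hlt)
  have hGφ := hG.comp hφ.tendsto_atTop
  have hlimit : ∀ v ∈ G₀.1, eLpNorm (toL1 v) p₀ (volume.restrict Ω) = 1 ∧
      seminormSP s₀ p₀ (extZero (toL1 v)) ≤ limitBound N s₀ α p₀ t := by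
    intro v hv
    obtain ⟨u, hu, huv⟩ := exists_seq_of_tendsto hGφ hv
    exact limit_member hΩ (F := fun n => F (φ n)) (p := fun n => p (φ n)) (s := fun n => s (φ n))
      (fun n => hp _) (fun n => hs _) hα (fun n => hF _) (hp₀.comp hφ.tendsto_atTop)
      (hs₀.comp hφ.tendsto_atTop) hs₀pos huv fun n => isMember_of_J_le (hφt n).le (hu n)
  have hA : Admissible k s₀ p₀ G₀ := by
    refine ⟨fun v hv => ⟨⟨(measurable_extZero hΩ _).aestronglyMeasurable, ?_⟩,
      (hlimit v hv).2.trans_lt (limitBound_lt_top _ _ _ _ _)⟩,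
      fun w _ hw => admissible_closed hΩ G₀ hp₀1 w hw, ?_, fun v hv => (hlimit v hv).1, ?_⟩
    · rw [eLpNorm_extZero hΩ, (hlimit v hv).1]; exact ENNReal.one_lt_top
    · refine ⟨1 + (limitBound N s₀ α p₀ t).toNNReal, fun v hv => ?_⟩
      rw [ENNReal.coe_add, ENNReal.coe_toNNReal (limitBound_lt_top _ _ _ _ _).ne]
      refine add_le_add ?_ (hlimit v hv).2
      rw [eLpNorm_extZero hΩ, (hlimit v hv).1, ENNReal.coe_one]
    · exact le_genus_of_tendsto hGφ fun n =>
        ((J_le_iff ENNReal.coe_ne_top).1 (hφt n).le).1.genus_ge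
  refine lt_of_le_of_lt ?_ hc
  change J k s₀ p₀ F₀ G₀ ≤ _
  rw [J, if_pos hA]
  refine iSup₂_le fun v hv => ?_
  -- Here the full sequence is used: the liminf inequality for F compares with the liminf over all
  -- n, and each term is bounded by `J` even where `J` is infinite.
  obtain ⟨u, hu, huv⟩ := exists_seq_of_tendsto hG hv
  refine (hΓ v u huv).trans (liminf_le_liminf (Eventually.of_forall fun n => ?_))
  change F n (toL1 (u n)) ≤ J k (s n) (p n) (F n) (G n)
  unfold J
  split_ifs
  · exact le_iSup₂ (f := fun (v : baseSpace Ω p₀) (_ : v ∈ (G n).1) => F n (toL1 v)) (u n) (hu n)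
  · exact le_top

end LimitMembers

/-! ### Lower bound for the infima -/

section InfimaLower

/-- `GammaLiminf` speaks of full sequences, so the gaps of a subsequence are filled with its limit.
-/
theorem tendsto_extend_of_strictMono {X : Type*} [TopologicalSpace X] {φ : ℕ → ℕ}
    (hφ : StrictMono φ) {x : ℕ → X} {a : X} (hx : Tendsto x atTop (𝓝 a)) :
    Tendsto (Function.extend φ x fun _ => a) atTop (𝓝 a) := by
  intro U hU
  obtain ⟨J, hJ⟩ := eventually_atTop.1 (hx hU)
  refine eventually_atTop.2 ⟨φ J, fun n hn => ?_⟩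
  change Function.extend φ x (fun _ => a) n ∈ U
  by_cases h : ∃ j, φ j = n
  · obtain ⟨j, rfl⟩ := h
    rw [hφ.injective.extend_apply]
    exact hJ j (hφ.le_iff_le.1 hn)
  · rw [Function.extend_apply' _ _ _ h]
    exact mem_of_mem_nhds hU

theorem iInf_le_liminf_iInf {X : Type*} [MetricSpace X] {F : ℕ → X → ℝ≥0∞} {F₀ : X → ℝ≥0∞}
    (hcoer : EventuallyEquicoercive F) (hΓ : GammaLiminf F F₀) :
    ⨅ x, F₀ x ≤ liminf (fun n => ⨅ x, F n x) atTop := by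
  refine le_of_forall_gt fun c hc => ?_
  obtain ⟨t', hlt, htc⟩ := exists_between hc
  lift t' to ℝ≥0 using htc.ne_top with t
  obtain ⟨n₀, hn₀⟩ := hcoer
  obtain ⟨K, hK, hKt⟩ := hn₀ t
  obtain ⟨φ, hφ, hφt⟩ := extraction_of_frequently_atTop
    ((frequently_lt_of_liminf_lt (by isBoundedDefault) hlt).and_eventually (eventually_ge_atTop n₀))
  have hex : ∀ j, ∃ x, F (φ j) x < t := fun j => iInf_lt_iff.1 (hφt j).1
  choose x hx using hex
  obtain ⟨a, -, ψ, hψ, hlim⟩ := hK.tendsto_subseq fun j => hKt _ (hφt j).2 (hx j).le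
  have hmono : StrictMono (φ ∘ ψ) := hφ.comp hψ
  have h1 := hΓ a _ (tendsto_extend_of_strictMono hmono hlim)
  refine lt_of_le_of_lt ((iInf_le F₀ a).trans (h1.trans ?_)) htc
  refine liminf_le_of_frequently_le' (frequently_atTop.2 fun n => ?_)
  refine ⟨(φ ∘ ψ) n, hmono.id_le n, ?_⟩
  rw [hmono.injective.extend_apply]
  exact (hx (ψ n)).le

end InfimaLower

/-! ### Odd partition of unity -/

section OddPartition

variable {E : Type*} [NormedAddCommGroup E] [NormedSpace ℝ E]

/-- Odd continuous coordinates on a symmetric compact set, with respect to finitely many of its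
points. -/
theorem exists_odd_coordinates {K : Set E} (hK : IsCompact K) {η : ℝ} (hη : 0 < η) :
    ∃ (T : Finset E) (c : E → E → ℝ), (∀ i ∈ T, i ∈ K) ∧ (∀ i ∈ T, ContinuousOn (c i) K) ∧
      (∀ i v, c i (-v) = -c i v) ∧ (∀ v ∈ K, ∑ i ∈ T, |c i v| ≤ 1) ∧
      ∀ u : E → E, (∀ i ∈ T, ‖u i - i‖ < η) → ∀ v ∈ K,
        ∃ i ∈ T, ‖∑ j ∈ T, c j v • u j - i‖ < 3 * η := by
  obtain ⟨t, htK, htf, htc⟩ := hK.finite_cover_balls hη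
  set T := htf.toFinset with hT
  -- Bumps about a finite net, and their even total D. The coordinates are (φ_i(v) - φ_i(-v)) /
  -- D(v), so that the sum of their absolute values is at most 1.
  let φ : E → E → ℝ := fun i v => max 0 (η - ‖v - i‖)
  let D : E → ℝ := fun v => ∑ i ∈ T, (φ i v + φ i (-v))
  have hφ0 : ∀ i v, 0 ≤ φ i v := fun i v => le_max_left _ _
  have hφc : ∀ i, Continuous (φ i) := fun i => by fun_prop
  have hDc : Continuous D := continuous_finsetSum _ fun i _ =>
    (hφc i).add ((hφc i).comp continuous_neg)
  have hmem : ∀ v ∈ K, ∃ i ∈ T, ‖v - i‖ < η := fun v hv => by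
    obtain ⟨i, hi, hvi⟩ := mem_iUnion₂.1 (htc hv)
    exact ⟨i, htf.mem_toFinset.2 hi, mem_ball_iff_norm.1 hvi⟩
  have hD : ∀ v ∈ K, 0 < D v := fun v hv => by
    obtain ⟨i, hi, hvi⟩ := hmem v hv
    refine Finset.sum_pos' (fun j _ => add_nonneg (hφ0 _ _) (hφ0 _ _)) ⟨i, hi, ?_⟩
    exact add_pos_of_pos_of_nonneg (lt_max_of_lt_right (by linarith)) (hφ0 _ _)
  have hDneg : ∀ v, D (-v) = D v := fun v =>
    Finset.sum_congr rfl fun i _ => by rw [neg_neg, add_comm]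
  refine ⟨T, fun i v => (φ i v - φ i (-v)) / D v, fun i hi => htK (htf.mem_toFinset.1 hi),
    fun i _ => ContinuousOn.div ((hφc i).sub ((hφc i).comp continuous_neg)).continuousOn
      hDc.continuousOn fun v hv => (hD v hv).ne', fun i v => ?_, fun v hv => ?_,
    fun u hu v hv => ?_⟩
  · beta_reduce
    rw [hDneg, neg_neg, ← neg_div, neg_sub]
  · calc ∑ i ∈ T, |(φ i v - φ i (-v)) / D v| ≤ ∑ i ∈ T, (φ i v + φ i (-v)) / D v := by
          refine Finset.sum_le_sum fun i _ => ?_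
          rw [abs_div, abs_of_pos (hD v hv)]
          refine div_le_div_of_nonneg_right ?_ (hD v hv).le
          rw [abs_le]
          constructor <;> linarith [hφ0 i v, hφ0 i (-v)]
      _ = 1 := by rw [← Finset.sum_div]; exact div_self (hD v hv).ne'
  -- Where the bump of i is nonzero at x, u_i is within η of i and i within η of x. So the
  -- combination is within 2η of v, and v is within η of a net point.
  · have hφu : ∀ i ∈ T, ∀ x, φ i x * ‖u i - x‖ ≤ φ i x * (2 * η) := fun i hi x => by
      rcases (hφ0 i x).eq_or_lt with h | h
      · rw [← h, zero_mul, zero_mul]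
      · have h1 : ‖x - i‖ < η := by
          by_contra hcon
          have : φ i x = 0 := max_eq_left (by linarith)
          linarith
        refine mul_le_mul_of_nonneg_left ?_ h.le
        have := norm_sub_le_norm_sub_add_norm_sub (u i) i x
        rw [norm_sub_rev i x] at this
        linarith [hu i hi]
    have hkey : ‖∑ j ∈ T, ((φ j v - φ j (-v)) / D v) • u j - v‖ ≤ 2 * η := by
      -- Each -u_j with weight φ_j(-v) is compared with v, that is, u_j with -v, where that bump
      -- lives.
      have e : ∑ j ∈ T, ((φ j v - φ j (-v)) / D v) • u j - v =
          (D v)⁻¹ • ∑ j ∈ T, (φ j v • (u j - v) - φ j (-v) • (u j - -v)) := by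
        have hv1 : v = (D v)⁻¹ • ∑ j ∈ T, (φ j v + φ j (-v)) • v := by
          rw [← Finset.sum_smul, smul_smul]
          exact (by rw [inv_mul_cancel₀ (hD v hv).ne', one_smul] :
            ((D v)⁻¹ * D v) • v = v).symm
        nth_rewrite 4 [hv1]
        rw [Finset.smul_sum, ← Finset.sum_sub_distrib, Finset.smul_sum]
        refine Finset.sum_congr rfl fun j _ => ?_
        rw [div_eq_inv_mul, mul_smul, ← smul_sub]
        congr 1
        module
      rw [e, norm_smul, norm_inv, Real.norm_of_nonneg (hD v hv).le, inv_mul_le_iff₀ (hD v hv)]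
      calc ‖∑ j ∈ T, (φ j v • (u j - v) - φ j (-v) • (u j - -v))‖
          ≤ ∑ j ∈ T, (φ j v + φ j (-v)) * (2 * η) := by
            refine norm_sum_le_of_le _ fun j hj => (norm_sub_le _ _).trans ?_
            rw [norm_smul, norm_smul, Real.norm_of_nonneg (hφ0 _ _), Real.norm_of_nonneg (hφ0 _ _),
              add_mul]
            exact add_le_add (hφu j hj v) (hφu j hj (-v))
        _ = D v * (2 * η) := by rw [← Finset.sum_mul]
    obtain ⟨i, hi, hvi⟩ := hmem v hv
    refine ⟨i, hi, ?_⟩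
    have := norm_sub_le_norm_sub_add_norm_sub (∑ j ∈ T, ((φ j v - φ j (-v)) / D v) • u j) v i
    linarith

end OddPartition

/-! ### Convex homogeneous functionals on finite spans -/

section Homogeneous

variable {E : Type*} [NormedAddCommGroup E] [NormedSpace ℝ E] {H : E → ℝ≥0∞}

theorem ConvexHomogeneous.add_le (hH : ConvexHomogeneous H) (u v : E) : H (u + v) ≤ H u + H v := by
  have h := hH.convex u v (1 / 2) (1 / 2) (by norm_num)
  have e : u + v = (2 : ℝ) • ((1 / 2 : ℝ≥0) • u + (1 / 2 : ℝ≥0) • v) := by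
    rw [NNReal.smul_def, NNReal.smul_def, ← smul_add, smul_smul]
    norm_num
  have h2 : ‖(2 : ℝ)‖ₑ = 2 := by rw [← ofReal_norm]; norm_num
  have hhalf : (2 : ℝ≥0∞) * ((1 / 2 : ℝ≥0) : ℝ≥0∞) = 1 := by
    rw [← ENNReal.coe_ofNat, ← ENNReal.coe_mul]; norm_num
  calc H (u + v) = 2 * H ((1 / 2 : ℝ≥0) • u + (1 / 2 : ℝ≥0) • v) := by
        rw [e, hH.homogeneous, h2]
    _ ≤ 2 * (((1 / 2 : ℝ≥0) : ℝ≥0∞) * H u + ((1 / 2 : ℝ≥0) : ℝ≥0∞) * H v) := by gcongr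
    _ = H u + H v := by rw [mul_add, ← mul_assoc, ← mul_assoc, hhalf, one_mul, one_mul]

/-- The hypotheses are those of an extended seminorm, so that the L^p norm on L^1(Ω) is covered as
well as F. -/
theorem apply_sum_smul_le (hadd : ∀ u v, H (u + v) ≤ H u + H v)
    (hsmul : ∀ (c : ℝ) v, H (c • v) = ‖c‖ₑ * H v) {ι : Type*} (T : Finset ι) (c : ι → ℝ)
    (u : ι → E) : H (∑ i ∈ T, c i • u i) ≤ ∑ i ∈ T, ‖c i‖ₑ * H (u i) := by
  classical
  induction T using Finset.induction_on with
  | empty =>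
    have := hsmul 0 0
    simp only [zero_smul, enorm_zero, zero_mul] at this
    simp [this]
  | insert a T ha ih =>
    rw [Finset.sum_insert ha, Finset.sum_insert ha]
    exact (hadd _ _).trans (add_le_add (hsmul _ _).le ih)

/-- H need be neither finite nor continuous on E. On combinations of finitely many vectors of finite
value it is Lipschitz in the coefficients. -/
theorem continuousOn_toReal_apply_sum (hadd : ∀ u v, H (u + v) ≤ H u + H v)
    (hsmul : ∀ (c : ℝ) v, H (c • v) = ‖c‖ₑ * H v) {ι X : Type*} [TopologicalSpace X]
    {T : Finset ι} {c : ι → X → ℝ} {K : Set X} (hc : ∀ i ∈ T, ContinuousOn (c i) K) {u : ι → E}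
    (hu : ∀ i ∈ T, H (u i) ≠ ∞) :
    ContinuousOn (fun x => (H (∑ i ∈ T, c i x • u i)).toReal) K := by
  have hfin : ∀ a : ι → ℝ, ∑ i ∈ T, ‖a i‖ₑ * H (u i) ≠ ∞ := fun a =>
    ENNReal.sum_ne_top.2 fun i hi => ENNReal.mul_ne_top enorm_ne_top (hu i hi)
  have hHfin : ∀ a : ι → ℝ, H (∑ i ∈ T, a i • u i) ≠ ∞ := fun a =>
    ((apply_sum_smul_le hadd hsmul T a u).trans_lt (lt_top_iff_ne_top.2 (hfin a))).ne
  have hle : ∀ a b : ι → ℝ, (H (∑ i ∈ T, a i • u i)).toReal ≤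
      (H (∑ i ∈ T, b i • u i)).toReal + ∑ i ∈ T, |a i - b i| * (H (u i)).toReal := by
    intro a b
    have e : ∑ i ∈ T, a i • u i = ∑ i ∈ T, b i • u i + ∑ i ∈ T, (a i - b i) • u i := by
      rw [← Finset.sum_add_distrib]
      exact Finset.sum_congr rfl fun i _ => by rw [← add_smul, add_sub_cancel]
    have h1 : H (∑ i ∈ T, a i • u i) ≤
        H (∑ i ∈ T, b i • u i) + ∑ i ∈ T, ‖a i - b i‖ₑ * H (u i) := by
      rw [e]
      exact (hadd _ _).trans (add_le_add le_rfl (apply_sum_smul_le hadd hsmul T _ u))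
    have h2 := ENNReal.toReal_mono (ENNReal.add_ne_top.2 ⟨hHfin b, hfin fun i => a i - b i⟩) h1
    rw [ENNReal.toReal_add (hHfin b) (hfin fun i => a i - b i), ENNReal.toReal_sum
      fun i hi => ENNReal.mul_ne_top enorm_ne_top (hu i hi)] at h2
    simpa [ENNReal.toReal_mul] using h2
  intro x hx
  have hlim : Tendsto (fun y => ∑ i ∈ T, |c i y - c i x| * (H (u i)).toReal) (𝓝[K] x) (𝓝 0) := by
    rw [← Finset.sum_const_zero (s := T)]
    refine tendsto_finsetSum _ fun i hi => ?_
    have := (((hc i hi x hx).tendsto.sub_const (c i x)).abs).mul_const (H (u i)).toReal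
    simpa using this
  rw [ContinuousWithinAt, tendsto_iff_dist_tendsto_zero]
  refine squeeze_zero (fun _ => dist_nonneg) (fun y => ?_) hlim
  rw [Real.dist_eq, abs_le]
  have h1 := hle (fun i => c i y) fun i => c i x
  have h2 := hle (fun i => c i x) fun i => c i y
  simp_rw [abs_sub_comm (c _ x)] at h2
  constructor <;> linarith

end Homogeneous

/-! ### Upper bound for the infima -/

section InfimaUpper

variable {N : ℕ} {Ω : Set (Euc N)}

theorem eLpNorm_add_le_LpOn {p : ℝ≥0∞} (hp : 1 ≤ p) (u v : LpOn Ω 1) :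
    eLpNorm (u + v : LpOn Ω 1) p (volume.restrict Ω) ≤
      eLpNorm u p (volume.restrict Ω) + eLpNorm v p (volume.restrict Ω) := by
  rw [eLpNorm_congr_ae (Lp.coeFn_add u v)]
  exact eLpNorm_add_le (Lp.aestronglyMeasurable u) (Lp.aestronglyMeasurable v) hp

theorem eLpNorm_smul_LpOn {p : ℝ≥0∞} (c : ℝ) (v : LpOn Ω 1) :
    eLpNorm (c • v : LpOn Ω 1) p (volume.restrict Ω) =
      ‖c‖ₑ * eLpNorm v p (volume.restrict Ω) := by
  rw [eLpNorm_congr_ae (Lp.coeFn_smul c v), eLpNorm_const_smul]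

variable {p₀ : ℝ≥0∞} [Fact (1 ≤ p₀)] [Fact (volume Ω < ∞)]

/-- On the unit sphere of the limit exponent, nearby functions have norms near `1`. -/
theorem eventually_le_eLpNorm_add {p : ℕ → ℝ≥0∞} (hp : ∀ n, 1 ≤ p n ∧ p n < ∞)
    (hp₀ : Tendsto p atTop (𝓝 p₀)) {v : baseSpace Ω p₀}
    (hv : eLpNorm (toL1 v) p₀ (volume.restrict Ω) = 1) {ρ : ℝ≥0∞} (hρ : ρ < 1) :
    ∀ᶠ n in atTop, ∀ w : baseSpace Ω p₀,
      ρ ≤ eLpNorm (toL1 w) (p n) (volume.restrict Ω) + edist w v * max 1 (volume Ω) := by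
  have hp₀1 : 1 ≤ p₀ := Fact.out
  set μ := (volume : Measure (Euc N)).restrict Ω with hμ
  have hμΩ : μ univ = volume Ω := Measure.restrict_apply_univ Ω
  set m := max 1 (volume Ω) with hm
  have hm1 : 1 ≤ m := le_max_left _ _
  have hmt : m ≠ ∞ := max_one_volume_ne_top
  have hm0 : 0 < m.toReal := ENNReal.toReal_pos (one_pos.trans_le hm1).ne' hmt
  -- Where p n exceeds p₀, v need not lie in L^(p n). The norm is therefore taken at the smaller
  -- exponent, and returning to p n costs by Hölder a factor that tends to 1.
  set r : ℕ → ℝ≥0∞ := fun n => min (p n) p₀ with hr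
  have hr1 : ∀ n, 1 ≤ r n := fun n => le_min (hp n).1 hp₀1
  have hrt : ∀ n, r n ≠ ∞ := fun n => ((min_le_left _ _).trans_lt (hp n).2).ne
  have hrlim : Tendsto r atTop (𝓝 p₀) := by
    simpa using hp₀.min (tendsto_const_nhds (x := p₀))
  have h1 : Tendsto (fun n => eLpNorm (toL1 v) (r n) μ) atTop (𝓝 1) := by
    have h := tendsto_eLpNorm_exponent (memLp_toL1 v) hp₀1 hrlim hr1 hrt
      (Eventually.of_forall fun n => min_le_right _ _)
    rwa [hv] at h
  set e : ℕ → ℝ := fun n => 1 / (r n).toReal - 1 / (p n).toReal with he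
  have he0 : ∀ n, 0 ≤ e n := fun n =>
    sub_nonneg.2 (one_div_toReal_anti (hr1 n) (min_le_left _ _))
  have helim : Tendsto e atTop (𝓝 0) := by
    have h := (tendsto_one_div_toReal hp₀1 hrlim).sub (tendsto_one_div_toReal hp₀1 hp₀)
    rwa [sub_self] at h
  have hM : Tendsto (fun n => m ^ e n) atTop (𝓝 1) := by
    have h2 := ENNReal.tendsto_ofReal
      ((tendsto_const_nhds (x := m.toReal)).rpow helim (Or.inl hm0.ne'))
    rw [Real.rpow_zero, ENNReal.ofReal_one] at h2
    refine h2.congr fun n => ?_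
    rw [← ENNReal.ofReal_rpow_of_pos hm0, ENNReal.ofReal_toReal hmt]
  have hdiv : Tendsto (fun n => eLpNorm (toL1 v) (r n) μ / m ^ e n) atTop (𝓝 1) := by
    simpa using ENNReal.Tendsto.div h1 (Or.inl one_ne_zero) hM (Or.inl ENNReal.one_ne_top)
  filter_upwards [hdiv.eventually (lt_mem_nhds hρ)] with n hn w
  refine hn.le.trans ?_
  have hMge : 1 ≤ m ^ e n := by
    simpa using ENNReal.rpow_le_rpow hm1 (he0 n)
  have hM0 : m ^ e n ≠ 0 := (one_pos.trans_le hMge).ne'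
  have hMt : m ^ e n ≠ ∞ := ENNReal.rpow_ne_top_of_nonneg (he0 n) hmt
  rw [ENNReal.div_le_iff hM0 hMt]
  have hwr : eLpNorm (toL1 w) (r n) μ ≤ eLpNorm (toL1 w) (p n) μ * m ^ e n := by
    refine (eLpNorm_le_eLpNorm_mul_rpow_measure_univ (min_le_left _ _)
      (Lp.aestronglyMeasurable (toL1 w))).trans ?_
    gcongr
    · exact he0 n
    · rw [hμΩ]; exact le_max_right _ _
  have hvw : eLpNorm (toL1 (v - w)) (r n) μ ≤ edist w v * m := by
    have h3 := eLpNorm_le_mul_of_exponent_le (μ := μ) (hr1 n) (min_le_right (p n) p₀)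
      (Lp.aestronglyMeasurable (toL1 (v - w)))
    rw [hμΩ] at h3
    refine h3.trans_eq ?_
    rw [edist_comm, edist_eq_enorm_sub]
    congr 1
    exact (Lp.enorm_def ((v - w : baseSpace Ω p₀) : LpOn Ω p₀)).symm
  have hsum : toL1 v = toL1 w + toL1 (v - w) := by rw [← toL1_add, add_sub_cancel]
  calc eLpNorm (toL1 v) (r n) μ
      ≤ eLpNorm (toL1 w) (r n) μ + eLpNorm (toL1 (v - w)) (r n) μ := by
        nth_rewrite 1 [hsum]; exact eLpNorm_add_le_LpOn (hr1 n) _ _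
    _ ≤ eLpNorm (toL1 w) (p n) μ * m ^ e n + edist w v * m * m ^ e n := by
        refine add_le_add hwr (hvw.trans ?_)
        exact le_mul_of_one_le_right' hMge
    _ = _ := by rw [add_mul]

theorem toL1_sum_smul {ι : Type*} (T : Finset ι) (c : ι → ℝ) (u : ι → baseSpace Ω p₀) :
    toL1 (∑ i ∈ T, c i • u i) = ∑ i ∈ T, c i • toL1 (u i) := by
  let L : baseSpace Ω p₀ →ₗ[ℝ] LpOn Ω 1 :=
    { toFun := toL1, map_add' := toL1_add, map_smul' := toL1_smul }
  exact (map_sum L _ _).trans (Finset.sum_congr rfl fun i _ => map_smul L _ _)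

/-- Closedness comes from compactness, and boundedness from the level through the lower bound of
`Comparable`. -/
theorem admissible_of_isMember (hΩ : MeasurableSet Ω) {k : ℕ} {s α β : ℝ} {p : ℝ≥0∞}
    {F : LpOn Ω 1 → ℝ≥0∞} {t : ℝ≥0} (hF : Comparable α β s p F) (hα : 0 < α) (hs1 : s < 1)
    (hp : 1 ≤ p) (hpt : p ≠ ∞) {G : Ksym Ω p₀} (hG : ∀ v ∈ G.1, IsMember s p F t (toL1 v))
    (hgenus : (k : ℕ∞) ≤ genus (G.1 : Set (baseSpace Ω p₀))) : Admissible k s p G := by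
  have hpr : 0 < p.toReal := ENNReal.toReal_pos (one_pos.trans_le hp).ne' hpt
  refine ⟨fun v hv => (hG v hv).memW0, fun w _ hw => admissible_closed hΩ G hp w hw, ?_,
    fun v hv => (hG v hv).sphere, hgenus⟩
  set B := ENNReal.ofReal ((t / α) ^ p.toReal / (1 - s)) ^ (1 / p.toReal) with hB
  have hBt : B ≠ ∞ := ENNReal.rpow_ne_top_of_nonneg (by positivity) ENNReal.ofReal_ne_top
  refine ⟨1 + B.toNNReal, fun v hv => ?_⟩
  rw [ENNReal.coe_add, ENNReal.coe_toNNReal hBt]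
  refine add_le_add ?_ ?_
  · rw [eLpNorm_extZero hΩ, (hG v hv).sphere, ENNReal.coe_one]
  · rw [seminormSP_eq_gagliardo hs1 hpt]
    have h := ENNReal.rpow_le_rpow ((hG v hv).gagliardo_rpow_le hF hα hs1 hp hpt)
      (one_div_nonneg.2 hpr.le)
    rwa [← ENNReal.rpow_mul, mul_one_div_cancel hpr.ne', ENNReal.rpow_one] at h

/-- Normalized odd combinations of finitely many functions of finite level form a competitor. -/
theorem exists_J_le (hΩ : MeasurableSet Ω) {k : ℕ} {s α β : ℝ} {p : ℝ≥0∞}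
    {F : LpOn Ω 1 → ℝ≥0∞} (hF : Comparable α β s p F) (hconv : ConvexHomogeneous F) (hα : 0 < α)
    (hs1 : s < 1) (hp : 1 ≤ p) (hpt : p ≠ ∞) {G : Ksym Ω p₀}
    (hgenus : (k : ℕ∞) ≤ genus (G.1 : Set (baseSpace Ω p₀)))
    {T : Finset (baseSpace Ω p₀)} {c : baseSpace Ω p₀ → baseSpace Ω p₀ → ℝ}
    {u : baseSpace Ω p₀ → baseSpace Ω p₀}
    (hc : ∀ i ∈ T, ContinuousOn (c i) (G.1 : Set (baseSpace Ω p₀)))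
    (hodd : ∀ i v, c i (-v) = -c i v) (hsum : ∀ v ∈ G.1, ∑ i ∈ T, |c i v| ≤ 1)
    {t ρ τ : ℝ≥0} (hρ : 0 < ρ) (htρ : t ≤ ρ * τ) (hFu : ∀ i ∈ T, F (toL1 (u i)) ≤ t)
    (hnorm : ∀ v ∈ G.1, (ρ : ℝ≥0∞) ≤
      eLpNorm (toL1 (∑ i ∈ T, c i v • u i)) p (volume.restrict Ω)) :
    ∃ G' : Ksym Ω p₀, J k s p F G' ≤ τ := by
  have hmemW : ∀ w : LpOn Ω 1, F w ≠ ∞ → MemW0 s p w := fun w hw =>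
    by_contra fun h => hw (hF.infinite w h)
  set P : baseSpace Ω p₀ → baseSpace Ω p₀ := fun v => ∑ i ∈ T, c i v • u i with hP
  set n : baseSpace Ω p₀ → ℝ≥0∞ := fun v => eLpNorm (toL1 (P v)) p (volume.restrict Ω) with hn
  have hu : ∀ i ∈ T, eLpNorm (toL1 (u i)) p (volume.restrict Ω) ≠ ∞ := fun i hi => by
    rw [← eLpNorm_extZero hΩ]
    exact (hmemW _ ((hFu i hi).trans_lt ENNReal.coe_lt_top).ne).1.2.ne
  have hPsum : ∀ v, toL1 (P v) = ∑ i ∈ T, c i v • toL1 (u i) := fun v =>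
    toL1_sum_smul T (fun i => c i v) u
  -- The L^p norm need not be continuous on the base space, as p may exceed p₀, but it is so along
  -- these finite combinations.
  have hnc : ContinuousOn (fun v => (n v).toReal) (G.1 : Set (baseSpace Ω p₀)) := by
    have h := continuousOn_toReal_apply_sum
      (H := fun w : LpOn Ω 1 => eLpNorm w p (volume.restrict Ω))
      (eLpNorm_add_le_LpOn hp) eLpNorm_smul_LpOn hc hu
    refine h.congr fun v _ => ?_
    simp only [hn, hPsum]
  have hnt : ∀ v, n v ≠ ∞ := fun v => by
    have h := apply_sum_smul_le (H := fun w : LpOn Ω 1 => eLpNorm w p (volume.restrict Ω))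
      (eLpNorm_add_le_LpOn hp) eLpNorm_smul_LpOn T (fun i => c i v) fun i => toL1 (u i)
    simp only [hn, hPsum]
    exact (h.trans_lt (ENNReal.sum_lt_top.2 fun i hi =>
      ENNReal.mul_lt_top enorm_lt_top (lt_top_iff_ne_top.2 (hu i hi)))).ne
  have hn0 : ∀ v ∈ G.1, 0 < (n v).toReal := fun v hv =>
    ENNReal.toReal_pos ((ENNReal.coe_pos.2 hρ).trans_le (hnorm v hv)).ne' (hnt v)
  have hPodd : ∀ v, P (-v) = -P v := fun v => by
    simp only [hP, hodd, neg_smul, Finset.sum_neg_distrib]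
  have hnodd : ∀ v, n (-v) = n v := fun v => by
    have : toL1 (P (-v)) = (-1 : ℝ) • toL1 (P v) := by rw [hPodd, toL1_neg, neg_one_smul]
    simp only [hn, this, eLpNorm_smul_LpOn]
    simp
  have hPc : ContinuousOn P (G.1 : Set (baseSpace Ω p₀)) :=
    continuousOn_finsetSum _ fun i hi => (hc i hi).smul continuousOn_const
  set Q : baseSpace Ω p₀ → baseSpace Ω p₀ := fun v => (n v).toReal⁻¹ • P v with hQ
  have hQc : ContinuousOn Q (G.1 : Set (baseSpace Ω p₀)) :=
    (hnc.inv₀ fun v hv => (hn0 v hv).ne').smul hPc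
  have hQodd : ∀ v, Q (-v) = -Q v := fun v => by
    simp only [hQ, hnodd, hPodd, smul_neg]
  let K : TopologicalSpace.NonemptyCompacts (baseSpace Ω p₀) :=
    ⟨⟨Q '' (G.1 : Set (baseSpace Ω p₀)), G.1.isCompact.image_of_continuousOn hQc⟩,
      G.1.nonempty.image Q⟩
  have hKsymm : ∀ w ∈ K, -w ∈ K := by
    rintro w ⟨v, hv, rfl⟩
    exact ⟨-v, G.2 v hv, hQodd v⟩
  have hinv : ∀ v ∈ G.1, ‖(n v).toReal⁻¹‖ₑ = (n v)⁻¹ := fun v hv => by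
    rw [← ofReal_norm, Real.norm_of_nonneg (inv_nonneg.2 (hn0 v hv).le),
      ENNReal.ofReal_inv_of_pos (hn0 v hv), ENNReal.ofReal_toReal (hnt v)]
  have hlevel : ∀ v ∈ G.1, F (toL1 (Q v)) ≤ τ := fun v hv => by
    -- Since Σ|c_i| ≤ 1, combining does not raise the level. Dividing by a norm of at least ρ gives
    -- at most t/ρ ≤ τ.
    have hPt : F (toL1 (P v)) ≤ t := by
      rw [hPsum]
      calc F (∑ i ∈ T, c i v • toL1 (u i)) ≤ ∑ i ∈ T, ‖c i v‖ₑ * F (toL1 (u i)) :=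
            apply_sum_smul_le hconv.add_le hconv.homogeneous T _ _
        _ ≤ ∑ i ∈ T, ‖c i v‖ₑ * t := by gcongr with i hi; exact hFu i hi
        _ = ENNReal.ofReal (∑ i ∈ T, |c i v|) * t := by
            rw [← Finset.sum_mul, ENNReal.ofReal_sum_of_nonneg fun i _ => abs_nonneg _]
            simp_rw [← Real.norm_eq_abs, ofReal_norm]
        _ ≤ 1 * t := by
            gcongr
            exact ENNReal.ofReal_le_one.2 (hsum v hv)
        _ = t := one_mul _
    rw [toL1_smul, hconv.homogeneous, hinv v hv, ← ENNReal.div_eq_inv_mul]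
    refine ENNReal.div_le_of_le_mul' (hPt.trans ?_)
    calc (t : ℝ≥0∞) ≤ ((ρ * τ : ℝ≥0) : ℝ≥0∞) := ENNReal.coe_le_coe.2 htρ
      _ = ρ * τ := ENNReal.coe_mul _ _
      _ ≤ n v * τ := by gcongr; exact hnorm v hv
  have hmember : ∀ w ∈ K, IsMember s p F τ (toL1 w) := by
    rintro w ⟨v, hv, rfl⟩
    refine ⟨hmemW _ ((hlevel v hv).trans_lt ENNReal.coe_lt_top).ne, ?_, hlevel v hv⟩
    rw [toL1_smul, eLpNorm_smul_LpOn, hinv v hv]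
    exact ENNReal.inv_mul_cancel ((ENNReal.coe_pos.2 hρ).trans_le (hnorm v hv)).ne' (hnt v)
  refine ⟨⟨K, hKsymm⟩, (J_le_iff ENNReal.coe_ne_top).2 ⟨?_, fun w hw => (hmember w hw).level⟩⟩
  refine admissible_of_isMember hΩ hF hα hs1 hp hpt hmember (hgenus.trans ?_)
  exact genus_le_of_odd_map Q hQc (mapsTo_image _ _) fun v _ => hQodd v

/-- A competitor for each large n suffices. It need not converge to G, only to have level at most τ
and genus at least k. -/
theorem limsup_iInf_J_le (hΩ : MeasurableSet Ω) {F : ℕ → LpOn Ω 1 → ℝ≥0∞} {F₀ : LpOn Ω 1 → ℝ≥0∞}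
    {p : ℕ → ℝ≥0∞} {s : ℕ → ℝ} {s₀ α β : ℝ}
    (hp : ∀ n, 1 ≤ p n ∧ p n < ∞) (hs : ∀ n, s n < 1) (hα : 0 < α)
    (hconv : ∀ n, ConvexHomogeneous (F n)) (hF : ∀ n, Comparable α β (s n) (p n) (F n))
    (hp₀ : Tendsto p atTop (𝓝 p₀))
    (hΓ : ∀ x : baseSpace Ω p₀, ∃ u : ℕ → baseSpace Ω p₀, Tendsto u atTop (𝓝 x) ∧
      limsup (fun n => F n (toL1 (u n))) atTop ≤ F₀ (toL1 x)) (k : ℕ) :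
    limsup (fun n => ⨅ G : Ksym Ω p₀, J k (s n) (p n) (F n) G) atTop ≤
      ⨅ G : Ksym Ω p₀, J k s₀ p₀ F₀ G := by
  refine le_iInf fun G => le_of_forall_gt fun c hc => ?_
  obtain ⟨τ', hlt, hτc⟩ := exists_between hc
  refine lt_of_le_of_lt ?_ hτc
  lift τ' to ℝ≥0 using hτc.ne_top with τ
  obtain ⟨t', hlt', htτ⟩ := exists_between hlt
  lift t' to ℝ≥0 using htτ.ne_top with t
  have htτ' : t < τ := ENNReal.coe_lt_coe.1 htτ
  have hτ0 : 0 < τ := (zero_le).trans_lt htτ'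
  obtain ⟨hA, hFG⟩ := (J_le_iff ENNReal.coe_ne_top).1 hlt'.le
  -- Room for the normalization: t/τ < ρ < ρ' < 1. Norms near points of G are almost at least ρ',
  -- the gap ρ' - ρ pays for the distance 3η, and t/ρ stays below τ.
  obtain ⟨ρ, hρt, hρ1⟩ := exists_between (show t / τ < 1 from (div_lt_one hτ0).2 htτ')
  obtain ⟨ρ', hρρ', hρ'1⟩ := exists_between hρ1
  have hρ0 : 0 < ρ := (zero_le).trans_lt hρt
  have htρ : t ≤ ρ * τ := ((div_lt_iff₀ hτ0).1 hρt).le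
  have hm := max_one_volume_ne_top (Ω := Ω)
  obtain ⟨η, hη, hηρ⟩ : ∃ η : ℝ, 0 < η ∧
      ENNReal.ofReal (3 * η) * max 1 (volume Ω) ≤ (ρ' : ℝ≥0∞) - ρ := by
    have h1 : Tendsto (fun η : ℝ => ENNReal.ofReal (3 * η) * max 1 (volume Ω)) (𝓝[>] 0) (𝓝 0) := by
      have h2 : Tendsto (fun η : ℝ => 3 * η) (𝓝 0) (𝓝 (3 * 0)) := tendsto_id.const_mul 3
      have h3 := ENNReal.Tendsto.mul_const (ENNReal.tendsto_ofReal h2) (Or.inr hm)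
      rw [mul_zero, ENNReal.ofReal_zero, zero_mul] at h3
      exact h3.mono_left nhdsWithin_le_nhds
    have hpos : (0 : ℝ≥0∞) < (ρ' : ℝ≥0∞) - ρ := tsub_pos_of_lt (ENNReal.coe_lt_coe.2 hρρ')
    obtain ⟨η, h4, h5⟩ := ((h1.eventually (gt_mem_nhds hpos)).and self_mem_nhdsWithin).exists
    exact ⟨η, h5, h4.le⟩
  obtain ⟨T, c, hTG, hcont, hodd, hsum, happrox⟩ := exists_odd_coordinates G.1.isCompact hη
  choose u hu huF using hΓ
  refine limsup_le_of_le (by isBoundedDefault) ?_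
  have h1 : ∀ᶠ n in atTop, ∀ i ∈ T, F n (toL1 (u i n)) ≤ t := by
    refine (Finset.eventually_all T).2 fun i hi => ?_
    have hlim : limsup (fun n => F n (toL1 (u i n))) atTop < t :=
      lt_of_le_of_lt ((huF i).trans (le_trans
        (le_iSup₂ (f := fun (v : baseSpace Ω p₀) (_ : v ∈ G.1) => F₀ (toL1 v)) i (hTG i hi))
        (by rw [J, if_pos hA]))) hlt'
    exact (eventually_lt_of_limsup_lt hlim).mono fun n hn => hn.le
  have h2 : ∀ᶠ n in atTop, ∀ i ∈ T, ‖u i n - i‖ < η :=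
    (Finset.eventually_all T).2 fun i _ =>
      ((Metric.tendsto_nhds.1 (hu i)) η hη).mono fun n hn => by rwa [dist_eq_norm] at hn
  have h3 : ∀ᶠ n in atTop, ∀ i ∈ T, ∀ w : baseSpace Ω p₀,
      (ρ' : ℝ≥0∞) ≤ eLpNorm (toL1 w) (p n) (volume.restrict Ω) + edist w i * max 1 (volume Ω) :=
    (Finset.eventually_all T).2 fun i hi =>
      eventually_le_eLpNorm_add hp hp₀ (hA.sphere i (hTG i hi)) (by exact_mod_cast hρ'1)
  filter_upwards [h1, h2, h3] with n hn1 hn2 hn3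
  obtain ⟨G', hG'⟩ := exists_J_le hΩ (hF n) (hconv n) hα (hs n) (hp n).1 (hp n).2.ne hA.genus_ge
    (u := fun i => u i n) hcont hodd hsum hρ0 htρ hn1 fun v hv => by
      obtain ⟨i, hi, hvi⟩ := happrox (fun i => u i n) hn2 v hv
      have h4 := hn3 i hi (∑ j ∈ T, c j v • u j n)
      have h5 : edist (∑ j ∈ T, c j v • u j n) i ≤ ENNReal.ofReal (3 * η) := by
        rw [edist_dist, dist_eq_norm]
        exact ENNReal.ofReal_le_ofReal hvi.le
      have h6 : edist (∑ j ∈ T, c j v • u j n) i * max 1 (volume Ω) ≤ (ρ' : ℝ≥0∞) - ρ :=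
        (mul_le_mul_left h5 _).trans hηρ
      have h7 : (ρ' : ℝ≥0∞) = ρ + ((ρ' : ℝ≥0∞) - ρ) :=
        (add_tsub_cancel_of_le (ENNReal.coe_le_coe.2 hρρ'.le)).symm
      have h8 : (ρ : ℝ≥0∞) + ((ρ' : ℝ≥0∞) - ρ) ≤
          eLpNorm (toL1 (∑ j ∈ T, c j v • u j n)) (p n) (volume.restrict Ω) +
            ((ρ' : ℝ≥0∞) - ρ) := h7 ▸ h4.trans (add_le_add le_rfl h6)
      exact (ENNReal.add_le_add_iff_right (ENNReal.sub_ne_top ENNReal.coe_ne_top)).1 h8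
  exact (iInf_le _ G').trans hG'

end InfimaUpper

end FracEig

end

theorem theorem3p1 {N : ℕ} (hN : 1 ≤ N) (Ω : Set (FracEig.Euc N)) (hΩ : IsOpen Ω)
    [Fact (volume Ω < ∞)]
    (F : ℕ → FracEig.LpOn Ω 1 → ℝ≥0∞) (F₀ : FracEig.LpOn Ω 1 → ℝ≥0∞)
    (p : ℕ → ℝ≥0∞) (s : ℕ → ℝ) (p₀ : ℝ≥0∞) [Fact (1 ≤ p₀)] (s₀ α β : ℝ)
    (hp : ∀ n, 1 ≤ p n ∧ p n < ∞) (hs : ∀ n, 0 < s n ∧ s n < 1)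
    (hα : 0 < α) (hαβ : α < β)
    (A1 : ∀ n, FracEig.ConvexHomogeneous (F n))
    (A2 : ∀ n, FracEig.Comparable α β (s n) (p n) (F n))
    (hp₀ : Tendsto p atTop (𝓝 p₀)) (hs₀ : Tendsto s atTop (𝓝 s₀))
    (hs₀_pos : 0 < s₀) (hs₀_le : s₀ ≤ 1)
    (A3 : FracEig.GammaConverges
      (fun n (v : FracEig.baseSpace Ω p₀) => F n (FracEig.toL1 v))
      (fun v : FracEig.baseSpace Ω p₀ => F₀ (FracEig.toL1 v)))
    (k : ℕ) (hk : 1 ≤ k) :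
    FracEig.EventuallyEquicoercive
      (fun n (G : FracEig.Ksym Ω p₀) => FracEig.J k (s n) (p n) (F n) G) ∧
    FracEig.GammaLiminf
      (fun n (G : FracEig.Ksym Ω p₀) => FracEig.J k (s n) (p n) (F n) G)
      (fun G : FracEig.Ksym Ω p₀ => FracEig.J k s₀ p₀ F₀ G) ∧
    Tendsto
      (fun n => ⨅ G : FracEig.Ksym Ω p₀, FracEig.J k (s n) (p n) (F n) G) atTop
      (𝓝 (⨅ G : FracEig.Ksym Ω p₀, FracEig.J k s₀ p₀ F₀ G)) := by
  have hcoer := FracEig.equicoercive (p₀ := p₀) hΩ.measurableSet hp hs hα A2 hp₀ hs₀ hs₀_pos k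
  have hlim := FracEig.J_gammaLiminf hΩ.measurableSet hp hs hα A2 hp₀ hs₀ hs₀_pos A3.1 k
  exact ⟨hcoer, hlim, tendsto_of_le_liminf_of_limsup_le (FracEig.iInf_le_liminf_iInf hcoer hlim)
    (FracEig.limsup_iInf_J_le hΩ.measurableSet hp (fun n => (hs n).2) hα A1 A2 hp₀ A3.2 k)⟩
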